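/- **$k$-server on HSTs.** Let $T$ be a finite rooted tree in which every non-root vertex $v$ is joined to its parent $p(v)$ by an edge of length $w_v>0$. For $\tau>0$, $T$ is a $\tau$-HST if along every root–leaf path consecutive edge lengths decrease by a factor of $\tau$ or more, that is, $w_v\le\tau\,w_{p(v)}$ for all $v$ such that $v$ and $p(v)$ are not the root. The metric space $(X,d)$ induced by $T$ consists of the leaves of $T$ (the vertices without children) with the tree distance $d$. In the $k$-server problem on $(X,d)$, a configuration is a set $A\subseteq X$ of $k$ points, and moving from $A$ to $B$ costs the earthmover distance $\min_{\sigma}\sum_{a\in A}d(a,\sigma(a))$, over bijections $\sigma:A\to B$. Starting from an initial configuration $A_0$, requests $r_1,\dots,r_m\in X$ are to be answered by configurations $A_1,\dots,A_m$ with $r_t\in A_t$, at cost $\sum_{t=1}^m d(A_{t-1},A_t)$. A randomized online algorithm chooses $A_t$ at random, with a law that depends only on $r_1,\dots,r_t$ and $A_0,A_1,\dots,A_{t-1}$; the request sequence is fixed independently of its random choices. $\mathrm{OPT}(A_0;r_1,\dots,r_m)$ is the least cost of an offline solution. **Theorem.** There is a randomized $O(\log^2 k)$-competitive algorithm for the $k$-server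 problem on metric spaces induced by a $\tau$-HST with $\tau\le 1/10$. That is, there is a universal constant $C>0$ such that for every $0<\tau\le 1/10$, every $\tau$-HST $T$ with induced metric space $(X,d)$, and every integer $1\le k\le|X|$, there is a number $b$ (depending only on $T$ and $k$) such that for every initial configuration $A_0$ there is a randomized online algorithm with $$\mathbb E\big[\mathrm{ALG}(A_0;r_1,\dots,r_m)\big]\;\le\; C\,(1+\log k)^2\cdot \mathrm{OPT}(A_0;r_1,\dots,r_m)+b$$ for every $m\ge 0$ and every request sequence $r_1,\dots,r_m\in X$. -/

import Mathlib

noncomputable section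

namespace KServer

/-! Rooted trees with edge lengths, and hierarchically separated trees. -/

/-- A rooted tree on the vertex set `V` with positive edge lengths. Every vertex other than the root
is joined by an edge to its parent, and `len v` is the length of that edge. The values
`parent root` and `len root` carry no meaning. -/
structure RootedTree (V : Type*) where
  root : V
  parent : V → V
  parent_root : parent root = root
  reaches_root : ∀ v, ∃ i : ℕ, parent^[i] v = root
  len : V → ℝ
  len_pos : ∀ v, v ≠ root → 0 < len v

namespace RootedTree

variable {V : Type*} (T : RootedTree V)

/-- `T.InSubtree a v`: the vertex `v` lies in the subtree rooted at `a`. -/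
def InSubtree (a v : V) : Prop := ∃ i : ℕ, T.parent^[i] v = a

/-- A leaf is a vertex without children. -/
def IsLeaf (v : V) : Prop := ∀ u, u ≠ T.root → T.parent u ≠ v

/-- The leaves of the tree. -/
abbrev Leaves : Type _ := {v : V // T.IsLeaf v}

open Classical in
/-- The tree distance: the total length of the edges on the path from `u` to `v`. The edge from
`a` to its parent is on this path iff exactly one of `u`, `v` lies in the subtree of `a`; for
`a = root` the condition never holds. -/
def pathDist [Fintype V] (u v : V) : ℝ :=
  ∑ a : V, if Xor (T.InSubtree a u) (T.InSubtree a v) then T.len a else 0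

/-- A `τ`-HST: going away from the root, consecutive edge lengths decrease by a factor of
`τ` or more, that is, each edge has length at most `τ` times that of the edge above it. -/
def IsHST (τ : ℝ) : Prop :=
  ∀ v, v ≠ T.root → T.parent v ≠ T.root → T.len v ≤ τ * T.len (T.parent v)

/-- The metric space `X` is induced by `T`: its points are the leaves of `T`, and its metric is the
tree distance. -/
def Induces [Fintype V] (X : Type*) [MetricSpace X] : Prop :=
  ∃ φ : X ≃ T.Leaves, ∀ x y : X, dist x y = T.pathDist (φ x) (φ y)

end RootedTree

/-! The `k`-server problem and randomized online algorithms. -/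

section Problem

variable {X : Type*} {k : ℕ}

/-- A configuration: the set of the `k` points at which there is a server. -/
abbrev Config (X : Type*) (k : ℕ) : Type _ := {A : Finset X // A.card = k}

/-- The earthmover distance between two configurations: the least total distance over which `k`
servers have to travel to get from the points of `A` to the points of `B`. -/
def moveCost [MetricSpace X] (A B : Config X k) : ℝ :=
  ⨅ e : {x // x ∈ A.1} ≃ {x // x ∈ B.1}, ∑ a : {x // x ∈ A.1}, dist (a : X) (e a : X)

/-- The cost of moving from the configuration `A` through the successive configurations in a
list. -/
def scheduleCost [MetricSpace X] : Config X k → List (Config X k) → ℝ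
  | _, [] => 0
  | A, B :: Bs => moveCost A B + scheduleCost B Bs

/-- An (offline) schedule serves a request sequence if it has one configuration for each request and
this configuration has a server at the requested point. -/
def Serves (rs : List X) (Bs : List (Config X k)) : Prop :=
  List.Forall₂ (fun r B => r ∈ B.1) rs Bs

/-- A randomized online algorithm. `next h r` is the law, given the past, of the configuration with
which the algorithm answers the request `r`, where `h` is the list (oldest first) of all earlier
requests together with the configurations with which they were answered. Future requests are not
available, and the new configuration always has a server at the requested point. -/
structure OnlineAlgorithm (X : Type*) (k : ℕ) where
  next : List (X × Config X k) → X → PMF (Config X k)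
  serves : ∀ h r, ∀ B ∈ (next h r).support, r ∈ B.1

/-- The conditional expectation, given the history `h` and the current configuration `A`, of the
cost that the algorithm pays on the remaining requests, by the law of total expectation over the
next configuration. The request sequence is fixed independently of the random choices. -/
def OnlineAlgorithm.costToGo [Fintype X] [MetricSpace X] (alg : OnlineAlgorithm X k) :
    List (X × Config X k) → Config X k → List X → ℝ
  | _, _, [] => 0
  | h, A, r :: rs =>
      ∑ B : Config X k, (alg.next h r B).toReal *
        (moveCost A B + alg.costToGo (h ++ [(r, B)]) B rs)

/-- The expected total cost of the algorithm on a request sequence, if the servers start in the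
configuration `A`. -/
def OnlineAlgorithm.expectedCost [Fintype X] [MetricSpace X] (alg : OnlineAlgorithm X k)
    (A : Config X k) (rs : List X) : ℝ :=
  alg.costToGo [] A rs

/-- Starting from the configuration `A`, the expected cost of the algorithm is at most `c` times the
optimal offline cost plus `b`, on every request sequence: the comparison is with every schedule
that starts in `A` and serves the requests, in particular with an optimal one. -/
def OnlineAlgorithm.IsCompetitive [Fintype X] [MetricSpace X] (alg : OnlineAlgorithm X k)
    (A : Config X k) (c b : ℝ) : Prop :=
  ∀ (rs : List X) (Bs : List (Config X k)), Serves rs Bs →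
    alg.expectedCost A rs ≤ c * scheduleCost A Bs + b

end Problem

end KServer

end

open Finset

set_option linter.unusedSectionVars false

/-- A rooted tree in which all leaves (the vertices at maximal depth, labelled by `X`) are equally
far from the root. -/
structure LevelTree (V X : Type*) where
  root : V
  par : V → V
  lev : V → ℕ
  depth : ℕ
  leaf : X → V
  depth_pos : 0 < depth
  lev_root : lev root = 0
  lev_par : ∀ v, v ≠ root → lev v = lev (par v) + 1
  lev_le : ∀ v, lev v ≤ depth
  lev_leaf : ∀ x, lev (leaf x) = depth
  leaf_inj : Function.Injective leaf
  leaf_surj : ∀ v, lev v = depth → ∃ x, leaf x = v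

namespace LevelTree

variable {V X : Type*} (T : LevelTree V X)

/-- The length of the edge above `v`. -/
noncomputable def w (v : V) : ℝ := (1 / 2) ^ T.lev v

lemma w_pos (v : V) : 0 < T.w v := by unfold w; positivity

lemma w_ge (v : V) : (1 / 2) ^ T.depth ≤ T.w v :=
  pow_le_pow_of_le_one (by norm_num) (by norm_num) (T.lev_le v)

/-- `v` lies in the subtree of `q`. -/
def Below (q v : V) : Prop := T.lev q ≤ T.lev v ∧ T.par^[T.lev v - T.lev q] v = q

instance [DecidableEq V] (q v : V) : Decidable (T.Below q v) := by
  unfold Below; infer_instance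

lemma eq_root_of_lev {v : V} (h : T.lev v = 0) : v = T.root := by
  by_contra hv
  have := T.lev_par v hv
  omega

lemma lev_iter (i : ℕ) (v : V) (h : i ≤ T.lev v) : T.lev (T.par^[i] v) = T.lev v - i := by
  induction i generalizing v with
  | zero => simp
  | succ i ih =>
    have hv : v ≠ T.root := by
      rintro rfl
      rw [T.lev_root] at h; omega
    have := T.lev_par v hv
    rw [Function.iterate_succ_apply, ih _ (by omega)]
    omega

lemma below_refl (v : V) : T.Below v v := ⟨le_rfl, by simp⟩

lemma below_root (v : V) : T.Below T.root v := by
  refine ⟨by rw [T.lev_root]; omega, T.eq_root_of_lev ?_⟩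
  rw [T.lev_iter _ _ (by omega), T.lev_root]; omega

lemma Below.eq_of_lev {q q' v : V} (h : T.Below q v) (h' : T.Below q' v)
    (hl : T.lev q = T.lev q') : q = q' := by
  rw [← h.2, ← h'.2, hl]

lemma Below.trans {a b c : V} (h : T.Below a b) (h' : T.Below b c) : T.Below a c := by
  refine ⟨h.1.trans h'.1, ?_⟩
  have e : T.lev c - T.lev a = (T.lev b - T.lev a) + (T.lev c - T.lev b) := by
    have := h.1; have := h'.1; omega
  rw [e, Function.iterate_add_apply, h'.2, h.2]

lemma below_par {v : V} (h : v ≠ T.root) : T.Below (T.par v) v := by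
  have := T.lev_par v h
  refine ⟨by omega, ?_⟩
  rw [this]; simp

lemma below_of_lev_le {a b v : V} (ha : T.Below a v) (hb : T.Below b v)
    (hl : T.lev a ≤ T.lev b) : T.Below a b := by
  refine ⟨hl, ?_⟩
  have e : T.lev v - T.lev a = (T.lev b - T.lev a) + (T.lev v - T.lev b) := by
    have := ha.1; have := hb.1; omega
  have := ha.2
  rwa [e, Function.iterate_add_apply, hb.2] at this

section Fin

variable [Fintype V] [DecidableEq V]

/-- The children of `p`. -/
def ch (p : V) : Finset V := univ.filter fun v => v ≠ T.root ∧ T.par v = p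

/-- The vertices of the subtree of `q`. -/
def sub (q : V) : Finset V := univ.filter fun v => T.Below q v

lemma mem_ch {p v : V} : v ∈ T.ch p ↔ v ≠ T.root ∧ T.par v = p := by simp [ch]

lemma mem_sub {q v : V} : v ∈ T.sub q ↔ T.Below q v := by simp [sub]

lemma lev_ch {p v : V} (h : v ∈ T.ch p) : T.lev v = T.lev p + 1 := by
  rw [mem_ch] at h
  rw [T.lev_par v h.1, h.2]

lemma w_ch {p v : V} (h : v ∈ T.ch p) : T.w v = T.w p / 2 := by
  unfold w; rw [T.lev_ch h, pow_succ]; ring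

lemma ne_root_of_ch {p v : V} (h : v ∈ T.ch p) : v ≠ T.root := (T.mem_ch.1 h).1

lemma below_ch {p v : V} (h : v ∈ T.ch p) : T.Below p v := by
  rw [mem_ch] at h
  rw [← h.2]; exact T.below_par h.1

lemma lev_lt_of_ch {p v : V} (h : v ∈ T.ch p) : T.lev p < T.depth := by
  have := T.lev_ch h
  have := T.lev_le v
  omega

lemma ch_leaf {p : V} (h : T.lev p = T.depth) : T.ch p = ∅ := by
  ext v
  simp only [notMem_empty, iff_false]
  intro hv
  have := T.lev_lt_of_ch hv
  omega

lemma exists_ch_below {q v : V} (h : T.Below q v) (hne : v ≠ q) :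
    ∃ c ∈ T.ch q, T.Below c v := by
  have hlt : T.lev q < T.lev v := by
    rcases h.1.lt_or_eq with h1 | h1
    · exact h1
    · exact absurd (by have := h.2; rw [h1] at this; simpa using this) hne
  have hc : T.lev (T.par^[T.lev v - T.lev q - 1] v) = T.lev q + 1 := by
    rw [T.lev_iter _ _ (by omega)]; omega
  refine ⟨T.par^[T.lev v - T.lev q - 1] v, ?_, ?_⟩
  · rw [mem_ch]
    refine ⟨?_, ?_⟩
    · intro h0
      rw [h0, T.lev_root] at hc; omega
    · rw [← Function.iterate_succ_apply' T.par]
      have : (T.lev v - T.lev q - 1).succ = T.lev v - T.lev q := by omega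
      rw [this, h.2]
  · refine ⟨by omega, ?_⟩
    rw [hc]; congr 1

lemma eq_of_below_ch {p c c' v : V} (hc : c ∈ T.ch p) (hc' : c' ∈ T.ch p) (h : T.Below c v)
    (h' : T.Below c' v) : c = c' :=
  h.eq_of_lev T h' (by rw [T.lev_ch hc, T.lev_ch hc'])

lemma not_below_of_ch {p c : V} (hc : c ∈ T.ch p) : ¬ T.Below c p := by
  intro h
  have := h.1
  have := T.lev_ch hc
  omega

lemma sub_eq (q : V) : T.sub q = insert q ((T.ch q).biUnion T.sub) := by
  ext v
  simp only [mem_sub, mem_insert, mem_biUnion]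
  constructor
  · intro h
    by_cases hv : v = q
    · exact Or.inl hv
    · obtain ⟨c, hc, hb⟩ := T.exists_ch_below h hv
      exact Or.inr ⟨c, hc, hb⟩
  · rintro (rfl | ⟨c, hc, hb⟩)
    · exact T.below_refl _
    · exact (T.below_ch hc).trans T hb

lemma sum_sub {M : Type*} [AddCommMonoid M] (f : V → M) (q : V) :
    ∑ v ∈ T.sub q, f v = f q + ∑ c ∈ T.ch q, ∑ v ∈ T.sub c, f v := by
  rw [sub_eq, sum_insert, sum_biUnion]
  · intro c hc c' hc' hne
    refine Finset.disjoint_left.2 fun v hv hv' => hne ?_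
    exact T.eq_of_below_ch hc hc' (T.mem_sub.1 hv) (T.mem_sub.1 hv')
  · simp only [mem_biUnion, mem_sub, not_exists, not_and]
    exact fun c hc => T.not_below_of_ch hc

/-- Induction from the leaves towards the root. -/
lemma up_induction {P : V → Prop} (h : ∀ p, (∀ c ∈ T.ch p, P c) → P p) (v : V) : P v := by
  have : ∀ n v, T.depth - T.lev v = n → P v := by
    intro n
    induction n using Nat.strong_induction_on with
    | _ n ih =>
      intro v hv
      refine h v fun c hc => ih _ ?_ c rfl
      have := T.lev_ch hc
      have := T.lev_le c
      omega
  exact this _ v rfl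

/-- Induction from the root towards the leaves. -/
lemma down_induction {P : V → Prop} (h0 : P T.root)
    (h : ∀ p, P p → ∀ c ∈ T.ch p, P c) (v : V) : P v := by
  have : ∀ n v, T.lev v = n → P v := by
    intro n
    induction n with
    | zero => intro v hv; rw [T.eq_root_of_lev hv]; exact h0
    | succ n ih =>
      intro v hv
      have hr : v ≠ T.root := by rintro rfl; rw [T.lev_root] at hv; omega
      have := T.lev_par v hr
      exact h (T.par v) (ih _ (by omega)) v (T.mem_ch.2 ⟨hr, rfl⟩)
  exact this _ v rfl

/-- Summing over all edges is summing over all parents. -/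
lemma sum_ne_root {M : Type*} [AddCommMonoid M] (f : V → M) :
    ∑ v ∈ univ.filter (· ≠ T.root), f v = ∑ p, ∑ c ∈ T.ch p, f c := by
  rw [← Finset.sum_fiberwise (univ.filter (· ≠ T.root)) T.par]
  refine sum_congr rfl fun p _ => sum_congr ?_ fun _ _ => rfl
  ext v; simp [mem_ch]

lemma ne_root_of_lev_pos {v : V} (h : 0 < T.lev v) : v ≠ T.root := by
  rintro rfl
  rw [T.lev_root] at h; omega

/-- The vertex at level `j` on the path from the root to the leaf `l`. -/
def pth (l : X) (j : ℕ) : V := T.par^[T.depth - j] (T.leaf l)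

lemma lev_pth (l : X) {j : ℕ} (h : j ≤ T.depth) : T.lev (T.pth l j) = j := by
  unfold pth
  rw [T.lev_iter _ _ (by rw [T.lev_leaf]; omega), T.lev_leaf]; omega

lemma pth_depth (l : X) : T.pth l T.depth = T.leaf l := by simp [pth]

lemma pth_zero (l : X) : T.pth l 0 = T.root := T.eq_root_of_lev (T.lev_pth l (Nat.zero_le _))

lemma below_pth (l : X) {j : ℕ} (h : j ≤ T.depth) : T.Below (T.pth l j) (T.leaf l) := by
  refine ⟨by rw [T.lev_pth l h, T.lev_leaf]; exact h, ?_⟩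
  rw [T.lev_pth l h, T.lev_leaf]; rfl

lemma eq_pth {l : X} {v : V} (h : T.Below v (T.leaf l)) : v = T.pth l (T.lev v) := by
  rw [pth, ← T.lev_leaf l]; exact h.2.symm

lemma pth_ch (l : X) {j : ℕ} (h : j < T.depth) : T.pth l (j + 1) ∈ T.ch (T.pth l j) := by
  rw [mem_ch]
  refine ⟨T.ne_root_of_lev_pos (by rw [T.lev_pth l h]; omega), ?_⟩
  unfold pth
  rw [← Function.iterate_succ_apply' T.par]
  congr 1; omega

lemma sum_path {M : Type*} [AddCommMonoid M] (l : X) (f : V → M) :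
    ∑ v ∈ univ.filter (fun v => T.Below v (T.leaf l)), f v
      = ∑ j ∈ range (T.depth + 1), f (T.pth l j) := by
  refine sum_nbij' T.lev (T.pth l) ?_ ?_ ?_ ?_ ?_
  · intro v _; have := T.lev_le v; simp; omega
  · intro j hj; simp at hj; simp [T.below_pth l hj]
  · intro v hv; simp at hv; exact (T.eq_pth hv).symm
  · intro j hj; simp at hj; exact T.lev_pth l (by omega)
  · intro v hv; simp at hv; rw [← T.eq_pth hv]

lemma leaf_below {l : X} {v : V} (h : T.Below (T.leaf l) v) : v = T.leaf l := by
  have h1 := h.1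
  have h2 := T.lev_le v
  have h3 := h.2
  rw [T.lev_leaf] at h1 h3
  have : T.lev v - T.depth = 0 := by omega
  rw [this] at h3
  simpa using h3

/-- The number of points of `A` in the subtree of `v`. -/
def cnt (A : Finset X) (v : V) : ℕ := (A.filter fun a => T.Below v (T.leaf a)).card

lemma cnt_root (A : Finset X) : T.cnt A T.root = A.card := by
  unfold cnt
  rw [filter_true_of_mem fun a _ => T.below_root _]

lemma cnt_mono {A B : Finset X} (h : A ⊆ B) (v : V) : T.cnt A v ≤ T.cnt B v :=
  card_le_card (filter_subset_filter _ h)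

lemma cnt_node (A : Finset X) {p : V} (h : T.lev p < T.depth) :
    T.cnt A p = ∑ c ∈ T.ch p, T.cnt A c := by
  unfold cnt
  classical
  rw [← card_biUnion]
  · congr 1
    ext a
    simp only [mem_filter, mem_biUnion]
    constructor
    · rintro ⟨ha, hb⟩
      obtain ⟨c, hc, hb'⟩ := T.exists_ch_below hb (by
        rintro h1; rw [← h1, T.lev_leaf] at h; omega)
      exact ⟨c, hc, ha, hb'⟩
    · rintro ⟨c, hc, ha, hb⟩
      exact ⟨ha, (T.below_ch hc).trans T hb⟩
  · intro c hc c' hc' hne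
    refine Finset.disjoint_left.2 fun v hv hv' => hne ?_
    exact T.eq_of_below_ch hc hc' (mem_filter.1 hv).2 (mem_filter.1 hv').2

lemma below_leaf_leaf {a b : X} : T.Below (T.leaf a) (T.leaf b) ↔ a = b := by
  constructor
  · intro h; exact (T.leaf_inj (T.leaf_below h)).symm
  · rintro rfl; exact T.below_refl _

lemma cnt_leaf [DecidableEq X] (A : Finset X) (x : X) :
    T.cnt A (T.leaf x) = if x ∈ A then 1 else 0 := by
  unfold cnt
  simp only [below_leaf_leaf, filter_eq]
  split_ifs <;> simp

end Fin

end LevelTree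

namespace LevelTree

/-- The Bregman divergence of the shifted negative entropy. -/
noncomputable def brg (d t s : ℝ) : ℝ :=
  (t + d) * Real.log (t + d) - (t + d) * Real.log (s + d) - (t - s)

lemma continuous_brg (d s : ℝ) : Continuous fun t => brg d t s := by
  unfold brg
  have h : Continuous fun t : ℝ => (t + d) * Real.log (t + d) :=
    Real.continuous_mul_log.comp (continuous_id.add continuous_const)
  fun_prop

lemma hasDerivAt_brg {d t s : ℝ} (h : t + d ≠ 0) :
    HasDerivAt (fun t => brg d t s) (Real.log (t + d) - Real.log (s + d)) t := by
  unfold brg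
  have h1 : HasDerivAt (fun t : ℝ => t + d) 1 t := (hasDerivAt_id t).add_const d
  have h2 : HasDerivAt (fun t : ℝ => (t + d) * Real.log (t + d)) ((Real.log (t + d) + 1) * 1) t :=
    HasDerivAt.comp t (Real.hasDerivAt_mul_log h) h1
  have h3 := (h2.sub (h1.mul_const (Real.log (s + d)))).sub ((hasDerivAt_id t).sub_const s)
  exact h3.congr_deriv (by ring)

lemma sub_le_mul_log {a b : ℝ} (ha : 0 < a) (hb : 0 < b) :
    a - b ≤ a * (Real.log a - Real.log b) := by
  have h := Real.log_le_sub_one_of_pos (div_pos hb ha)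
  rw [Real.log_div hb.ne' ha.ne'] at h
  have : a * (Real.log b - Real.log a) ≤ a * (b / a - 1) := mul_le_mul_of_nonneg_left h ha.le
  have e : a * (b / a - 1) = b - a := by field_simp
  nlinarith

lemma brg_min_le {d t s : ℝ} (hd : 0 < d) (hs : 0 ≤ s) (hs1 : s ≤ 1) :
    brg d (min t 1) s ≤ brg d t s := by
  rcases le_total t 1 with h | h
  · rw [min_eq_left h]
  · rw [min_eq_right h]
    unfold brg
    have h1 := sub_le_mul_log (a := t + d) (b := 1 + d) (by linarith) (by linarith)
    have h2 : Real.log (s + d) ≤ Real.log (1 + d) := Real.log_le_log (by linarith) (by linarith)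
    have h3 := mul_le_mul_of_nonneg_left h2 (sub_nonneg.2 h)
    nlinarith

variable {V X : Type*} (T : LevelTree V X) [Fintype V] [DecidableEq V] [Fintype X]

/-- The number of leaves below `v`. -/
def nn (v : V) : ℕ := T.cnt univ v

lemma nn_node {p : V} (h : T.lev p < T.depth) : T.nn p = ∑ c ∈ T.ch p, T.nn c :=
  T.cnt_node _ h

lemma nn_leaf (x : X) : T.nn (T.leaf x) = 1 := by
  classical
  unfold nn; rw [T.cnt_leaf]; simp

lemma sum_le_nn {p : V} (h : T.lev p < T.depth) {m : V → ℕ} (hm : m ≤ T.nn) :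
    ∑ c ∈ T.ch p, m c ≤ T.nn p := by
  rw [T.nn_node h]
  exact sum_le_sum fun c _ => hm c

/-- Partial sums of a sequence at each vertex. -/
noncomputable def psum (x : V → ℕ → ℝ) (v : V) (m : ℕ) : ℝ := ∑ i ∈ range m, x v i

omit [Fintype V] [DecidableEq V] in
lemma psum_succ (x : V → ℕ → ℝ) (v : V) (m : ℕ) : psum x v (m + 1) = psum x v m + x v m := by
  unfold psum; rw [sum_range_succ]

/-- The relaxed states: `x v i` stands for the probability that at most `i` servers are
below `v`. -/
structure Feas (k : ℕ) (x : V → ℕ → ℝ) : Prop where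
  root : ∀ i, x T.root i = if i < k then 0 else 1
  top : ∀ v i, T.nn v ≤ i → x v i = 1
  mono : ∀ v i, i + 1 < T.nn v → x v i ≤ x v (i + 1)
  cons : ∀ p, T.lev p < T.depth → ∀ m ≤ T.nn,
    psum x p (∑ c ∈ T.ch p, m c) ≤ ∑ c ∈ T.ch p, psum x c (m c)

variable {T} {k : ℕ} {x : V → ℕ → ℝ}

lemma Feas.mono' (h : T.Feas k x) (v : V) {i j : ℕ} (hij : i ≤ j) (hj : j < T.nn v) :
    x v i ≤ x v j := by
  induction j, hij using Nat.le_induction with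
  | base => exact le_rfl
  | succ j hij ih => exact (ih (by omega)).trans (h.mono v j hj)

lemma Feas.nonneg (h : T.Feas k x) (v : V) (i : ℕ) : 0 ≤ x v i := by
  suffices H : 0 ≤ x v 0 by
    rcases lt_or_ge i (T.nn v) with hi | hi
    · exact H.trans (h.mono' v (Nat.zero_le _) hi)
    · rw [h.top v i hi]; norm_num
  induction v using T.down_induction with
  | h0 => rw [h.root]; split_ifs <;> norm_num
  | h p ih c hc =>
    rcases Nat.eq_zero_or_pos (T.nn c) with h0 | h0
    · rw [h.top c 0 (by omega)]; norm_num
    · have := h.cons p (T.lev_lt_of_ch hc) (fun v => if v = c then 1 else 0) (by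
        intro v; dsimp only; split_ifs with hv
        · rw [hv]; exact h0
        · exact Nat.zero_le _)
      have e1 : ∑ v ∈ T.ch p, (if v = c then 1 else 0 : ℕ) = 1 := by simp [hc]
      have e2 : ∑ v ∈ T.ch p, psum x v (if v = c then 1 else 0) = x c 0 := by
        rw [sum_eq_single c]
        · simp [psum]
        · intro v _ hv; simp [hv, psum]
        · intro h'; exact absurd hc h'
      rw [e1, e2] at this
      simp only [psum, sum_range_one] at this
      exact ih.trans this

omit [Fintype V] [DecidableEq V] in
lemma psum_min_le (x : V → ℕ → ℝ) (v : V) {m j : ℕ} (hj : j ≤ m) :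
    psum (fun v i => min (x v i) 1) v m ≤ psum x v j + (m - j : ℝ) := by
  induction m, hj using Nat.le_induction with
  | base =>
    simp only [sub_self, add_zero]
    exact sum_le_sum fun i _ => min_le_left _ _
  | succ m hjm ih =>
    rw [psum_succ]
    have := min_le_right (x v m) 1
    push_cast
    linarith

lemma Feas.exists_psum_min (h : T.Feas k x) (v : V) {m : ℕ} (hm : m ≤ T.nn v) :
    ∃ j ≤ m, psum x v j + (m - j : ℝ) = psum (fun v i => min (x v i) 1) v m := by
  induction m with
  | zero => exact ⟨0, le_rfl, by simp [psum]⟩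
  | succ m ih =>
    rcases le_total (x v m) 1 with h1 | h1
    · refine ⟨m + 1, le_rfl, ?_⟩
      simp only [sub_self, add_zero]
      refine sum_congr rfl fun i hi => (min_eq_left ?_).symm
      rw [mem_range] at hi
      exact (h.mono' v (by omega) (by omega)).trans h1
    · obtain ⟨j, hj, e⟩ := ih (by omega)
      refine ⟨j, by omega, ?_⟩
      rw [psum_succ, ← e, min_eq_right h1]
      push_cast; ring

lemma Feas.min_one (h : T.Feas k x) : T.Feas k fun v i => min (x v i) 1 where
  root i := by rw [h.root]; split_ifs <;> norm_num
  top v i hi := by rw [h.top v i hi]; norm_num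
  mono v i hi := min_le_min_right _ (h.mono v i hi)
  cons p hp m hm := by
    choose j hj e using fun v => h.exists_psum_min v (hm v)
    have h1 := h.cons p hp j fun v => (hj v).trans (hm v)
    have h2 : ∑ c ∈ T.ch p, j c ≤ ∑ c ∈ T.ch p, m c := sum_le_sum fun c _ => hj c
    have h3 := psum_min_le x p h2
    have h4 : ∑ c ∈ T.ch p, psum (fun v i => min (x v i) 1) c (m c)
        = ∑ c ∈ T.ch p, psum x c (j c) + ((∑ c ∈ T.ch p, m c : ℕ) - (∑ c ∈ T.ch p, j c : ℕ) : ℝ) := by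
      push_cast
      rw [← sum_sub_distrib, ← sum_add_distrib]
      exact sum_congr rfl fun c _ => (e c).symm
    rw [h4]
    linarith

variable (T)

/-- The objective function of the Bregman projection step towards `x (leaf l) 0 = 0`. -/
noncomputable def obj (d ε : ℝ) (x0 : V → ℕ → ℝ) (l : X) (x : V → ℕ → ℝ) : ℝ :=
  ∑ v, ∑ i ∈ range (T.nn v), T.w v * brg d (x v i) (x0 v i) + ε * x (T.leaf l) 0

variable {T}

lemma exists_step {d ε : ℝ} {x0 : V → ℕ → ℝ} (l : X) (h0 : T.Feas k x0)
    (hc0 : ∀ v i, x0 v i ≤ 1) :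
    ∃ x1, T.Feas k x1 ∧ (∀ v i, x1 v i ≤ 1) ∧
      ∀ x, T.Feas k x → (∀ v i, x v i ≤ 1) → T.obj d ε x0 l x1 ≤ T.obj d ε x0 l x := by
  have hcl : IsClosed {x : V → ℕ → ℝ | T.Feas k x ∧ ∀ v i, x v i ≤ 1} := by
    have e : {x : V → ℕ → ℝ | T.Feas k x ∧ ∀ v i, x v i ≤ 1}
        = {x | ∀ i, x T.root i = if i < k then 0 else 1} ∩
          {x | ∀ v i, T.nn v ≤ i → x v i = 1} ∩
          {x | ∀ v i, i + 1 < T.nn v → x v i ≤ x v (i + 1)} ∩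
          {x | ∀ p, T.lev p < T.depth → ∀ m ≤ T.nn,
            psum x p (∑ c ∈ T.ch p, m c) ≤ ∑ c ∈ T.ch p, psum x c (m c)} ∩
          {x | ∀ v i, x v i ≤ 1} := by
      ext x
      constructor
      · rintro ⟨⟨a, b, c, d⟩, e⟩; exact ⟨⟨⟨⟨a, b⟩, c⟩, d⟩, e⟩
      · rintro ⟨⟨⟨⟨a, b⟩, c⟩, d⟩, e⟩; exact ⟨⟨a, b, c, d⟩, e⟩
    rw [e]
    simp only [Set.ofPred_forall]
    refine IsClosed.inter (IsClosed.inter (IsClosed.inter (IsClosed.inter ?_ ?_) ?_) ?_) ?_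
    · exact isClosed_iInter fun i => isClosed_eq (by fun_prop) continuous_const
    · exact isClosed_iInter fun v => isClosed_iInter fun i => isClosed_iInter fun _ =>
        isClosed_eq (by fun_prop) continuous_const
    · exact isClosed_iInter fun v => isClosed_iInter fun i => isClosed_iInter fun _ =>
        isClosed_le (by fun_prop) (by fun_prop)
    · refine isClosed_iInter fun v => isClosed_iInter fun i => isClosed_iInter fun m =>
        isClosed_iInter fun _ => isClosed_le ?_ ?_
      · unfold psum; fun_prop
      · unfold psum; fun_prop
    · exact isClosed_iInter fun v => isClosed_iInter fun i =>
        isClosed_le (by fun_prop) continuous_const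
  have hcomp : IsCompact {x : V → ℕ → ℝ | T.Feas k x ∧ ∀ v i, x v i ≤ 1} := by
    have hbig : IsCompact (Set.univ.pi fun _ : V => Set.univ.pi fun _ : ℕ => Set.Icc (0 : ℝ) 1) :=
      isCompact_univ_pi fun _ => isCompact_univ_pi fun _ => isCompact_Icc
    refine hbig.of_isClosed_subset hcl ?_
    rintro x ⟨hx, hc⟩ v - i -
    exact ⟨hx.nonneg v i, hc v i⟩
  obtain ⟨x1, hx1, hmin⟩ := hcomp.exists_isMinOn ⟨x0, h0, hc0⟩
    (f := T.obj d ε x0 l) (by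
      apply Continuous.continuousOn
      unfold obj
      refine Continuous.add ?_ (by fun_prop)
      refine continuous_finsetSum _ fun v _ => continuous_finsetSum _ fun i _ => ?_
      exact continuous_const.mul ((continuous_brg d (x0 v i)).comp (by fun_prop)))
  exact ⟨x1, hx1.1, hx1.2, fun x hx hc => hmin ⟨hx, hc⟩⟩

lemma eventually_add_mul_nonneg {a b : ℝ} (ha : 0 ≤ a) (h : 0 < a ∨ 0 ≤ b) :
    ∀ᶠ τ in nhdsWithin (0 : ℝ) (Set.Ioi 0), 0 ≤ a + τ * b := by
  rcases h with h | h
  · have hc : Filter.Tendsto (fun τ : ℝ => a + τ * b) (nhdsWithin 0 (Set.Ioi 0)) (nhds a) := by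
      have : Continuous fun τ : ℝ => a + τ * b := by fun_prop
      have h2 := this.tendsto 0
      simp only [zero_mul, add_zero] at h2
      exact h2.mono_left nhdsWithin_le_nhds
    filter_upwards [hc.eventually (lt_mem_nhds h)] with τ hτ using hτ.le
  · filter_upwards [self_mem_nhdsWithin] with τ hτ
    have : (0 : ℝ) < τ := hτ
    positivity

omit [Fintype V] [DecidableEq V] in
lemma psum_add_mul (x h : V → ℕ → ℝ) (τ : ℝ) (v : V) (m : ℕ) :
    psum (fun v i => x v i + τ * h v i) v m = psum x v m + τ * psum h v m := by
  simp only [psum, sum_add_distrib, mul_sum]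

/-- A direction along which one can move a little inside the relaxed states. -/
structure Dir (T : LevelTree V X) (x h : V → ℕ → ℝ) : Prop where
  root : ∀ i, h T.root i = 0
  top : ∀ v i, T.nn v ≤ i → h v i = 0
  mono : ∀ v i, i + 1 < T.nn v → x v i < x v (i + 1) ∨ h v i ≤ h v (i + 1)
  cons : ∀ p, T.lev p < T.depth → ∀ m ≤ T.nn,
    psum x p (∑ c ∈ T.ch p, m c) < ∑ c ∈ T.ch p, psum x c (m c) ∨
      psum h p (∑ c ∈ T.ch p, m c) ≤ ∑ c ∈ T.ch p, psum h c (m c)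

lemma Feas.eventually {h : V → ℕ → ℝ} (hx : T.Feas k x) (hd : T.Dir x h) :
    ∀ᶠ τ in nhdsWithin (0 : ℝ) (Set.Ioi 0), T.Feas k fun v i => x v i + τ * h v i := by
  have h1 : ∀ᶠ τ in nhdsWithin (0 : ℝ) (Set.Ioi 0), ∀ v, ∀ i ∈ Set.Iio (T.nn v - 1),
      0 ≤ (x v (i + 1) - x v i) + τ * (h v (i + 1) - h v i) := by
    refine Filter.eventually_all.2 fun v =>
      (Filter.eventually_all_finite (Set.finite_Iio _)).2 fun i hi => ?_
    have hi' : i + 1 < T.nn v := by have := Set.mem_Iio.1 hi; omega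
    refine eventually_add_mul_nonneg (sub_nonneg.2 (hx.mono v i hi')) ?_
    rcases hd.mono v i hi' with h | h
    · exact Or.inl (sub_pos.2 h)
    · exact Or.inr (sub_nonneg.2 h)
  have h2 : ∀ᶠ τ in nhdsWithin (0 : ℝ) (Set.Ioi 0), ∀ p : V, T.lev p < T.depth →
      ∀ m ∈ Set.Iic T.nn,
      0 ≤ (∑ c ∈ T.ch p, psum x c (m c) - psum x p (∑ c ∈ T.ch p, m c))
        + τ * (∑ c ∈ T.ch p, psum h c (m c) - psum h p (∑ c ∈ T.ch p, m c)) := by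
    refine Filter.eventually_all.2 fun p => ?_
    by_cases hp : T.lev p < T.depth
    · simp only [hp, true_imp_iff]
      refine (Filter.eventually_all_finite (Set.finite_Iic _)).2 fun m hm => ?_
      refine eventually_add_mul_nonneg (sub_nonneg.2 (hx.cons p hp m hm)) ?_
      rcases hd.cons p hp m hm with h | h
      · exact Or.inl (sub_pos.2 h)
      · exact Or.inr (sub_nonneg.2 h)
    · simp [hp]
  filter_upwards [h1, h2] with τ a1 a2
  refine ⟨fun i => ?_, fun v i hi => ?_, fun v i hi => ?_, fun p hp m hm => ?_⟩
  · rw [hd.root, hx.root]; simp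
  · rw [hd.top v i hi, hx.top v i hi]; simp
  · have := a1 v i (Set.mem_Iio.2 (by omega)); nlinarith
  · have := a2 p hp m hm
    simp only [psum_add_mul, sum_add_distrib, ← mul_sum]
    nlinarith

/-- First order optimality of the projection step. -/
lemma step_kkt {d ε : ℝ} (hd : 0 < d) (hε : 0 ≤ ε) {x0 x1 : V → ℕ → ℝ} {l : X}
    (h0 : T.Feas k x0) (hc0 : ∀ v i, x0 v i ≤ 1) (h1 : T.Feas k x1)
    (hmin : ∀ x, T.Feas k x → (∀ v i, x v i ≤ 1) → T.obj d ε x0 l x1 ≤ T.obj d ε x0 l x)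
    {h : V → ℕ → ℝ} (hh : T.Dir x1 h) :
    0 ≤ ∑ v, ∑ i ∈ range (T.nn v),
      T.w v * ((Real.log (x1 v i + d) - Real.log (x0 v i + d)) * h v i) + ε * h (T.leaf l) 0 := by
  set g : ℝ → ℝ := fun τ => T.obj d ε x0 l fun v i => x1 v i + τ * h v i with hg
  have hder : HasDerivAt g (∑ v, ∑ i ∈ range (T.nn v),
      T.w v * ((Real.log (x1 v i + d) - Real.log (x0 v i + d)) * h v i)
        + ε * h (T.leaf l) 0) 0 := by
    have hin : ∀ v i, HasDerivAt (fun τ : ℝ => x1 v i + τ * h v i) (h v i) 0 := by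
      intro v i
      have := ((hasDerivAt_id (0 : ℝ)).mul_const (h v i)).const_add (x1 v i)
      simpa using this
    refine HasDerivAt.add ?_ ((hin _ _).const_mul ε)
    refine HasDerivAt.fun_sum fun v _ => HasDerivAt.fun_sum fun i _ => ?_
    refine HasDerivAt.const_mul (T.w v) ?_
    have hb : HasDerivAt (fun t => brg d t (x0 v i))
        (Real.log (x1 v i + d) - Real.log (x0 v i + d)) (x1 v i + 0 * h v i) := by
      have := hasDerivAt_brg (d := d) (t := x1 v i) (s := x0 v i)
        (by have := h1.nonneg v i; linarith)
      simpa using this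
    exact HasDerivAt.comp (0 : ℝ) hb (hin v i)
  have hev : ∀ᶠ τ in nhdsWithin (0 : ℝ) (Set.Ioi 0), g 0 ≤ g τ := by
    filter_upwards [h1.eventually hh] with τ hτ
    have e0 : g 0 = T.obj d ε x0 l x1 := by simp [hg]
    rw [e0]
    refine (hmin _ hτ.min_one fun v i => min_le_right _ _).trans ?_
    unfold obj
    refine add_le_add (sum_le_sum fun v _ => sum_le_sum fun i _ => ?_) ?_
    · exact mul_le_mul_of_nonneg_left (brg_min_le hd (h0.nonneg v i) (hc0 v i)) (T.w_pos v).le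
    · exact mul_le_mul_of_nonneg_left (min_le_left _ _) hε
  have hslope := (hasDerivAt_iff_tendsto_slope.1 hder).mono_left
    (nhdsWithin_mono (0 : ℝ) (s := Set.Ioi 0) (fun τ hτ => (ne_of_gt hτ : τ ≠ 0)))
  refine ge_of_tendsto hslope ?_
  filter_upwards [hev, self_mem_nhdsWithin] with τ h2 h3
  rw [slope_def_field]
  have : (0 : ℝ) < τ := h3
  exact div_nonneg (by linarith) (by linarith)

end LevelTree

namespace LevelTree

variable {V X : Type*} {T : LevelTree V X} [Fintype V] [DecidableEq V] [Fintype X]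
  {k : ℕ}

/-- `x1` arises from `x0` by a Bregman projection step towards `x (leaf l) 0 = 0`. -/
structure IsStep (T : LevelTree V X) (k : ℕ) (d ε : ℝ) (l : X) (x0 x1 : V → ℕ → ℝ) : Prop where
  feas0 : T.Feas k x0
  cap0 : ∀ v i, x0 v i ≤ 1
  feas1 : T.Feas k x1
  cap1 : ∀ v i, x1 v i ≤ 1
  kkt : ∀ h, T.Dir x1 h → 0 ≤ ∑ v, ∑ i ∈ range (T.nn v),
      T.w v * ((Real.log (x1 v i + d) - Real.log (x0 v i + d)) * h v i) + ε * h (T.leaf l) 0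

lemma exists_isStep {d ε : ℝ} (hd : 0 < d) (hε : 0 ≤ ε) {x0 : V → ℕ → ℝ} (l : X)
    (h0 : T.Feas k x0) (hc0 : ∀ v i, x0 v i ≤ 1) : ∃ x1, T.IsStep k d ε l x0 x1 := by
  obtain ⟨x1, h1, hc1, hmin⟩ := exists_step (d := d) (ε := ε) l h0 hc0
  exact ⟨x1, h0, hc0, h1, hc1, fun h hh => step_kkt hd hε h0 hc0 h1 hmin hh⟩

/-- A direction concentrated at one vertex. -/
def at_ (v : V) (g : ℕ → ℝ) : V → ℕ → ℝ := fun u i => if u = v then g i else 0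

lemma psum_at (v : V) (g : ℕ → ℝ) (u : V) (m : ℕ) :
    psum (at_ v g) u m = if u = v then ∑ i ∈ range m, g i else 0 := by
  unfold psum at_
  split_ifs <;> simp

lemma dir_at {x : V → ℕ → ℝ} {v : V} {g : ℕ → ℝ} (hv : v ≠ T.root)
    (htop : ∀ i, T.nn v ≤ i → g i = 0)
    (hmono : ∀ i, i + 1 < T.nn v → x v i < x v (i + 1) ∨ g i ≤ g (i + 1))
    (hdown : T.lev v < T.depth → ∀ m ≤ T.nn,
      psum x v (∑ c ∈ T.ch v, m c) < ∑ c ∈ T.ch v, psum x c (m c) ∨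
        ∑ i ∈ range (∑ c ∈ T.ch v, m c), g i ≤ 0)
    (hup : ∀ p, v ∈ T.ch p → ∀ m ≤ T.nn,
      psum x p (∑ c ∈ T.ch p, m c) < ∑ c ∈ T.ch p, psum x c (m c) ∨
        0 ≤ ∑ i ∈ range (m v), g i) : T.Dir x (at_ v g) where
  root i := by simp [at_, hv.symm]
  top u i hi := by
    unfold at_
    split_ifs with h
    · subst h; exact htop i hi
    · rfl
  mono u i hi := by
    unfold at_
    split_ifs with h
    · subst h; exact hmono i hi
    · exact Or.inr le_rfl
  cons p hp m hm := by
    simp only [psum_at]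
    by_cases hpv : p = v
    · subst hpv
      rcases hdown hp m hm with h | h
      · exact Or.inl h
      · refine Or.inr ?_
        rw [if_pos rfl]
        refine h.trans (le_of_eq (sum_eq_zero fun c hc => if_neg ?_).symm)
        rintro rfl
        have := T.lev_ch hc
        omega
    · rw [if_neg hpv]
      by_cases hvp : v ∈ T.ch p
      · rcases hup p hvp m hm with h | h
        · exact Or.inl h
        · refine Or.inr ?_
          rw [sum_ite_eq' (T.ch p) v, if_pos hvp]
          exact h
      · refine Or.inr ?_
        rw [sum_ite_eq' (T.ch p) v, if_neg hvp]

variable {d ε : ℝ} {l : X} {x0 x1 : V → ℕ → ℝ}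

/-- The directional derivative of the divergence at one coordinate. -/
noncomputable def lg (d : ℝ) (x0 x1 : V → ℕ → ℝ) (v : V) (i : ℕ) : ℝ :=
  Real.log (x1 v i + d) - Real.log (x0 v i + d)

lemma IsStep.kkt_at (h : T.IsStep k d ε l x0 x1) {v : V} {g : ℕ → ℝ} (hd : T.Dir x1 (at_ v g)) :
    0 ≤ T.w v * ∑ i ∈ range (T.nn v), lg d x0 x1 v i * g i
      + ε * (if T.leaf l = v then g 0 else 0) := by
  have := h.kkt _ hd
  rw [sum_eq_single v] at this
  · simpa [at_, ← mul_sum, lg] using this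
  · intro u _ hu
    simp [at_, hu]
  · simp

lemma IsStep.lg_pos (hd : 0 < d) (h : T.IsStep k d ε l x0 x1) {v : V} {i : ℕ}
    (hlt : x0 v i < x1 v i) : 0 < lg d x0 x1 v i := by
  have := h.feas0.nonneg v i
  exact sub_pos.2 (Real.log_lt_log (by linarith) (by linarith))

lemma IsStep.lg_neg (hd : 0 < d) (h : T.IsStep k d ε l x0 x1) {v : V} {i : ℕ}
    (hlt : x1 v i < x0 v i) : lg d x0 x1 v i < 0 := by
  have := h.feas1.nonneg v i
  exact sub_neg.2 (Real.log_lt_log (by linarith) (by linarith))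

lemma exists_negative_block (a : ℕ → ℝ) (n m : ℕ) (hm : m ≤ n) (hneg : ∑ i ∈ range m, a i < 0) :
    ∃ p q, p < q ∧ q ≤ n ∧ a p < 0 ∧ (p + 1 < n → 0 ≤ a (p + 1)) ∧
      (∀ s, p + 1 ≤ s → s ≤ q → ∑ i ∈ range s, a i < 0) ∧
      (q < n → 0 < a q ∧ a (q - 1) ≤ 0) := by
  classical
  have hex : ∃ m, ∑ i ∈ range m, a i < 0 := ⟨m, hneg⟩
  set m1 := Nat.find hex with hm1
  have hm1n : ∑ i ∈ range m1, a i < 0 := Nat.find_spec hex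
  have hm1m : m1 ≤ n := (Nat.find_le hneg).trans hm
  have hm1pos : 0 < m1 := by
    rcases Nat.eq_zero_or_pos m1 with h | h
    · rw [h] at hm1n; simp at hm1n
    · exact h
  have hlast : a (m1 - 1) < 0 := by
    have h1 : ¬ ∑ i ∈ range (m1 - 1), a i < 0 := Nat.find_min hex (by omega)
    have h2 : ∑ i ∈ range m1, a i = ∑ i ∈ range (m1 - 1), a i + a (m1 - 1) := by
      rw [← sum_range_succ]; congr 2; omega
    linarith
  have hex2 : ∃ j, m1 ≤ j ∧ (j = n ∨ 0 ≤ a j) := ⟨n, hm1m, Or.inl rfl⟩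
  set m2 := Nat.find hex2 with hm2
  obtain ⟨h12, hm2'⟩ := Nat.find_spec hex2
  have hm2n : m2 ≤ n := Nat.find_le ⟨hm1m, Or.inl rfl⟩
  have hmid : ∀ j, m1 ≤ j → j < m2 → a j < 0 := by
    intro j h1 h2
    have := Nat.find_min hex2 h2
    push Not at this
    exact (this h1).2
  have hneg2 : ∀ s, m1 ≤ s → s ≤ m2 → ∑ i ∈ range s, a i < 0 := by
    intro s h1 h2
    induction s, h1 using Nat.le_induction with
    | base => exact hm1n
    | succ s hs ih =>
      rw [sum_range_succ]
      have := ih (by omega)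
      have := hmid s hs (by omega)
      linarith
  have hlast2 : a (m2 - 1) < 0 := by
    rcases h12.lt_or_eq with h | h
    · exact hmid _ (by omega) (by omega)
    · have : m1 = m2 := h
      rw [← this]; exact hlast
  have hex3 : ∃ j, m2 ≤ j ∧ (j = n ∨ 0 < a j) := ⟨n, hm2n, Or.inl rfl⟩
  set q := Nat.find hex3 with hq
  obtain ⟨h23, hq'⟩ := Nat.find_spec hex3
  have hqn : q ≤ n := Nat.find_le ⟨hm2n, Or.inl rfl⟩
  have hmid3 : ∀ j, m2 ≤ j → j < q → a j ≤ 0 := by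
    intro j h1 h2
    have := Nat.find_min hex3 h2
    push Not at this
    exact (this h1).2
  have h12' : m1 ≤ m2 := h12
  have h23' : m2 ≤ q := h23
  refine ⟨m2 - 1, q, by omega, hqn, hlast2, fun h => ?_, fun s h1 h2 => ?_, fun h => ⟨?_, ?_⟩⟩
  · have e : m2 - 1 + 1 = m2 := by omega
    rw [e] at h ⊢
    rcases hm2' with h' | h'
    · have : m2 = n := h'
      omega
    · exact h'
  · have h1' : m2 ≤ s := by omega
    clear h1
    induction s, h1' using Nat.le_induction with
    | base => exact hneg2 _ h12' le_rfl
    | succ s hs ih =>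
      rw [sum_range_succ]
      have := ih (by omega)
      have := hmid3 s hs (by omega)
      linarith
  · rcases hq' with h' | h'
    · have : q = n := h'
      omega
    · exact h'
  · rcases h23'.lt_or_eq with h' | h'
    · exact hmid3 _ (by omega) (by omega)
    · rw [← h']; exact hlast2.le

/-- Away from the request, no subtree gains servers, in the strong sense of partial sums. -/
lemma IsStep.psum_mono (hd : 0 < d) (h : T.IsStep k d ε l x0 x1) (v : V) :
    ¬ T.Below v (T.leaf l) → ∀ m ≤ T.nn v, psum x0 v m ≤ psum x1 v m := by
  induction v using T.up_induction with
  | h v ih =>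
  intro hoff m hm
  by_contra hlt
  have hvr : v ≠ T.root := by
    rintro rfl; exact hoff (T.below_root _)
  have hch : ∀ c ∈ T.ch v, ∀ m ≤ T.nn c, psum x0 c m ≤ psum x1 c m := fun c hc =>
    ih c hc fun hb => hoff ((T.below_ch hc).trans T hb)
  obtain ⟨p, q, hpq, hqn, hp, hp1, hs, hq⟩ := exists_negative_block
    (fun i => x1 v i - x0 v i) (T.nn v) m hm (by
      rw [sum_sub_distrib]
      have : psum x1 v m - psum x0 v m < 0 := by linarith
      exact this)
  have hpx : x1 v p < x0 v p := by linarith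
  set g : ℕ → ℝ := fun i => if i = p then 1 else if i = q ∧ q < T.nn v then -1 else 0 with hg
  have hsumg : ∀ s, s ≤ T.nn v → (∑ i ∈ range s, g i = 0 ∨
      (p + 1 ≤ s ∧ s ≤ q ∧ ∑ i ∈ range s, g i = 1)) := by
    intro s hs
    have e : ∀ i, g i = (if i = p then 1 else 0) - (if i = q then (if q < T.nn v then 1 else 0) else 0) := by
      intro i
      simp only [hg]
      split_ifs with h1 h2 h3 h4 h5 <;> first | (exfalso; omega) | norm_num
    simp only [e, sum_sub_distrib, sum_ite_eq', mem_range]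
    split_ifs with h1 h2 h3 <;> first | (exfalso; omega) | (left; norm_num; done) | skip
    all_goals right; refine ⟨by omega, by omega, by norm_num⟩
  have hnn : ∀ s, s ≤ T.nn v → 0 ≤ ∑ i ∈ range s, g i := by
    intro s hs'
    rcases hsumg s hs' with h' | ⟨_, _, h'⟩ <;> rw [h']; norm_num
  have hdir : T.Dir x1 (at_ v g) := by
    refine dir_at hvr ?_ ?_ ?_ ?_
    · intro i hi
      simp only [hg]
      rw [if_neg (by omega), if_neg (by omega)]
    · intro i hi
      by_cases hip : i = p
      · subst hip
        left
        have h1 := hp1 hi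
        have h2 := h.feas0.mono v i hi
        simp only [sub_nonneg] at h1
        linarith
      · by_cases hiq : i + 1 = q
        · left
          obtain ⟨h1, h2⟩ := hq (by omega)
          have h3 := h.feas0.mono v i hi
          have e : q - 1 = i := by omega
          rw [e] at h2
          rw [← hiq] at h1
          linarith
        · right
          have e1 : g i ≤ 0 := by
            simp only [hg]; rw [if_neg hip]; split_ifs <;> norm_num
          have e2 : 0 ≤ g (i + 1) := by
            simp only [hg]
            split_ifs with h1 h2
            · norm_num
            · omega
            · norm_num
          exact e1.trans e2
    · intro hlev m hm
      rcases hsumg _ (T.sum_le_nn hlev hm) with h' | ⟨h1, h2, h'⟩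
      · exact Or.inr h'.le
      · left
        refine lt_of_le_of_ne (h.feas1.cons v hlev m hm) fun he => ?_
        have h3 := hs _ h1 h2
        rw [sum_sub_distrib] at h3
        have h4 := h.feas0.cons v hlev m hm
        have h5 : ∑ c ∈ T.ch v, psum x0 c (m c) ≤ ∑ c ∈ T.ch v, psum x1 c (m c) :=
          sum_le_sum fun c hc => hch c hc _ (hm c)
        unfold psum at *
        linarith
    · intro p' _ m hm
      exact Or.inr (hnn _ (hm v))
  have hk := h.kkt_at hdir
  have hnl : T.leaf l ≠ v := by
    rintro rfl; exact hoff (T.below_refl _)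
  rw [if_neg hnl, mul_zero, add_zero] at hk
  have hneg : ∑ i ∈ range (T.nn v), lg d x0 x1 v i * g i < 0 := by
    have hle : ∀ i ∈ range (T.nn v), lg d x0 x1 v i * g i ≤ 0 := by
      intro i hi
      simp only [hg]
      split_ifs with h1 h2
      · subst h1; have := h.lg_neg hd hpx; linarith
      · rw [h2.1]
        have := h.lg_pos hd (v := v) (i := q) (by have := (hq h2.2).1; linarith)
        linarith
      · simp
    refine sum_neg' hle ⟨p, mem_range.2 (by omega), ?_⟩
    simp only [hg]
    have := h.lg_neg hd hpx
    simpa using this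
  have := mul_neg_of_pos_of_neg (T.w_pos v) hneg
  linarith

end LevelTree

namespace LevelTree

variable {V X : Type*} {T : LevelTree V X} [Fintype V] [DecidableEq V] [Fintype X]
  {k : ℕ} {d ε : ℝ} {l : X} {x0 x1 : V → ℕ → ℝ}

lemma Feas.psum_convex {x : V → ℕ → ℝ} (h : T.Feas k x) (v : V) {a c t : ℕ} (hac : a ≤ c)
    (hc : c + t ≤ T.nn v) :
    psum x v (a + t) + psum x v c ≤ psum x v a + psum x v (c + t) := by
  induction t with
  | zero => simp
  | succ t ih =>
    have h1 := ih (by omega)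
    have h2 := h.mono' v (i := a + t) (j := c + t) (by omega) (by omega)
    rw [← add_assoc, ← add_assoc, psum_succ, psum_succ]
    linarith

/-- The profile `m` of the children of `p` is tight. -/
def Tight (T : LevelTree V X) (x : V → ℕ → ℝ) (p : V) (m : V → ℕ) : Prop :=
  m ≤ T.nn ∧ psum x p (∑ c ∈ T.ch p, m c) = ∑ c ∈ T.ch p, psum x c (m c)

lemma Feas.tight_sup {x : V → ℕ → ℝ} (h : T.Feas k x) {p : V} (hp : T.lev p < T.depth)
    {m m' : V → ℕ} (hm : T.Tight x p m) (hm' : T.Tight x p m') : T.Tight x p (m ⊔ m') := by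
  have hs : m ⊔ m' ≤ T.nn := sup_le hm.1 hm'.1
  have hi : m ⊓ m' ≤ T.nn := inf_le_left.trans hm.1
  refine ⟨hs, ?_⟩
  have h1 := h.cons p hp _ hs
  have h2 := h.cons p hp _ hi
  have e : ∑ c ∈ T.ch p, (m ⊔ m') c + ∑ c ∈ T.ch p, (m ⊓ m') c
      = ∑ c ∈ T.ch p, m c + ∑ c ∈ T.ch p, m' c := by
    rw [← sum_add_distrib, ← sum_add_distrib]
    refine sum_congr rfl fun c _ => ?_
    simp only [Pi.sup_apply, Pi.inf_apply]
    exact max_add_min _ _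
  have e2 : ∑ c ∈ T.ch p, psum x c ((m ⊔ m') c) + ∑ c ∈ T.ch p, psum x c ((m ⊓ m') c)
      = ∑ c ∈ T.ch p, psum x c (m c) + ∑ c ∈ T.ch p, psum x c (m' c) := by
    rw [← sum_add_distrib, ← sum_add_distrib]
    refine sum_congr rfl fun c _ => ?_
    simp only [Pi.sup_apply, Pi.inf_apply]
    rcases le_total (m c) (m' c) with hc | hc
    · rw [sup_eq_right.2 hc, inf_eq_left.2 hc, add_comm]
    · rw [sup_eq_left.2 hc, inf_eq_right.2 hc]
  have hle : ∑ c ∈ T.ch p, (m ⊓ m') c ≤ ∑ c ∈ T.ch p, m c :=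
    sum_le_sum fun c _ => inf_le_left (a := m) (b := m') c
  have hle' : ∑ c ∈ T.ch p, (m ⊓ m') c ≤ ∑ c ∈ T.ch p, m' c :=
    sum_le_sum fun c _ => inf_le_right (a := m) (b := m') c
  have hbig := T.sum_le_nn hp hs
  have h3 := h.psum_convex p (a := ∑ c ∈ T.ch p, (m ⊓ m') c) (c := ∑ c ∈ T.ch p, m c)
    (t := ∑ c ∈ T.ch p, m' c - ∑ c ∈ T.ch p, (m ⊓ m') c) hle (by omega)
  have e3 : ∑ c ∈ T.ch p, (m ⊓ m') c + (∑ c ∈ T.ch p, m' c - ∑ c ∈ T.ch p, (m ⊓ m') c)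
      = ∑ c ∈ T.ch p, m' c := by omega
  have e4 : ∑ c ∈ T.ch p, m c + (∑ c ∈ T.ch p, m' c - ∑ c ∈ T.ch p, (m ⊓ m') c)
      = ∑ c ∈ T.ch p, (m ⊔ m') c := by omega
  rw [e3, e4] at h3
  have := hm.2
  have := hm'.2
  linarith

lemma Feas.exists_max_tight {x : V → ℕ → ℝ} (h : T.Feas k x) {p : V} (hp : T.lev p < T.depth) :
    ∃ M, T.Tight x p M ∧ ∀ m, T.Tight x p m → ∀ c ∈ T.ch p, m c ≤ M c := by
  have hfin : {m | T.Tight x p m}.Finite := (Set.finite_Iic T.nn).subset fun m hm => hm.1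
  have hne : {m | T.Tight x p m}.Nonempty :=
    ⟨0, fun v => Nat.zero_le _, by simp [psum]⟩
  obtain ⟨M, hM, hmax⟩ := hfin.exists_maximalFor (fun m => ∑ c ∈ T.ch p, m c) _ hne
  refine ⟨M, hM, fun m hm => ?_⟩
  have hsup := h.tight_sup hp hM hm
  have h1 := hmax hsup (sum_le_sum fun c _ => le_sup_left (a := M) (b := m) c)
  have h2 : ∀ c ∈ T.ch p, M c ≤ (M ⊔ m) c := fun c _ => le_sup_left (a := M) (b := m) c
  have h3 := (sum_eq_sum_iff_of_le h2).1 (le_antisymm (sum_le_sum h2) h1)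
  intro c hc
  rw [h3 c hc]
  exact le_sup_right (a := M) (b := m) c

/-- The step lowers no coordinate above the maximal tight profile. -/
lemma IsStep.le_of_max_tight (hd : 0 < d) (hε : 0 ≤ ε) (h : T.IsStep k d ε l x0 x1) {p : V}
    (hp : T.lev p < T.depth) {M : V → ℕ} (hM : T.Tight x1 p M)
    (hmax : ∀ m, T.Tight x1 p m → ∀ c ∈ T.ch p, m c ≤ M c) {v : V} (hv : v ∈ T.ch p) (i : ℕ)
    (hMi : M v ≤ i) (hi : i < T.nn v) : x1 v i ≤ x0 v i := by
  induction i using Nat.strong_induction_on with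
  | _ i ih =>
  by_contra hlt
  push Not at hlt
  have hpred : i = 0 ∨ x1 v (i - 1) < x1 v i := by
    rcases Nat.eq_zero_or_pos i with h0 | h0
    · exact Or.inl h0
    right
    have e : i - 1 + 1 = i := by omega
    rcases hMi.lt_or_eq with hlt' | heq
    · have h1 := ih (i - 1) (by omega) (by omega) (by omega)
      have h2 := h.feas0.mono v (i - 1) (by omega)
      rw [e] at h2
      linarith
    · have h2 := h.feas1.mono v (i - 1) (by omega)
      rw [e] at h2
      refine lt_of_le_of_ne h2 fun heq' => ?_
      set s := ∑ c ∈ T.ch p, M c with hs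
      have hchange : ∀ j, ∑ c ∈ T.ch p, (Function.update M v j) c + M v = s + j := by
        intro j
        have h3 : ∑ c ∈ T.ch p, (Function.update M v j) c
            = j + ∑ c ∈ (T.ch p).erase v, M c := by
          rw [← add_sum_erase _ _ hv, Function.update_self]
          congr 1
          exact sum_congr rfl fun c hc => Function.update_of_ne (ne_of_mem_erase hc) _ _
        have h4 := add_sum_erase (T.ch p) M hv
        omega
      have hchange2 : ∀ j, ∑ c ∈ T.ch p, psum x1 c ((Function.update M v j) c) + psum x1 v (M v)
          = ∑ c ∈ T.ch p, psum x1 c (M c) + psum x1 v j := by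
        intro j
        have h3 : ∑ c ∈ T.ch p, psum x1 c ((Function.update M v j) c)
            = psum x1 v j + ∑ c ∈ (T.ch p).erase v, psum x1 c (M c) := by
          rw [← add_sum_erase _ _ hv, Function.update_self]
          congr 1
          exact sum_congr rfl fun c hc => by rw [Function.update_of_ne (ne_of_mem_erase hc)]
        have h4 := add_sum_erase (T.ch p) (fun c => psum x1 c (M c)) hv
        linarith
      have hupd : ∀ j ≤ T.nn v, Function.update M v j ≤ T.nn := by
        intro j hj c
        rcases eq_or_ne c v with rfl | hc
        · simpa using hj
        · rw [Function.update_of_ne hc]; exact hM.1 c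
      have hup1 := hupd (M v + 1) (by omega)
      have hdn1 := hupd (M v - 1) (by omega)
      have c1 := h.feas1.cons p hp _ hup1
      have c2 := h.feas1.cons p hp _ hdn1
      have s1 := hchange (M v + 1)
      have s2 := hchange (M v - 1)
      have t1 := hchange2 (M v + 1)
      have t2 := hchange2 (M v - 1)
      have hsb := T.sum_le_nn hp hup1
      have hM2 := hM.2
      rw [← hs] at hM2
      have e1 : ∑ c ∈ T.ch p, (Function.update M v (M v + 1)) c = s + 1 := by omega
      have e2 : ∑ c ∈ T.ch p, (Function.update M v (M v - 1)) c = s - 1 := by omega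
      have hspos : 0 < s := by
        have : M v ≤ s := single_le_sum (f := M) (fun _ _ => Nat.zero_le _) hv
        omega
      have f1 : psum x1 p (s + 1) = psum x1 p s + x1 p s := psum_succ _ _ _
      have f2 : psum x1 p s = psum x1 p (s - 1) + x1 p (s - 1) := by
        rw [← psum_succ]; congr 1; omega
      have f3 : psum x1 v (M v + 1) = psum x1 v (M v) + x1 v i := by rw [psum_succ, heq]
      have f4 : psum x1 v (M v) = psum x1 v (M v - 1) + x1 v (i - 1) := by
        rw [← heq, ← psum_succ]; congr 1; omega
      have f5 := h.feas1.mono p (s - 1) (by omega)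
      have f6 : s - 1 + 1 = s := by omega
      rw [f6] at f5
      rw [e1] at c1
      rw [e2] at c2
      have htight : T.Tight x1 p (Function.update M v (M v + 1)) := by
        refine ⟨hup1, ?_⟩
        rw [e1]
        linarith
      have := hmax _ htight v hv
      simp at this
  set g : ℕ → ℝ := fun j => if j = i then -1 else 0 with hg
  have hsum : ∀ s, ∑ j ∈ range s, g j = if i < s then -1 else 0 := by
    intro s
    simp [hg, sum_ite_eq']
  have hdir : T.Dir x1 (at_ v g) := by
    refine dir_at (T.ne_root_of_ch hv) ?_ ?_ ?_ ?_
    · intro j hj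
      simp only [hg]; rw [if_neg (by omega)]
    · intro j hj
      by_cases hji : j + 1 = i
      · left
        rcases hpred with h0 | h0
        · omega
        · rw [← hji] at h0; simpa using h0
      · right
        simp only [hg]
        rw [if_neg hji]; split_ifs <;> norm_num
    · intro _ m _
      right; rw [hsum]; split_ifs <;> norm_num
    · intro p' hp' m hm
      have : p' = p := by rw [← (T.mem_ch.1 hp').2, ← (T.mem_ch.1 hv).2]
      subst this
      rw [hsum]
      by_cases him : i < m v
      · left
        refine lt_of_le_of_ne (h.feas1.cons _ hp m hm) fun he => ?_
        have := hmax m ⟨hm, he⟩ v hv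
        omega
      · right; rw [if_neg him]
  have hk := h.kkt_at hdir
  have e1 : ∑ j ∈ range (T.nn v), lg d x0 x1 v j * g j = -lg d x0 x1 v i := by
    simp [hg, hi]
  rw [e1] at hk
  have h1 := mul_pos (T.w_pos v) (h.lg_pos hd hlt)
  have h2 : ε * (if T.leaf l = v then g 0 else 0) ≤ 0 := by
    refine mul_nonpos_of_nonneg_of_nonpos hε ?_
    simp only [hg]
    split_ifs <;> norm_num
  linarith

/-- The step raises no coordinate of `p` beyond the size of the maximal tight profile. -/
lemma IsStep.ge_of_max_tight (hd : 0 < d) (h : T.IsStep k d ε l x0 x1) {p : V}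
    (hp : T.lev p < T.depth) {M : V → ℕ}
    (hmax : ∀ m, T.Tight x1 p m → ∀ c ∈ T.ch p, m c ≤ M c) (i : ℕ)
    (hMi : ∑ c ∈ T.ch p, M c ≤ i) (hi : i < T.nn p) : x0 p i ≤ x1 p i := by
  obtain ⟨j, hj⟩ : ∃ j, j = T.nn p - i := ⟨_, rfl⟩
  induction j using Nat.strong_induction_on generalizing i with
  | _ j ih =>
  by_contra hlt
  push Not at hlt
  have hpr : p ≠ T.root := by
    rintro rfl
    rw [h.feas0.root, h.feas1.root] at hlt
    exact lt_irrefl _ hlt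
  have hsucc : i + 1 < T.nn p → x1 p i < x1 p (i + 1) := by
    intro hi'
    have h1 := ih (T.nn p - (i + 1)) (by omega) (i + 1) (by omega) hi' rfl
    have h2 := h.feas0.mono p i hi'
    linarith
  set g : ℕ → ℝ := fun j => if j = i then 1 else 0 with hg
  have hsum : ∀ s, ∑ j ∈ range s, g j = if i < s then 1 else 0 := by
    intro s
    simp [hg, sum_ite_eq']
  have hdir : T.Dir x1 (at_ p g) := by
    refine dir_at hpr ?_ ?_ ?_ ?_
    · intro j hj
      simp only [hg]; rw [if_neg (by omega)]
    · intro j hj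
      by_cases hji : j = i
      · left; rw [hji] at hj ⊢; exact hsucc hj
      · right
        simp only [hg]
        rw [if_neg hji]; split_ifs <;> norm_num
    · intro _ m hm
      rw [hsum]
      by_cases him : i < ∑ c ∈ T.ch p, m c
      · left
        refine lt_of_le_of_ne (h.feas1.cons _ hp m hm) fun he => ?_
        have : ∑ c ∈ T.ch p, m c ≤ ∑ c ∈ T.ch p, M c := sum_le_sum (hmax m ⟨hm, he⟩)
        omega
      · right; rw [if_neg him]
    · intro p' hp' m hm
      right; rw [hsum]; split_ifs <;> norm_num
  have hk := h.kkt_at hdir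
  have e1 : ∑ j ∈ range (T.nn p), lg d x0 x1 p j * g j = lg d x0 x1 p i := by
    simp [hg, hi]
  rw [e1] at hk
  have h1 := mul_neg_of_pos_of_neg (T.w_pos p) (h.lg_neg hd hlt)
  have h2 : T.leaf l ≠ p := by
    rintro rfl
    rw [T.lev_leaf] at hp; omega
  rw [if_neg h2] at hk
  linarith

omit [Fintype V] [DecidableEq V] [Fintype X] in
lemma psum_sub_psum (x : V → ℕ → ℝ) (v : V) {a b : ℕ} (h : a ≤ b) :
    psum x v b = psum x v a + ∑ i ∈ Ico a b, x v i := by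
  unfold psum
  rw [sum_range_add_sum_Ico _ h]

/-- A vertex gains at most as much as its children together. -/
lemma IsStep.psum_children (hd : 0 < d) (hε : 0 ≤ ε) (h : T.IsStep k d ε l x0 x1) {p : V}
    (hp : T.lev p < T.depth) :
    ∑ c ∈ T.ch p, (psum x1 c (T.nn c) - psum x0 c (T.nn c))
      ≤ psum x1 p (T.nn p) - psum x0 p (T.nn p) := by
  obtain ⟨M, hM, hmax⟩ := h.feas1.exists_max_tight hp
  have h1 : ∑ c ∈ T.ch p, (psum x1 c (T.nn c) - psum x0 c (T.nn c))
      ≤ ∑ c ∈ T.ch p, (psum x1 c (M c) - psum x0 c (M c)) := by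
    refine sum_le_sum fun c hc => ?_
    rw [psum_sub_psum x1 c (hM.1 c), psum_sub_psum x0 c (hM.1 c)]
    have : ∑ i ∈ Ico (M c) (T.nn c), x1 c i ≤ ∑ i ∈ Ico (M c) (T.nn c), x0 c i :=
      sum_le_sum fun i hi => by
        rw [mem_Ico] at hi
        exact h.le_of_max_tight hd hε hp hM hmax hc i hi.1 hi.2
    linarith
  have h2 : ∑ c ∈ T.ch p, (psum x1 c (M c) - psum x0 c (M c))
      ≤ psum x1 p (∑ c ∈ T.ch p, M c) - psum x0 p (∑ c ∈ T.ch p, M c) := by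
    rw [sum_sub_distrib, ← hM.2]
    have := h.feas0.cons p hp M hM.1
    linarith
  have hle := T.sum_le_nn hp hM.1
  rw [psum_sub_psum x1 p hle, psum_sub_psum x0 p hle]
  have : ∑ i ∈ Ico (∑ c ∈ T.ch p, M c) (T.nn p), x0 p i
      ≤ ∑ i ∈ Ico (∑ c ∈ T.ch p, M c) (T.nn p), x1 p i :=
    sum_le_sum fun i hi => by
      rw [mem_Ico] at hi
      exact h.ge_of_max_tight hd hp hmax i hi.1 hi.2
  linarith

end LevelTree

namespace LevelTree

variable {V X : Type*} (T : LevelTree V X) [Fintype V] [DecidableEq V] [Fintype X]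

/-- The state that corresponds to the set `A` of servers. -/
def cfg (A : Finset X) : V → ℕ → ℝ := fun v i => if i < T.cnt A v then 0 else 1

/-- The server mass below `v`. -/
noncomputable def mass (x : V → ℕ → ℝ) (v : V) : ℝ := T.nn v - psum x v (T.nn v)

/-- The shifted relative entropy of a state with respect to a set of servers, up to terms that
depend on the set of servers alone. -/
noncomputable def ent (d : ℝ) (A : Finset X) (x : V → ℕ → ℝ) : ℝ :=
  ∑ v, ∑ i ∈ range (T.nn v),
    T.w v * (x v i - (T.cfg A v i + d) * Real.log (x v i + d))

variable {T} {k : ℕ} {d ε : ℝ} {l : X} {x0 x1 : V → ℕ → ℝ}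

lemma psum_cfg (A : Finset X) (v : V) (m : ℕ) :
    psum (T.cfg A) v m = ((m - T.cnt A v : ℕ) : ℝ) := by
  induction m with
  | zero => simp [psum]
  | succ m ih =>
    rw [psum_succ, ih, cfg]
    split_ifs with h
    · rw [Nat.sub_eq_zero_of_le h.le, Nat.sub_eq_zero_of_le h]; simp
    · push Not at h
      rw [Nat.succ_sub h]; push_cast; ring

lemma cfg_feas {A : Finset X} (hA : A.card = k) : T.Feas k (T.cfg A) where
  root i := by simp [cfg, T.cnt_root, hA]
  top v i hi := by
    have := T.cnt_mono (subset_univ A) v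
    have h2 : T.cnt univ v ≤ i := hi
    simp only [cfg]; rw [if_neg (by omega)]
  mono v i _ := by
    simp only [cfg]
    split_ifs <;> first | omega | norm_num
  cons p hp m _ := by
    simp only [psum_cfg]
    rw [T.cnt_node A hp]
    have : ∑ c ∈ T.ch p, m c - ∑ c ∈ T.ch p, T.cnt A c
        ≤ ∑ c ∈ T.ch p, (m c - T.cnt A c) := by
      rw [Nat.sub_le_iff_le_add, ← sum_add_distrib]
      exact sum_le_sum fun c _ => by omega
    exact_mod_cast this

lemma IsStep.ent_le (hd : 0 < d) (h : T.IsStep k d ε l x0 x1) {A : Finset X} (hA : A.card = k)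
    (hl : l ∈ A) : T.ent d A x1 ≤ T.ent d A x0 - ε * x1 (T.leaf l) 0 := by
  classical
  have hy := cfg_feas (T := T) hA
  have hdir : T.Dir x1 fun v i => T.cfg A v i - x1 v i := by
    refine ⟨fun i => ?_, fun v i hi => ?_, fun v i hi => ?_, fun p hp m hm => ?_⟩
    · rw [hy.root, h.feas1.root, sub_self]
    · rw [hy.top v i hi, h.feas1.top v i hi, sub_self]
    · rcases (h.feas1.mono v i hi).lt_or_eq with h1 | h1
      · exact Or.inl h1
      · right
        have := hy.mono v i hi
        linarith
    · rcases (h.feas1.cons p hp m hm).lt_or_eq with h1 | h1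
      · exact Or.inl h1
      · right
        have h2 := hy.cons p hp m hm
        have e : ∀ v m, psum (fun v i => T.cfg A v i - x1 v i) v m
            = psum (T.cfg A) v m - psum x1 v m := fun v m => sum_sub_distrib _ _
        simp only [e, sum_sub_distrib]
        linarith
  have hk := h.kkt _ hdir
  have e0 : T.cfg A (T.leaf l) 0 = 0 := by simp [cfg, T.cnt_leaf, hl]
  rw [e0] at hk
  have hle : T.ent d A x1 - T.ent d A x0 ≤ -∑ v, ∑ i ∈ range (T.nn v),
      T.w v * ((Real.log (x1 v i + d) - Real.log (x0 v i + d)) * (T.cfg A v i - x1 v i)) := by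
    unfold ent
    rw [← sum_sub_distrib, ← sum_neg_distrib]
    refine sum_le_sum fun v _ => ?_
    rw [← sum_sub_distrib, ← sum_neg_distrib]
    refine sum_le_sum fun i _ => ?_
    have h1 := sub_le_mul_log (a := x1 v i + d) (b := x0 v i + d)
      (by have := h.feas1.nonneg v i; linarith) (by have := h.feas0.nonneg v i; linarith)
    have := mul_le_mul_of_nonneg_left h1 (T.w_pos v).le
    nlinarith
  linarith

lemma IsStep.leaf_ge (hd : 0 < d) (h : T.IsStep k d ε l x0 x1) (hε : ε * 2 ^ T.depth ≤ 1 / 4) :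
    3 / 4 * (x0 (T.leaf l) 0 + d) ≤ x1 (T.leaf l) 0 + d := by
  have hr : T.leaf l ≠ T.root := T.ne_root_of_lev_pos (by rw [T.lev_leaf]; exact T.depth_pos)
  set g : ℕ → ℝ := fun j => if j = 0 then 1 else 0 with hg
  have hn := T.nn_leaf l
  have hdir : T.Dir x1 (at_ (T.leaf l) g) := by
    refine dir_at hr ?_ ?_ ?_ ?_
    · intro j hj
      simp only [hg]; rw [if_neg (by omega)]
    · intro j hj; omega
    · intro hlt; rw [T.lev_leaf] at hlt; omega
    · intro p hp m hm
      right
      exact sum_nonneg fun i _ => by simp only [hg]; split_ifs <;> norm_num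
  have hk := h.kkt_at hdir
  rw [hn, if_pos rfl] at hk
  simp only [hg, sum_range_one, if_true, mul_one, lg] at hk
  have hw : T.w (T.leaf l) * 2 ^ T.depth = 1 := by
    unfold w; rw [T.lev_leaf, ← mul_pow]; norm_num
  have h0 := h.feas0.nonneg (T.leaf l) 0
  have h1 := h.feas1.nonneg (T.leaf l) 0
  have hpow : (0 : ℝ) < 2 ^ T.depth := by positivity
  have h2 : -(1 / 4) ≤ Real.log (x1 (T.leaf l) 0 + d) - Real.log (x0 (T.leaf l) 0 + d) := by
    have := mul_nonneg hk hpow.le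
    have e : (T.w (T.leaf l) * (Real.log (x1 (T.leaf l) 0 + d) - Real.log (x0 (T.leaf l) 0 + d)) + ε)
        * 2 ^ T.depth = (T.w (T.leaf l) * 2 ^ T.depth) *
          (Real.log (x1 (T.leaf l) 0 + d) - Real.log (x0 (T.leaf l) 0 + d))
          + ε * 2 ^ T.depth := by ring
    rw [e, hw] at this
    linarith
  rw [← Real.log_div (by linarith) (by linarith)] at h2
  have h3 := Real.log_le_sub_one_of_pos (x := (x1 (T.leaf l) 0 + d) / (x0 (T.leaf l) 0 + d))
    (div_pos (by linarith) (by linarith))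
  have h4 : 3 / 4 ≤ (x1 (T.leaf l) 0 + d) / (x0 (T.leaf l) 0 + d) := by linarith
  rwa [le_div_iff₀ (by linarith)] at h4

/-- The weighted mass gain of a subtree containing the request is small. -/
lemma IsStep.mass_sub_le (hd : 0 < d) (h : T.IsStep k d ε l x0 x1) {q : V} (hq : q ≠ T.root)
    (hl : T.Below q (T.leaf l)) :
    ∑ v ∈ T.sub q, T.w v * (T.mass x1 v - T.mass x0 v) ≤ ε * (x0 (T.leaf l) 0 + d) := by
  have hdir : T.Dir x1 fun v i => if T.Below q v ∧ i < T.nn v then x0 v i + d else 0 := by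
    have hrq : ¬ T.Below q T.root := by
      intro h
      have := h.1
      rw [T.lev_root] at this
      exact hq (T.eq_root_of_lev (by omega))
    have hps : ∀ v m, m ≤ T.nn v →
        psum (fun v i => if T.Below q v ∧ i < T.nn v then x0 v i + d else 0) v m
          = if T.Below q v then psum x0 v m + d * m else 0 := by
      intro v m hm
      unfold psum
      split_ifs with hb
      · rw [mul_comm, ← nsmul_eq_mul, ← card_range m, ← sum_const, card_range, ← sum_add_distrib]
        refine sum_congr rfl fun i hi => ?_
        rw [mem_range] at hi
        exact if_pos ⟨hb, by omega⟩
      · exact sum_eq_zero fun i _ => if_neg fun hc => hb hc.1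
    refine ⟨fun i => ?_, fun v i hi => ?_, fun v i hi => ?_, fun p hp m hm => ?_⟩
    · exact if_neg fun hc => hrq hc.1
    · exact if_neg fun hc => by omega
    · right
      by_cases hb : T.Below q v
      · rw [if_pos ⟨hb, by omega⟩, if_pos ⟨hb, hi⟩]
        have := h.feas0.mono v i hi
        linarith
      · rw [if_neg fun hc => hb hc.1, if_neg fun hc => hb hc.1]
    · right
      rw [hps _ _ (T.sum_le_nn hp hm), sum_congr rfl fun c hc => hps c _ (hm c)]
      have hnn : ∀ v m, 0 ≤ psum x0 v m + d * m := fun v m =>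
        add_nonneg (sum_nonneg fun i _ => h.feas0.nonneg v i) (by positivity)
      split_ifs with hb
      · have : ∀ c ∈ T.ch p, (if T.Below q c then psum x0 c (m c) + d * (m c : ℝ) else 0)
            = psum x0 c (m c) + d * m c := fun c hc => if_pos (hb.trans T (T.below_ch hc))
        rw [sum_congr rfl this, sum_add_distrib, ← mul_sum]
        push_cast
        have := h.feas0.cons p hp m hm
        linarith
      · exact sum_nonneg fun c _ => by split_ifs; exacts [hnn _ _, le_rfl]
  have hk := h.kkt _ hdir
  rw [if_pos ⟨hl, by rw [T.nn_leaf]; norm_num⟩] at hk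
  have hle : ∑ v, ∑ i ∈ range (T.nn v), T.w v * ((Real.log (x1 v i + d) - Real.log (x0 v i + d))
      * (if T.Below q v ∧ i < T.nn v then x0 v i + d else 0))
      ≤ -∑ v ∈ T.sub q, T.w v * (T.mass x1 v - T.mass x0 v) := by
    unfold sub
    rw [sum_filter, ← sum_neg_distrib]
    refine sum_le_sum fun v _ => ?_
    split_ifs with hb
    · have e : -(T.w v * (T.mass x1 v - T.mass x0 v))
          = ∑ i ∈ range (T.nn v), T.w v * (x1 v i - x0 v i) := by
        unfold mass psum
        rw [← mul_sum, sum_sub_distrib]; ring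
      rw [e]
      refine sum_le_sum fun i hi => ?_
      rw [if_pos ⟨hb, mem_range.1 hi⟩]
      refine mul_le_mul_of_nonneg_left ?_ (T.w_pos v).le
      have := sub_le_mul_log (a := x0 v i + d) (b := x1 v i + d)
        (by have := h.feas0.nonneg v i; linarith) (by have := h.feas1.nonneg v i; linarith)
      nlinarith
    · simp [hb]
  linarith

lemma Feas.mass_root {x : V → ℕ → ℝ} (h : T.Feas k x) (hk : k ≤ Fintype.card X) :
    T.mass x T.root = k := by
  have hn : T.nn T.root = Fintype.card X := T.cnt_root univ
  have e : ∀ m, psum x T.root m = ((m - k : ℕ) : ℝ) := by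
    intro m
    induction m with
    | zero => simp [psum]
    | succ m ih =>
      rw [psum_succ, ih, h.root]
      split_ifs with h
      · rw [Nat.sub_eq_zero_of_le h.le, Nat.sub_eq_zero_of_le h]; simp
      · push Not at h
        rw [Nat.succ_sub h]; push_cast; ring
  unfold mass
  rw [e, hn, Nat.cast_sub hk]; ring

lemma mass_nonneg {x : V → ℕ → ℝ} (hc : ∀ v i, x v i ≤ 1) (v : V) : 0 ≤ T.mass x v := by
  unfold mass psum
  have : ∑ i ∈ range (T.nn v), x v i ≤ ∑ i ∈ range (T.nn v), (1 : ℝ) :=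
    sum_le_sum fun i _ => hc v i
  simp at this
  linarith

lemma Feas.mass_children {x : V → ℕ → ℝ} (h : T.Feas k x) {p : V} (hp : T.lev p < T.depth) :
    ∑ c ∈ T.ch p, T.mass x c ≤ T.mass x p := by
  have := h.cons p hp T.nn le_rfl
  rw [← T.nn_node hp] at this
  unfold mass
  rw [sum_sub_distrib]
  have e : (T.nn p : ℝ) = ∑ c ∈ T.ch p, (T.nn c : ℝ) := by
    rw [T.nn_node hp]; push_cast; rfl
  linarith

lemma mass_leaf (x : V → ℕ → ℝ) (a : X) : T.mass x (T.leaf a) = 1 - x (T.leaf a) 0 := by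
  unfold mass psum
  rw [T.nn_leaf]; simp

end LevelTree

namespace LevelTree

variable {V X : Type*} (T : LevelTree V X) [Fintype V] [DecidableEq V]

/-- The shift in the entropy of the server masses. -/
noncomputable def eta : ℝ := 1 / 64

lemma eta_pos : 0 < eta := by unfold eta; norm_num

/-- The shifted function `z log z`. -/
noncomputable def zlog (z : ℝ) : ℝ := (z + eta) * Real.log (z + eta)

lemma zlog_sub_le {a b : ℝ} (ha : 0 ≤ a) (hb : 0 ≤ b) :
    zlog b - zlog a ≤ (b - a) * (1 + Real.log (b + eta)) := by
  have := eta_pos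
  have h := sub_le_mul_log (a := a + eta) (b := b + eta) (by linarith) (by linarith)
  unfold zlog
  nlinarith

lemma le_zlog_sub {a b : ℝ} (ha : 0 ≤ a) (hb : 0 ≤ b) :
    (b - a) * (1 + Real.log (a + eta)) ≤ zlog b - zlog a := by
  have := zlog_sub_le hb ha
  nlinarith

/-- The conditional entropy of the server masses at `p`, given the mass of `p`. -/
noncomputable def nodeEnt (z : V → ℝ) (p : V) : ℝ :=
  T.w p / 2 * (zlog (z p) - ∑ c ∈ T.ch p, zlog (z c) - zlog (z p - ∑ c ∈ T.ch p, z c))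

/-- The weighted conditional entropy of the server masses. -/
noncomputable def treeEnt (z : V → ℝ) : ℝ :=
  ∑ p ∈ univ.filter (fun p => T.lev p < T.depth), T.nodeEnt z p

/-- The potential that pays for filling nearly empty subtrees on the path to `l`. -/
noncomputable def fill (l : X) (z : V → ℝ) : ℝ :=
  ∑ j ∈ range (T.depth + 1), T.w (T.pth l j) * min (z (T.pth l j)) (2 * eta)

/-- The weighted distance of two mass distributions. -/
noncomputable def wdist (z0 z1 : V → ℝ) : ℝ := ∑ v, T.w v * |z1 v - z0 v|

/-- Mass distributions on the tree. -/
structure IsMass (K : ℝ) (z : V → ℝ) : Prop where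
  nonneg : ∀ v, 0 ≤ z v
  node : ∀ p, T.lev p < T.depth → ∑ c ∈ T.ch p, z c ≤ z p
  root : z T.root = K

/-- A small movement of mass towards the leaf `l`. -/
structure Flow (K M : ℝ) (l : X) (z0 z1 : V → ℝ) : Prop where
  mass0 : T.IsMass K z0
  mass1 : T.IsMass K z1
  off : ∀ v, ¬ T.Below v (T.leaf l) → z1 v ≤ z0 v
  node : ∀ p, T.lev p < T.depth → z1 p - z0 p ≤ ∑ c ∈ T.ch p, (z1 c - z0 c)
  bound : ∀ q, q ≠ T.root → T.Below q (T.leaf l) → T.w q * (z1 q - z0 q) ≤ M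
  nonneg : 0 ≤ M
  small : 2 ^ (T.depth + 1) * T.depth * M ≤ eta / 20

variable {T} {K M : ℝ} {l : X} {z0 z1 : V → ℝ}

lemma IsMass.le_of_ch {z : V → ℝ} (h : T.IsMass K z) {p c : V} (hc : c ∈ T.ch p) : z c ≤ z p :=
  (single_le_sum (fun v _ => h.nonneg v) hc).trans (h.node p (T.lev_lt_of_ch hc))

lemma IsMass.le_root {z : V → ℝ} (h : T.IsMass K z) (v : V) : z v ≤ K := by
  induction v using T.down_induction with
  | h0 => exact h.root.le
  | h p ih c hc => exact (h.le_of_ch hc).trans ih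

lemma not_below_sib {j : ℕ} (hj : j < T.depth) {c : V} (hc : c ∈ T.ch (T.pth l j))
    (hne : c ≠ T.pth l (j + 1)) : ¬ T.Below c (T.leaf l) := fun hb =>
  hne (T.eq_of_below_ch hc (T.pth_ch l hj) hb (T.below_pth l hj))

lemma Flow.sib_le (h : T.Flow K M l z0 z1) {j : ℕ} (hj : j < T.depth) :
    z1 (T.pth l j) - z0 (T.pth l j) + ∑ c ∈ (T.ch (T.pth l j)).erase (T.pth l (j + 1)),
      (z0 c - z1 c) ≤ z1 (T.pth l (j + 1)) - z0 (T.pth l (j + 1)) := by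
  have h1 := h.node (T.pth l j) (by rw [T.lev_pth l hj.le]; exact hj)
  rw [← add_sum_erase _ _ (T.pth_ch l hj)] at h1
  have e : ∑ c ∈ (T.ch (T.pth l j)).erase (T.pth l (j + 1)), (z0 c - z1 c)
      = -∑ c ∈ (T.ch (T.pth l j)).erase (T.pth l (j + 1)), (z1 c - z0 c) := by
    rw [← sum_neg_distrib]; exact sum_congr rfl fun c _ => by ring
  linarith

lemma Flow.sib_nonneg (h : T.Flow K M l z0 z1) {j : ℕ} (hj : j < T.depth) :
    0 ≤ ∑ c ∈ (T.ch (T.pth l j)).erase (T.pth l (j + 1)), (z0 c - z1 c) :=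
  sum_nonneg fun c hc => by
    rw [mem_erase] at hc
    have := h.off c (not_below_sib hj hc.2 hc.1)
    linarith

lemma Flow.gain_succ (h : T.Flow K M l z0 z1) {j : ℕ} (hj : j < T.depth) :
    z1 (T.pth l j) - z0 (T.pth l j) ≤ z1 (T.pth l (j + 1)) - z0 (T.pth l (j + 1)) := by
  have := h.sib_le hj
  have := h.sib_nonneg hj
  linarith

lemma Flow.gain_zero (h : T.Flow K M l z0 z1) : z1 (T.pth l 0) - z0 (T.pth l 0) = 0 := by
  rw [T.pth_zero, h.mass0.root, h.mass1.root, sub_self]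

lemma Flow.gain_nonneg (h : T.Flow K M l z0 z1) {j : ℕ} (hj : j ≤ T.depth) :
    0 ≤ z1 (T.pth l j) - z0 (T.pth l j) := by
  induction j with
  | zero => exact h.gain_zero.ge
  | succ j ih => exact (ih (by omega)).trans (h.gain_succ hj)

lemma Flow.w_gain_le (h : T.Flow K M l z0 z1) {j : ℕ} (hj : j ≤ T.depth) :
    T.w (T.pth l j) * (z1 (T.pth l j) - z0 (T.pth l j)) ≤ M := by
  rcases Nat.eq_zero_or_pos j with rfl | h0
  · rw [h.gain_zero, mul_zero]; exact h.nonneg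
  · exact h.bound _ (T.ne_root_of_lev_pos (by rw [T.lev_pth l hj]; exact h0)) (T.below_pth l hj)

lemma w_pth_succ {j : ℕ} (hj : j < T.depth) : T.w (T.pth l (j + 1)) = T.w (T.pth l j) / 2 :=
  T.w_ch (T.pth_ch l hj)

/-- The mass that enters the path towards `l`, weighted by the lengths of edges. -/
noncomputable def inflow (T : LevelTree V X) (l : X) (z0 z1 : V → ℝ) : ℝ :=
  ∑ j ∈ range T.depth, T.w (T.pth l j) / 2 *
    ((z1 (T.pth l (j + 1)) - z0 (T.pth l (j + 1))) - (z1 (T.pth l j) - z0 (T.pth l j)))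

lemma Flow.off_le (h : T.Flow K M l z0 z1) :
    ∑ v ∈ univ.filter (fun v => ¬ T.Below v (T.leaf l)), T.w v * (z0 v - z1 v)
      ≤ 2 * T.inflow l z0 z1 := by
  set O := ∑ v ∈ univ.filter (fun v => ¬ T.Below v (T.leaf l)), T.w v * (z0 v - z1 v) with hO
  set F : V → ℝ := fun v => if T.Below v (T.leaf l) then 0 else T.w v * (z0 v - z1 v) with hF
  have e1 : O = ∑ p, ∑ c ∈ T.ch p, F c := by
    rw [← T.sum_ne_root, hO, sum_filter, sum_filter]
    refine sum_congr rfl fun v _ => ?_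
    simp only [hF]
    by_cases hv : T.Below v (T.leaf l)
    · simp [hv]
    · have : v ≠ T.root := by rintro rfl; exact hv (T.below_root _)
      simp [hv, this]
  have e2 : ∑ p, ∑ c ∈ T.ch p, F c
      = ∑ j ∈ range (T.depth + 1), ∑ c ∈ T.ch (T.pth l j), F c
        + ∑ p ∈ univ.filter (fun v => ¬ T.Below v (T.leaf l)), ∑ c ∈ T.ch p, F c := by
    rw [← T.sum_path l (fun p => ∑ c ∈ T.ch p, F c)]
    exact (sum_filter_add_sum_filter_not _ _ _).symm
  have h3 : ∑ p ∈ univ.filter (fun v => ¬ T.Below v (T.leaf l)), ∑ c ∈ T.ch p, F c ≤ O / 2 := by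
    rw [hO, sum_div]
    refine sum_le_sum fun p hp => ?_
    simp only [mem_filter, mem_univ, true_and] at hp
    have hoff : ∀ c ∈ T.ch p, ¬ T.Below c (T.leaf l) := fun c hc hb =>
      hp ((T.below_ch hc).trans T hb)
    have e : ∑ c ∈ T.ch p, F c = T.w p / 2 * ∑ c ∈ T.ch p, (z0 c - z1 c) := by
      rw [mul_sum]
      refine sum_congr rfl fun c hc => ?_
      simp only [hF]
      rw [if_neg (hoff c hc), T.w_ch hc]
    rw [e]
    have hw := T.w_pos p
    rcases (T.lev_le p).lt_or_eq with hlt | heq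
    · have h1 := h.node p hlt
      have e' : ∑ c ∈ T.ch p, (z0 c - z1 c) = -∑ c ∈ T.ch p, (z1 c - z0 c) := by
        rw [← sum_neg_distrib]; exact sum_congr rfl fun c _ => by ring
      rw [e']
      nlinarith
    · rw [T.ch_leaf heq, sum_empty, mul_zero]
      have := h.off p hp
      have : 0 ≤ T.w p * (z0 p - z1 p) := mul_nonneg hw.le (by linarith)
      linarith
  have h4 : ∑ j ∈ range (T.depth + 1), ∑ c ∈ T.ch (T.pth l j), F c ≤ T.inflow l z0 z1 := by
    rw [sum_range_succ, T.ch_leaf (T.lev_pth l le_rfl), sum_empty, add_zero]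
    refine sum_le_sum fun j hj => ?_
    rw [mem_range] at hj
    rw [← add_sum_erase _ _ (T.pth_ch l hj)]
    have e0 : F (T.pth l (j + 1)) = 0 := if_pos (T.below_pth l hj)
    have e : ∑ c ∈ (T.ch (T.pth l j)).erase (T.pth l (j + 1)), F c
        = T.w (T.pth l j) / 2 * ∑ c ∈ (T.ch (T.pth l j)).erase (T.pth l (j + 1)), (z0 c - z1 c) := by
      rw [mul_sum]
      refine sum_congr rfl fun c hc => ?_
      rw [mem_erase] at hc
      simp only [hF]
      rw [if_neg (not_below_sib hj hc.2 hc.1), T.w_ch hc.2]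
    rw [e0, e, zero_add]
    refine mul_le_mul_of_nonneg_left ?_ (by have := T.w_pos (T.pth l j); linarith)
    have := h.sib_le hj
    linarith
  linarith

lemma Flow.path_le (h : T.Flow K M l z0 z1) :
    ∑ j ∈ range (T.depth + 1), T.w (T.pth l j) * (z1 (T.pth l j) - z0 (T.pth l j))
      ≤ 2 * T.inflow l z0 z1 := by
  set P := ∑ j ∈ range (T.depth + 1), T.w (T.pth l j) * (z1 (T.pth l j) - z0 (T.pth l j)) with hP
  have e1 : P = ∑ j ∈ range T.depth,
      T.w (T.pth l (j + 1)) * (z1 (T.pth l (j + 1)) - z0 (T.pth l (j + 1))) := by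
    rw [hP, sum_range_succ', h.gain_zero]; simp
  have e2 : P = T.inflow l z0 z1 + (∑ j ∈ range T.depth,
      T.w (T.pth l j) * (z1 (T.pth l j) - z0 (T.pth l j))) / 2 := by
    rw [e1, inflow, sum_div, ← sum_add_distrib]
    refine sum_congr rfl fun j hj => ?_
    rw [w_pth_succ (mem_range.1 hj)]; ring
  have h3 : ∑ j ∈ range T.depth, T.w (T.pth l j) * (z1 (T.pth l j) - z0 (T.pth l j)) ≤ P := by
    rw [hP, sum_range_succ]
    have := mul_nonneg (T.w_pos (T.pth l T.depth)).le (h.gain_nonneg le_rfl)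
    linarith
  linarith

lemma Flow.wdist_le (h : T.Flow K M l z0 z1) : T.wdist z0 z1 ≤ 4 * T.inflow l z0 z1 := by
  have h1 := h.off_le
  have h2 := h.path_le
  unfold wdist
  rw [← sum_filter_add_sum_filter_not univ (fun v => T.Below v (T.leaf l)),
    T.sum_path l (fun v => T.w v * |z1 v - z0 v|)]
  have e1 : ∑ j ∈ range (T.depth + 1), T.w (T.pth l j) * |z1 (T.pth l j) - z0 (T.pth l j)|
      = ∑ j ∈ range (T.depth + 1), T.w (T.pth l j) * (z1 (T.pth l j) - z0 (T.pth l j)) := by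
    refine sum_congr rfl fun j hj => ?_
    rw [abs_of_nonneg (h.gain_nonneg (by rw [mem_range] at hj; omega))]
  have e2 : ∑ v ∈ univ.filter (fun v => ¬ T.Below v (T.leaf l)), T.w v * |z1 v - z0 v|
      = ∑ v ∈ univ.filter (fun v => ¬ T.Below v (T.leaf l)), T.w v * (z0 v - z1 v) := by
    refine sum_congr rfl fun v hv => ?_
    simp only [mem_filter, mem_univ, true_and] at hv
    rw [abs_of_nonpos (by have := h.off v hv; linarith)]; ring
  rw [e1, e2]
  linarith

lemma Flow.inflow_le (h : T.Flow K M l z0 z1) : T.inflow l z0 z1 ≤ T.depth * M := by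
  have : T.inflow l z0 z1 ≤ ∑ j ∈ range T.depth, M := by
    refine sum_le_sum fun j hj => ?_
    rw [mem_range] at hj
    rw [← w_pth_succ hj]
    refine le_trans ?_ (h.w_gain_le hj)
    refine mul_le_mul_of_nonneg_left ?_ (T.w_pos _).le
    have := h.gain_nonneg hj.le
    linarith
  simpa using this

lemma one_le_two_pow_mul_w (v : V) : 1 ≤ 2 ^ T.depth * T.w v := by
  have := mul_le_mul_of_nonneg_left (T.w_ge v) (by positivity : (0 : ℝ) ≤ 2 ^ T.depth)
  rwa [← mul_pow, show (2 : ℝ) * (1 / 2) = 1 by norm_num, one_pow] at this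

lemma Flow.gain_small (h : T.Flow K M l z0 z1) {j : ℕ} (hj : j ≤ T.depth) :
    z1 (T.pth l j) - z0 (T.pth l j) ≤ eta / 20 := by
  have h1 := h.w_gain_le hj
  have h2 := one_le_two_pow_mul_w (T := T) (T.pth l j)
  have h3 := h.gain_nonneg hj
  have h4 := h.small
  have h5 : (1 : ℝ) ≤ T.depth := by exact_mod_cast T.depth_pos
  have h6 : (0 : ℝ) ≤ 2 ^ T.depth * M := mul_nonneg (by positivity) h.nonneg
  have h7 : 2 ^ T.depth * (T.w (T.pth l j) * (z1 (T.pth l j) - z0 (T.pth l j))) ≤ 2 ^ T.depth * M :=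
    mul_le_mul_of_nonneg_left h1 (by positivity)
  rw [pow_succ] at h4
  nlinarith

lemma Flow.off_small (h : T.Flow K M l z0 z1) {v : V} (hv : ¬ T.Below v (T.leaf l)) :
    z0 v - z1 v ≤ eta / 20 := by
  have h1 : T.w v * (z0 v - z1 v)
      ≤ ∑ v ∈ univ.filter (fun v => ¬ T.Below v (T.leaf l)), T.w v * (z0 v - z1 v) := by
    refine single_le_sum (f := fun v => T.w v * (z0 v - z1 v)) (fun u hu => ?_) (by simpa using hv)
    simp only [mem_filter, mem_univ, true_and] at hu
    exact mul_nonneg (T.w_pos u).le (by have := h.off u hu; linarith)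
  have h2 := h.off_le
  have h3 := h.inflow_le
  have h4 := h.small
  have h5 := one_le_two_pow_mul_w (T := T) v
  have h6 := h.off v hv
  have h7 : 2 ^ T.depth * (T.w v * (z0 v - z1 v)) ≤ 2 ^ T.depth * (2 * (T.depth * M)) :=
    mul_le_mul_of_nonneg_left (by linarith) (by positivity)
  rw [pow_succ] at h4
  nlinarith

end LevelTree

namespace LevelTree

variable {V X : Type*} {T : LevelTree V X} [Fintype V] [DecidableEq V]
  {K M : ℝ} {l : X} {z0 z1 : V → ℝ}

lemma IsMass.slack_nonneg {z : V → ℝ} (h : T.IsMass K z) {p : V} (hp : T.lev p < T.depth) :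
    0 ≤ z p - ∑ c ∈ T.ch p, z c := sub_nonneg.2 (h.node p hp)

lemma log_shift_sub_le {a b : ℝ} (ha : 0 ≤ a) (hab : a ≤ b) :
    Real.log (b + eta) - Real.log (a + eta) ≤ (b - a) / eta := by
  have he := eta_pos
  rw [← Real.log_div (by linarith) (by linarith)]
  have h1 := Real.log_le_sub_one_of_pos (x := (b + eta) / (a + eta))
    (div_pos (by linarith) (by linarith))
  have h2 : (b + eta) / (a + eta) - 1 = (b - a) / (a + eta) := by
    have : a + eta ≠ 0 := by linarith
    field_simp; ring
  have h3 : (b - a) / (a + eta) ≤ (b - a) / eta :=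
    div_le_div_of_nonneg_left (by linarith) he (by linarith)
  linarith

lemma Flow.nodeEnt_off (h : T.Flow K M l z0 z1) {p : V} (hp : T.lev p < T.depth)
    (hoff : ¬ T.Below p (T.leaf l)) :
    T.nodeEnt z1 p - T.nodeEnt z0 p ≤ 1 / 40 * (T.w p * (z0 p - z1 p)) := by
  have he := eta_pos
  have hw := T.w_pos p
  have hlog : ∀ {z}, 0 ≤ z → z ≤ z0 p → Real.log (z + eta) ≤ Real.log (z0 p + eta) :=
    fun h0 h1 => Real.log_le_log (by linarith) (by linarith)
  set L := 1 + Real.log (z0 p + eta) with hL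
  have h1 := zlog_sub_le (h.mass0.nonneg p) (h.mass1.nonneg p)
  have h2 : ∀ c ∈ T.ch p, (z1 c - z0 c) * L ≤ zlog (z1 c) - zlog (z0 c) := by
    intro c hc
    refine le_trans ?_ (le_zlog_sub (h.mass0.nonneg c) (h.mass1.nonneg c))
    have ho := h.off c fun hb => hoff ((T.below_ch hc).trans T hb)
    have := hlog (h.mass0.nonneg c) (h.mass0.le_of_ch hc)
    exact mul_le_mul_of_nonpos_left (by linarith) (by linarith)
  have h3 := sum_le_sum h2
  rw [← sum_mul, sum_sub_distrib, sum_sub_distrib] at h3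
  have hs0 := h.mass0.slack_nonneg hp
  have hs1 := h.mass1.slack_nonneg hp
  have hn := h.node p hp
  rw [sum_sub_distrib] at hn
  have hle0 : z0 p - ∑ c ∈ T.ch p, z0 c ≤ z0 p := by
    have : 0 ≤ ∑ c ∈ T.ch p, z0 c := sum_nonneg fun c _ => h.mass0.nonneg c
    linarith
  have h4 : ((z1 p - ∑ c ∈ T.ch p, z1 c) - (z0 p - ∑ c ∈ T.ch p, z0 c)) * L
      ≤ zlog (z1 p - ∑ c ∈ T.ch p, z1 c) - zlog (z0 p - ∑ c ∈ T.ch p, z0 c) := by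
    refine le_trans ?_ (le_zlog_sub hs0 hs1)
    have := hlog hs0 hle0
    exact mul_le_mul_of_nonpos_left (by linarith) (by linarith)
  have ho := h.off p hoff
  have h5 := log_shift_sub_le (h.mass1.nonneg p) ho
  have h6 : (z0 p - z1 p) / eta ≤ 1 / 20 := by
    rw [div_le_iff₀ he]
    have := h.off_small hoff
    linarith
  have h7 : (z0 p - z1 p) * (Real.log (z0 p + eta) - Real.log (z1 p + eta))
      ≤ (z0 p - z1 p) * (1 / 20) := mul_le_mul_of_nonneg_left (by linarith) (by linarith)
  unfold nodeEnt
  rw [← mul_sub]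
  have h8 : (zlog (z1 p) - ∑ c ∈ T.ch p, zlog (z1 c) - zlog (z1 p - ∑ c ∈ T.ch p, z1 c)) -
      (zlog (z0 p) - ∑ c ∈ T.ch p, zlog (z0 c) - zlog (z0 p - ∑ c ∈ T.ch p, z0 c))
      ≤ (z0 p - z1 p) * (1 / 20) := by
    nlinarith
  have h9 := mul_le_mul_of_nonneg_left h8 (by linarith : 0 ≤ T.w p / 2)
  linarith

/-- The logarithmic drop of the mass along the path to `l`. -/
noncomputable def drop (T : LevelTree V X) (l : X) (z : V → ℝ) (j : ℕ) : ℝ :=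
  Real.log (z (T.pth l j) + eta) - Real.log (z (T.pth l (j + 1)) + eta)

lemma IsMass.drop_nonneg {z : V → ℝ} (h : T.IsMass K z) {j : ℕ} (hj : j < T.depth) :
    0 ≤ T.drop l z j := by
  have he := eta_pos
  have := h.nonneg (T.pth l (j + 1))
  have := h.le_of_ch (T.pth_ch l hj)
  exact sub_nonneg.2 (Real.log_le_log (by linarith) (by linarith))

lemma IsMass.sum_drop_le {z : V → ℝ} (h : T.IsMass K z) :
    ∑ j ∈ range T.depth, T.drop l z j ≤ Real.log (K + eta) - Real.log eta := by
  have he := eta_pos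
  unfold drop
  rw [sum_range_sub' (fun j => Real.log (z (T.pth l j) + eta)), T.pth_zero, h.root]
  have := h.nonneg (T.pth l T.depth)
  have := Real.log_le_log he (by linarith : eta ≤ z (T.pth l T.depth) + eta)
  linarith

lemma Flow.nodeEnt_on (h : T.Flow K M l z0 z1) {j : ℕ} (hj : j < T.depth) {β : ℝ}
    (hβ : ∀ z, 0 ≤ z → z ≤ z0 (T.pth l j) - z0 (T.pth l (j + 1)) →
      Real.log (z + eta) ≤ Real.log (z0 (T.pth l (j + 1)) + eta) + β) :
    T.nodeEnt z1 (T.pth l j) - T.nodeEnt z0 (T.pth l j)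
      ≤ T.w (T.pth l j) / 2 * ((z1 (T.pth l j) - z0 (T.pth l j)) * (T.drop l z0 j + 1 / 20)
        + ((z1 (T.pth l (j + 1)) - z0 (T.pth l (j + 1))) - (z1 (T.pth l j) - z0 (T.pth l j))) * β) := by
  have he := eta_pos
  have hsib := h.sib_le hj
  have hg0 := h.gain_nonneg hj.le
  have hsm := h.gain_small hj.le
  have hlev : T.lev (T.pth l j) < T.depth := by rw [T.lev_pth l hj.le]; exact hj
  have hs0 := h.mass0.slack_nonneg hlev
  have hs1 := h.mass1.slack_nonneg hlev
  have hn := h.node _ hlev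
  have hu := T.pth_ch l hj
  have hoffc : ∀ c ∈ (T.ch (T.pth l j)).erase (T.pth l (j + 1)), z1 c ≤ z0 c := by
    intro c hc
    rw [mem_erase] at hc
    exact h.off c (not_below_sib hj hc.2 hc.1)
  unfold drop
  set p := T.pth l j with hp
  set u := T.pth l (j + 1) with hu'
  set S := (T.ch p).erase u with hS
  set L := 1 + (Real.log (z0 u + eta) + β) with hL
  have e0 : ∑ c ∈ T.ch p, z0 c = z0 u + ∑ c ∈ S, z0 c := (add_sum_erase _ _ hu).symm
  have e1 : ∑ c ∈ T.ch p, z1 c = z1 u + ∑ c ∈ S, z1 c := (add_sum_erase _ _ hu).symm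
  have f0 : ∑ c ∈ T.ch p, zlog (z0 c) = zlog (z0 u) + ∑ c ∈ S, zlog (z0 c) :=
    (add_sum_erase (T.ch p) (fun c => zlog (z0 c)) hu).symm
  have f1 : ∑ c ∈ T.ch p, zlog (z1 c) = zlog (z1 u) + ∑ c ∈ S, zlog (z1 c) :=
    (add_sum_erase (T.ch p) (fun c => zlog (z1 c)) hu).symm
  have hsum0 : 0 ≤ ∑ c ∈ S, z0 c := sum_nonneg fun c _ => h.mass0.nonneg c
  have h1 := zlog_sub_le (h.mass0.nonneg p) (h.mass1.nonneg p)
  have h2 := le_zlog_sub (h.mass0.nonneg u) (h.mass1.nonneg u)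
  have h3 : ∀ c ∈ S, (z1 c - z0 c) * L ≤ zlog (z1 c) - zlog (z0 c) := by
    intro c hc
    refine le_trans ?_ (le_zlog_sub (h.mass0.nonneg c) (h.mass1.nonneg c))
    have ho := hoffc c hc
    have hcle : z0 c ≤ ∑ c ∈ S, z0 c := single_le_sum (fun v _ => h.mass0.nonneg v) hc
    have := hβ _ (h.mass0.nonneg c) (by linarith)
    exact mul_le_mul_of_nonpos_left (by linarith) (by linarith)
  have h3' := sum_le_sum h3
  rw [← sum_mul, sum_sub_distrib, sum_sub_distrib] at h3'
  rw [sum_sub_distrib] at hn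
  have h4 : ((z1 p - ∑ c ∈ T.ch p, z1 c) - (z0 p - ∑ c ∈ T.ch p, z0 c)) * L
      ≤ zlog (z1 p - ∑ c ∈ T.ch p, z1 c) - zlog (z0 p - ∑ c ∈ T.ch p, z0 c) := by
    refine le_trans ?_ (le_zlog_sub hs0 hs1)
    have := hβ _ hs0 (by linarith)
    exact mul_le_mul_of_nonpos_left (by linarith) (by linarith)
  have h5 := log_shift_sub_le (h.mass0.nonneg p) (by linarith : z0 p ≤ z1 p)
  have h6 : (z1 p - z0 p) / eta ≤ 1 / 20 := by
    rw [div_le_iff₀ he]; linarith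
  have h7 : (z1 p - z0 p) * (Real.log (z1 p + eta) - Real.log (z0 p + eta))
      ≤ (z1 p - z0 p) * (1 / 20) := mul_le_mul_of_nonneg_left (by linarith) (by linarith)
  unfold nodeEnt
  rw [← mul_sub]
  refine mul_le_mul_of_nonneg_left ?_ (by have := T.w_pos p; linarith)
  rw [f0, f1]
  have h8 : ((∑ c ∈ S, z1 c - ∑ c ∈ S, z0 c)
      + ((z1 p - ∑ c ∈ T.ch p, z1 c) - (z0 p - ∑ c ∈ T.ch p, z0 c))) * L
      = -((z1 u - z0 u) - (z1 p - z0 p)) * L := by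
    rw [e0, e1]; ring
  rw [add_mul] at h8
  have h9 : (z1 p - z0 p) * (1 + Real.log (z1 p + eta)) - (z1 u - z0 u) * (1 + Real.log (z0 u + eta))
      + ((z1 u - z0 u) - (z1 p - z0 p)) * L
      = (z1 p - z0 p) * (Real.log (z1 p + eta) - Real.log (z0 p + eta))
        + (z1 p - z0 p) * (Real.log (z0 p + eta) - Real.log (z0 u + eta))
        + ((z1 u - z0 u) - (z1 p - z0 p)) * β := by
    rw [hL]; ring
  linarith

lemma Flow.level_le (h : T.Flow K M l z0 z1) {j : ℕ} (hj : j < T.depth) :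
    T.nodeEnt z1 (T.pth l j) - T.nodeEnt z0 (T.pth l j)
      - T.w (T.pth l (j + 1)) * (min (z1 (T.pth l (j + 1))) (2 * eta)
        - min (z0 (T.pth l (j + 1))) (2 * eta))
      ≤ 2 * M * T.drop l z0 j + 1 / 40 * (T.w (T.pth l j) * (z1 (T.pth l j) - z0 (T.pth l j)))
        - 17 / 25 * (T.w (T.pth l j) / 2 *
    ((z1 (T.pth l (j + 1)) - z0 (T.pth l (j + 1))) - (z1 (T.pth l j) - z0 (T.pth l j)))) := by
  have he := eta_pos
  have hR := h.mass0.drop_nonneg (l := l) hj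
  have hw := T.w_pos (T.pth l j)
  have hws := w_pth_succ (T := T) (l := l) hj
  have hg0 := h.gain_nonneg hj.le
  have hg1 := h.gain_nonneg (j := j + 1) hj
  have hq := h.gain_succ hj
  have hsm := h.gain_small (j := j + 1) hj
  have hM := h.w_gain_le (j := j + 1) hj
  have hup : z0 (T.pth l (j + 1)) ≤ z0 (T.pth l j) := h.mass0.le_of_ch (T.pth_ch l hj)
  have hu0 := h.mass0.nonneg (T.pth l (j + 1))
  have hon := fun β hβ => h.nodeEnt_on hj (β := β) hβ
  have hdrop : T.drop l z0 j
    = Real.log (z0 (T.pth l j) + eta) - Real.log (z0 (T.pth l (j + 1)) + eta) := rfl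
  rw [hws] at hM ⊢
  generalize T.drop l z0 j = R at *
  generalize T.nodeEnt z1 (T.pth l j) - T.nodeEnt z0 (T.pth l j) = E at *
  generalize T.w (T.pth l j) = w at *
  have hminmono : min (z0 (T.pth l (j + 1))) (2 * eta) ≤ min (z1 (T.pth l (j + 1))) (2 * eta) :=
    min_le_min_right _ (by linarith)
  rcases lt_or_ge (z0 (T.pth l (j + 1))) eta with ht | ht
  · have h1 := hon R fun z hz hzle => by
      rw [hdrop]
      have := Real.log_le_log (by linarith : 0 < z + eta)
        (by linarith : z + eta ≤ z0 (T.pth l j) + eta)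
      linarith
    rw [min_eq_left (by linarith), min_eq_left (by linarith)]
    generalize z1 (T.pth l (j + 1)) - z0 (T.pth l (j + 1)) = g1 at *
    generalize z1 (T.pth l j) - z0 (T.pth l j) = g0 at *
    have h2 : w / 2 * (g0 * (R + 1 / 20) + (g1 - g0) * R)
        = (w / 2 * g1) * R + 1 / 40 * (w * g0) := by ring
    have h3 : (w / 2 * g1) * R ≤ M * R := mul_le_mul_of_nonneg_right hM hR
    have h4 : 0 ≤ M * R := mul_nonneg h.nonneg hR
    have h5 : w / 2 * (g1 - g0) ≤ w / 2 * g1 := mul_le_mul_of_nonneg_left (by linarith) (by linarith)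
    have h6 : 0 ≤ w / 2 * (g1 - g0) := mul_nonneg (by linarith) (by linarith)
    linarith
  · have h1 := hon (2 * R - 17 / 25) fun z hz hzle => by
      set y := z0 (T.pth l (j + 1)) + eta with hy
      set P := z0 (T.pth l j) + eta with hP
      have hypos : 0 < y := by linarith
      have hPpos : 0 < P := by linarith
      have h2 : z + eta ≤ P * P / (2 * y) := by
        rw [le_div_iff₀ (by linarith)]
        have : z + eta ≤ P - y / 2 := by linarith
        nlinarith [sq_nonneg (P - y)]
      have h3 := Real.log_le_log (by linarith : 0 < z + eta) h2
      rw [Real.log_div (by positivity) (by positivity), Real.log_mul hPpos.ne' hPpos.ne',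
        Real.log_mul (by norm_num) hypos.ne'] at h3
      have := Real.log_two_gt_d9
      linarith
    generalize hg1' : z1 (T.pth l (j + 1)) - z0 (T.pth l (j + 1)) = g1 at *
    generalize z1 (T.pth l j) - z0 (T.pth l j) = g0 at *
    have h2 : w / 2 * (g0 * (R + 1 / 20) + (g1 - g0) * (2 * R - 17 / 25))
        = (w / 2 * (2 * g1 - g0)) * R + 1 / 40 * (w * g0) - 17 / 25 * (w / 2 * (g1 - g0)) := by ring
    have h3 : (w / 2 * (2 * g1 - g0)) * R ≤ (2 * M) * R := by
      refine mul_le_mul_of_nonneg_right ?_ hR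
      nlinarith
    have h4 : 0 ≤ w / 2 * (min (z1 (T.pth l (j + 1))) (2 * eta)
        - min (z0 (T.pth l (j + 1))) (2 * eta)) := mul_nonneg (by linarith) (by linarith)
    linarith

/-- The movement of a small flow is paid for by the potential. -/
theorem Flow.potential (h : T.Flow K M l z0 z1) :
    T.treeEnt z1 - T.fill l z1 + T.wdist z0 z1 / 8
      ≤ T.treeEnt z0 - T.fill l z0 + 2 * M * (Real.log (K + eta) - Real.log eta) := by
  have e1 : ∀ z : V → ℝ, T.treeEnt z = ∑ j ∈ range T.depth, T.nodeEnt z (T.pth l j)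
      + ∑ p ∈ univ.filter (fun p => ¬ T.Below p (T.leaf l)),
        if T.lev p < T.depth then T.nodeEnt z p else 0 := by
    intro z
    unfold treeEnt
    rw [sum_filter, ← sum_filter_add_sum_filter_not univ (fun v => T.Below v (T.leaf l)),
      T.sum_path l (fun p => if T.lev p < T.depth then T.nodeEnt z p else 0), sum_range_succ,
      if_neg (by rw [T.lev_pth l le_rfl]; exact lt_irrefl _), add_zero]
    congr 1
    refine sum_congr rfl fun j hj => ?_
    rw [mem_range] at hj
    rw [if_pos (by rw [T.lev_pth l hj.le]; exact hj)]
  have e2 : ∀ z : V → ℝ, T.fill l z = T.w (T.pth l 0) * min (z (T.pth l 0)) (2 * eta)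
      + ∑ j ∈ range T.depth, T.w (T.pth l (j + 1)) * min (z (T.pth l (j + 1))) (2 * eta) := by
    intro z
    unfold fill
    rw [sum_range_succ', add_comm]
  have e3 : z1 (T.pth l 0) = z0 (T.pth l 0) := by rw [T.pth_zero, h.mass0.root, h.mass1.root]
  have h1 := sum_le_sum fun j hj => h.level_le (mem_range.1 hj)
  rw [sum_sub_distrib, sum_sub_distrib, sum_sub_distrib, sum_add_distrib, ← mul_sum, ← mul_sum,
    ← mul_sum] at h1
  simp only [mul_sub] at h1
  rw [sum_sub_distrib] at h1
  have h2 : ∑ p ∈ univ.filter (fun p => ¬ T.Below p (T.leaf l)),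
        (if T.lev p < T.depth then T.nodeEnt z1 p else 0)
      - ∑ p ∈ univ.filter (fun p => ¬ T.Below p (T.leaf l)),
        (if T.lev p < T.depth then T.nodeEnt z0 p else 0)
      ≤ 1 / 40 * ∑ p ∈ univ.filter (fun p => ¬ T.Below p (T.leaf l)), T.w p * (z0 p - z1 p) := by
    rw [← sum_sub_distrib, mul_sum]
    refine sum_le_sum fun p hp => ?_
    simp only [mem_filter, mem_univ, true_and] at hp
    split_ifs with hl
    · exact h.nodeEnt_off hl hp
    · have := h.off p hp
      have := mul_nonneg (T.w_pos p).le (by linarith : 0 ≤ z0 p - z1 p)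
      linarith
  have h3 := h.off_le
  have h4 := h.path_le
  rw [sum_range_succ] at h4
  have h5 := mul_nonneg (T.w_pos (T.pth l T.depth)).le (h.gain_nonneg le_rfl)
  have h6 := h.wdist_le
  have h7 := h.mass0.sum_drop_le (l := l)
  have h8 := mul_le_mul_of_nonneg_left h7 (by have := h.nonneg; linarith : 0 ≤ 2 * M)
  have h9 : 0 ≤ T.inflow l z0 z1 := by
    have : 0 ≤ T.wdist z0 z1 := sum_nonneg fun v _ => mul_nonneg (T.w_pos v).le (abs_nonneg _)
    linarith
  have e4 : T.inflow l z0 z1 = ∑ j ∈ range T.depth, (T.w (T.pth l j) / 2 *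
    (z1 (T.pth l (j + 1)) - z0 (T.pth l (j + 1))) - T.w (T.pth l j) / 2 *
      (z1 (T.pth l j) - z0 (T.pth l j))) := by
    unfold inflow
    exact sum_congr rfl fun j _ => by ring
  rw [e1 z1, e1 z0, e2 z1, e2 z0, e3]
  simp only [mul_sub] at h4 h5
  have e5 := e4
  simp only [mul_sub] at e5
  linarith

end LevelTree

namespace LevelTree

section Fin

variable {V X : Type*} {T : LevelTree V X} [Fintype V] [DecidableEq V] [Fintype X]
variable {k : ℕ} {d ε : ℝ} {l : X} {x x0 x1 : V → ℕ → ℝ}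

lemma Feas.isMass (h : T.Feas k x) (hc : ∀ v i, x v i ≤ 1) (hk : k ≤ Fintype.card X) :
    T.IsMass k (T.mass x) :=
  ⟨mass_nonneg hc, fun _ hp => h.mass_children hp, h.mass_root hk⟩

lemma IsStep.mass_node (hd : 0 < d) (hε : 0 ≤ ε) (h : T.IsStep k d ε l x0 x1) {p : V}
    (hp : T.lev p < T.depth) :
    T.mass x1 p - T.mass x0 p ≤ ∑ c ∈ T.ch p, (T.mass x1 c - T.mass x0 c) := by
  have h1 := h.psum_children hd hε hp
  have e : ∑ c ∈ T.ch p, (T.mass x1 c - T.mass x0 c)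
      = - ∑ c ∈ T.ch p, (psum x1 c (T.nn c) - psum x0 c (T.nn c)) := by
    rw [← sum_neg_distrib]
    exact sum_congr rfl fun c _ => by unfold mass; ring
  rw [e]
  unfold mass
  linarith

lemma IsStep.mass_off (hd : 0 < d) (h : T.IsStep k d ε l x0 x1) {v : V}
    (hv : ¬ T.Below v (T.leaf l)) : T.mass x1 v ≤ T.mass x0 v := by
  have := h.psum_mono hd v hv _ le_rfl
  unfold mass; linarith

lemma IsStep.mass_on (hd : 0 < d) (hε : 0 ≤ ε) (hk : k ≤ Fintype.card X)
    (h : T.IsStep k d ε l x0 x1) (j : ℕ) (hj : j ≤ T.depth) :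
    0 ≤ T.mass x1 (T.pth l j) - T.mass x0 (T.pth l j) := by
  induction j with
  | zero => rw [T.pth_zero, h.feas0.mass_root hk, h.feas1.mass_root hk, sub_self]
  | succ j ih =>
    have h1 := ih (by omega)
    have h2 := h.mass_node hd hε (p := T.pth l j) (by rw [T.lev_pth l (by omega)]; omega)
    rw [← add_sum_erase _ _ (T.pth_ch l (show j < T.depth by omega))] at h2
    have h3 : ∑ c ∈ (T.ch (T.pth l j)).erase (T.pth l (j + 1)),
        (T.mass x1 c - T.mass x0 c) ≤ 0 := by
      refine sum_nonpos fun c hc => sub_nonpos.2 (h.mass_off hd ?_)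
      rw [mem_erase] at hc
      exact not_below_sib (by omega) hc.2 hc.1
    linarith

lemma sum_sub_ge {f : V → ℝ} (hf : ∀ p, T.lev p < T.depth → f p ≤ ∑ c ∈ T.ch p, f c) (q : V) :
    (2 * T.w q - (1 / 2) ^ T.depth) * f q ≤ ∑ v ∈ T.sub q, T.w v * f v := by
  induction q using T.up_induction with
  | h p ih =>
    rw [T.sum_sub]
    rcases (T.lev_le p).lt_or_eq with hp | hp
    · have h1 : ∑ c ∈ T.ch p, (T.w p - (1 / 2) ^ T.depth) * f c
          ≤ ∑ c ∈ T.ch p, ∑ v ∈ T.sub c, T.w v * f v := by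
        refine sum_le_sum fun c hc => le_trans (le_of_eq ?_) (ih c hc)
        rw [T.w_ch hc]; ring
      rw [← mul_sum] at h1
      have h2 := mul_le_mul_of_nonneg_left (hf p hp) (sub_nonneg.2 (T.w_ge p))
      linarith
    · rw [T.ch_leaf hp, sum_empty]
      have : T.w p = (1 / 2) ^ T.depth := by rw [w, hp]
      rw [← this]; linarith

lemma IsStep.flow (hd : 0 < d) (hd1 : d ≤ 1) (hε : 0 ≤ ε) (hk : k ≤ Fintype.card X)
    (hs : 2 ^ (T.depth + 1) * T.depth * (2 * ε) ≤ eta / 20) (h : T.IsStep k d ε l x0 x1) :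
    T.Flow k (ε * (x0 (T.leaf l) 0 + d)) l (T.mass x0) (T.mass x1) where
  mass0 := h.feas0.isMass h.cap0 hk
  mass1 := h.feas1.isMass h.cap1 hk
  off v hv := h.mass_off hd hv
  node p hp := h.mass_node hd hε hp
  bound q hq hl := by
    have h1 := h.mass_sub_le hd hq hl
    have h2 := sum_sub_ge (T := T) (f := fun v => T.mass x1 v - T.mass x0 v)
      (fun p hp => h.mass_node hd hε hp) q
    have h3 := h.mass_on hd hε hk (T.lev q) (T.lev_le q)
    rw [← T.eq_pth hl] at h3
    have h4 := mul_nonneg (sub_nonneg.2 (T.w_ge q)) h3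
    linarith
  nonneg := mul_nonneg hε (add_nonneg (h.feas0.nonneg _ _) hd.le)
  small := by
    refine le_trans ?_ hs
    have : ε * (x0 (T.leaf l) 0 + d) ≤ 2 * ε := by
      have := h.cap0 (T.leaf l) 0
      nlinarith
    gcongr

/-- The logarithm of the aspect ratio of the server masses. -/
noncomputable def lam (k : ℕ) : ℝ := Real.log (k + eta) - Real.log eta

lemma lam_nonneg (k : ℕ) : 0 ≤ lam k := by
  unfold lam
  have := eta_pos
  have : Real.log eta ≤ Real.log (k + eta) :=
    Real.log_le_log eta_pos (by linarith [Nat.cast_nonneg (α := ℝ) k])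
  linarith

lemma wdist_triangle (z0 z1 z2 : V → ℝ) : T.wdist z0 z2 ≤ T.wdist z0 z1 + T.wdist z1 z2 := by
  unfold wdist
  rw [← sum_add_distrib]
  refine sum_le_sum fun v _ => ?_
  rw [← mul_add]
  refine mul_le_mul_of_nonneg_left ?_ (T.w_pos v).le
  have := abs_sub_le (z2 v) (z1 v) (z0 v)
  linarith

lemma wdist_nonneg (z0 z1 : V → ℝ) : 0 ≤ T.wdist z0 z1 :=
  sum_nonneg fun v _ => mul_nonneg (T.w_pos v).le (abs_nonneg _)

lemma IsStep.potential_le (hd : 0 < d) (hd1 : d ≤ 1) (hε : 0 ≤ ε) (hk : k ≤ Fintype.card X)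
    (hs : 2 ^ (T.depth + 1) * T.depth * (2 * ε) ≤ eta / 20) (hs' : ε * 2 ^ T.depth ≤ 1 / 4)
    (h : T.IsStep k d ε l x0 x1) (hx : d < x0 (T.leaf l) 0) {A : Finset X} (hA : A.card = k)
    (hl : l ∈ A) :
    8 * lam k * T.ent d A x1 + (T.treeEnt (T.mass x1) - T.fill l (T.mass x1))
      + T.wdist (T.mass x0) (T.mass x1) / 8
    ≤ 8 * lam k * T.ent d A x0 + (T.treeEnt (T.mass x0) - T.fill l (T.mass x0)) := by
  have h1 := (h.flow hd hd1 hε hk hs).potential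
  have h2 := h.ent_le hd hA hl
  have h3 := h.leaf_ge hd hs'
  have h4 : ε * (x0 (T.leaf l) 0 + d) ≤ 4 * (T.ent d A x0 - T.ent d A x1) := by
    have : x0 (T.leaf l) 0 + d ≤ 4 * x1 (T.leaf l) 0 := by linarith
    nlinarith
  have h5 := mul_le_mul_of_nonneg_right h4 (lam_nonneg k)
  unfold lam at *
  linarith

lemma continuousOn_ent (hd : 0 < d) (A : Finset X) :
    ContinuousOn (T.ent d A) (Set.Icc 0 1) := by
  unfold ent
  refine continuousOn_finsetSum _ fun v _ => continuousOn_finsetSum _ fun i _ => ?_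
  have hc : Continuous fun x : V → ℕ → ℝ => x v i := by fun_prop
  refine continuousOn_const.mul (hc.continuousOn.sub (continuousOn_const.mul ?_))
  refine ContinuousOn.log (hc.add continuous_const).continuousOn fun x hx => ?_
  have : 0 ≤ x v i := hx.1 v i
  positivity

lemma exists_ent_bound (T : LevelTree V X) (hd : 0 < d) :
    ∃ B, ∀ A, ∀ x ∈ Set.Icc (0 : V → ℕ → ℝ) 1, |T.ent d A x| ≤ B := by
  have : ∀ A, ∃ B, ∀ x ∈ Set.Icc (0 : V → ℕ → ℝ) 1, |T.ent d A x| ≤ B := fun A =>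
    isCompact_Icc.exists_bound_of_continuousOn (continuousOn_ent hd A)
  choose B hB using this
  obtain ⟨M, hM⟩ := (Set.finite_range B).bddAbove
  exact ⟨M, fun A x hx => (hB A x hx).trans (hM ⟨A, rfl⟩)⟩

lemma continuous_treeEnt (T : LevelTree V X) : Continuous T.treeEnt := by
  have hz : Continuous zlog := by
    unfold zlog
    exact Real.continuous_mul_log.comp (continuous_id.add continuous_const)
  unfold treeEnt nodeEnt
  fun_prop

lemma exists_treeEnt_bound (T : LevelTree V X) (K : ℝ) :
    ∃ B, ∀ z, T.IsMass K z → |T.treeEnt z| ≤ B := by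
  obtain ⟨B, hB⟩ := (isCompact_Icc (a := (0 : V → ℝ)) (b := fun _ => K)).exists_bound_of_continuousOn
    T.continuous_treeEnt.continuousOn
  exact ⟨B, fun z hz => hB z ⟨hz.nonneg, hz.le_root⟩⟩

lemma Feas.mem_Icc (h : T.Feas k x) (hc : ∀ v i, x v i ≤ 1) :
    x ∈ Set.Icc (0 : V → ℕ → ℝ) 1 := ⟨fun v i => h.nonneg v i, fun v i => hc v i⟩

lemma exists_small (T : LevelTree V X) : ∃ ε : ℝ, 0 < ε ∧
    2 ^ (T.depth + 1) * T.depth * (2 * ε) ≤ eta / 20 ∧ ε * 2 ^ T.depth ≤ 1 / 4 := by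
  set P : ℝ := 2 ^ T.depth with hP
  have h1 : 1 ≤ P := one_le_pow₀ (by norm_num)
  have h2 : (1 : ℝ) ≤ T.depth := by exact_mod_cast T.depth_pos
  have := eta_pos
  refine ⟨eta / (80 * P * T.depth), by positivity, le_of_eq ?_, ?_⟩
  · rw [pow_succ, ← hP]; field_simp; norm_num
  · rw [div_mul_eq_mul_div, div_le_iff₀ (by positivity)]
    unfold eta
    nlinarith

theorem Feas.exists_fill (hd : 0 < d) (hd1 : d ≤ 1) (hk1 : 1 ≤ k) (hk : k ≤ Fintype.card X)
    (h : T.Feas k x) (hc : ∀ v i, x v i ≤ 1) (l : X) :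
    ∃ x', T.Feas k x' ∧ (∀ v i, x' v i ≤ 1) ∧ x' (T.leaf l) 0 ≤ d ∧
      ∀ A : Finset X, A.card = k → l ∈ A →
        8 * lam k * T.ent d A x' + (T.treeEnt (T.mass x') - T.fill l (T.mass x'))
          + T.wdist (T.mass x) (T.mass x') / 8
        ≤ 8 * lam k * T.ent d A x + (T.treeEnt (T.mass x) - T.fill l (T.mass x)) := by
  obtain ⟨ε, hε, hs, hs'⟩ := T.exists_small
  obtain ⟨B, hB⟩ := T.exists_ent_bound hd
  obtain ⟨A0, hlA0, -, hA0⟩ := Finset.exists_subsuperset_card_eq (s := {l}) (t := univ) (n := k)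
    (by simp) (by simpa) (by simpa)
  have key : ∀ (N : ℕ) x, T.Feas k x → (∀ v i, x v i ≤ 1) →
      T.ent d A0 x < -B + N * (ε * d / 2) →
      ∃ x', T.Feas k x' ∧ (∀ v i, x' v i ≤ 1) ∧ x' (T.leaf l) 0 ≤ d ∧
      ∀ A : Finset X, A.card = k → l ∈ A →
        8 * lam k * T.ent d A x' + (T.treeEnt (T.mass x') - T.fill l (T.mass x'))
          + T.wdist (T.mass x) (T.mass x') / 8
        ≤ 8 * lam k * T.ent d A x + (T.treeEnt (T.mass x) - T.fill l (T.mass x)) := by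
    intro N
    induction N with
    | zero =>
      intro x h hc hlt
      have := (abs_le.1 (hB A0 x (h.mem_Icc hc))).1
      simp at hlt; linarith
    | succ N ih =>
      intro x h hc hlt
      by_cases hx : x (T.leaf l) 0 ≤ d
      · exact ⟨x, h, hc, hx, fun A _ _ => by simp [wdist]⟩
      · push Not at hx
        obtain ⟨x1, h1⟩ := exists_isStep hd hε.le l h hc
        have e1 := h1.ent_le hd hA0 (hlA0 (mem_singleton_self l))
        have e2 := h1.leaf_ge hd hs'
        have e3 : ε * (d / 2) ≤ ε * x1 (T.leaf l) 0 :=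
          mul_le_mul_of_nonneg_left (by linarith) hε.le
        obtain ⟨x', hf, hc', hx', hp⟩ := ih x1 h1.feas1 h1.cap1 (by push_cast at hlt; linarith)
        refine ⟨x', hf, hc', hx', fun A hA hl => ?_⟩
        have p1 := hp A hA hl
        have p2 := h1.potential_le hd hd1 hε.le hk hs hs' hx hA hl
        have p3 := T.wdist_triangle (T.mass x) (T.mass x1) (T.mass x')
        linarith
  obtain ⟨N, hN⟩ := exists_nat_gt ((T.ent d A0 x + B) / (ε * d / 2))
  rw [div_lt_iff₀ (by positivity)] at hN
  exact key N x h hc (by linarith)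

lemma IsMass.le_of_below {K : ℝ} {z : V → ℝ} (h : T.IsMass K z) (l : X) {j : ℕ}
    (hj : j ≤ T.depth) : z (T.leaf l) ≤ z (T.pth l j) := by
  induction hj using Nat.decreasingInduction with
  | of_succ j hj ih => exact ih.trans (h.le_of_ch (T.pth_ch l hj))
  | self => rw [T.pth_depth]

/-- A request can be served so that the decrease of the potential pays for the movement. -/
theorem Feas.exists_serve (hd : 0 < d) (hd1 : d ≤ 1 / 3) (hk1 : 1 ≤ k)
    (hk : k ≤ Fintype.card X) (h : T.Feas k x) (hc : ∀ v i, x v i ≤ 1) (l : X) :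
    ∃ x', T.Feas k x' ∧ (∀ v i, x' v i ≤ 1) ∧ x' (T.leaf l) 0 ≤ d ∧
      ∀ A : Finset X, A.card = k → l ∈ A →
        8 * lam k * T.ent d A x' + T.treeEnt (T.mass x')
          + T.wdist (T.mass x) (T.mass x') / 16
        ≤ 8 * lam k * T.ent d A x + T.treeEnt (T.mass x) := by
  obtain ⟨x', hf, hc', hx', hp⟩ := h.exists_fill hd (by linarith) hk1 hk hc l
  refine ⟨x', hf, hc', hx', fun A hA hl => ?_⟩
  have h1 := hp A hA hl
  have h2 : T.fill l (T.mass x') - T.fill l (T.mass x)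
      ≤ T.wdist (T.mass x) (T.mass x') / 16 := by
    have h3 : ∑ v ∈ univ.filter (fun v => T.Below v (T.leaf l)), T.w v * |T.mass x' v - T.mass x v|
        ≤ T.wdist (T.mass x) (T.mass x') :=
      sum_le_sum_of_subset_of_nonneg (filter_subset _ _)
        fun v _ _ => mul_nonneg (T.w_pos v).le (abs_nonneg _)
    rw [T.sum_path l] at h3
    refine le_trans ?_ (div_le_div_of_nonneg_right h3 (by norm_num))
    unfold fill
    rw [← sum_sub_distrib, sum_div]
    refine sum_le_sum fun j hj => ?_
    have hj : j ≤ T.depth := by simp at hj; omega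
    have h4 := (hf.isMass hc' hk).le_of_below l hj
    rw [mass_leaf] at h4
    have h5 := min_le_right (T.mass x' (T.pth l j)) (2 * eta)
    rw [← mul_sub, mul_div_assoc]
    refine mul_le_mul_of_nonneg_left ?_ (T.w_pos _).le
    have h6 := le_abs_self (T.mass x' (T.pth l j) - T.mass x (T.pth l j))
    have h7 := abs_nonneg (T.mass x' (T.pth l j) - T.mass x (T.pth l j))
    unfold eta at *
    have h8 : 0 ≤ T.mass x (T.pth l j) := mass_nonneg hc _
    rcases le_total (T.mass x (T.pth l j)) (2 * (1 / 64)) with h9 | h9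
    · rw [min_eq_left h9]
      linarith
    · rw [min_eq_right h9]
      linarith
  linarith

lemma sum_abs_cfg_le (A B : Finset X) (v : V) :
    ∑ i ∈ range (T.nn v), |T.cfg A v i - T.cfg B v i| ≤ |(T.cnt A v : ℝ) - T.cnt B v| := by
  have key : ∀ A B : Finset X, T.cnt A v ≤ T.cnt B v →
      ∑ i ∈ range (T.nn v), |T.cfg A v i - T.cfg B v i| ≤ |(T.cnt A v : ℝ) - T.cnt B v| := by
    intro A B hAB
    have e : ∑ i ∈ range (T.nn v), |T.cfg A v i - T.cfg B v i|
        = psum (T.cfg A) v (T.nn v) - psum (T.cfg B) v (T.nn v) := by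
      unfold psum
      rw [← sum_sub_distrib]
      refine sum_congr rfl fun i _ => abs_of_nonneg ?_
      unfold cfg
      split_ifs with h1 h2
      · norm_num
      · omega
      · norm_num
      · norm_num
    have hA : T.cnt A v ≤ T.nn v := T.cnt_mono (subset_univ _) v
    have hB : T.cnt B v ≤ T.nn v := T.cnt_mono (subset_univ _) v
    rw [e, psum_cfg, psum_cfg, Nat.cast_sub hA, Nat.cast_sub hB, abs_sub_comm]
    refine le_trans (le_of_eq ?_) (le_abs_self _)
    ring
  rcases le_total (T.cnt A v) (T.cnt B v) with h | h
  · exact key A B h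
  · rw [abs_sub_comm (T.cnt A v : ℝ)]
    simp_rw [abs_sub_comm (T.cfg A v _)]
    exact key B A h

lemma ent_sub_le {T : LevelTree V X} (hd : 0 < d) (hd1 : d ≤ 1 / 3) (hx : x ∈ Set.Icc (0 : V → ℕ → ℝ) 1)
    (A B : Finset X) :
    T.ent d B x - T.ent d A x
      ≤ -Real.log d * T.wdist (fun v => T.cnt A v) (fun v => T.cnt B v) := by
  unfold ent wdist
  rw [← sum_sub_distrib, mul_sum]
  refine sum_le_sum fun v _ => ?_
  rw [← sum_sub_distrib]
  have h1 : ∀ i ∈ range (T.nn v),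
      T.w v * (x v i - (T.cfg B v i + d) * Real.log (x v i + d))
        - T.w v * (x v i - (T.cfg A v i + d) * Real.log (x v i + d))
      ≤ T.w v * (-Real.log d * |T.cfg A v i - T.cfg B v i|) := by
    intro i _
    have hx0 : 0 ≤ x v i := hx.1 v i
    have hx1 : x v i ≤ 1 := hx.2 v i
    have e : T.w v * (x v i - (T.cfg B v i + d) * Real.log (x v i + d))
        - T.w v * (x v i - (T.cfg A v i + d) * Real.log (x v i + d))
        = T.w v * ((T.cfg A v i - T.cfg B v i) * Real.log (x v i + d)) := by ring
    rw [e]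
    refine mul_le_mul_of_nonneg_left ?_ (T.w_pos v).le
    have h2 : |Real.log (x v i + d)| ≤ -Real.log d := by
      rw [abs_le]
      constructor
      · rw [neg_neg]; exact Real.log_le_log hd (by linarith)
      · rw [← Real.log_inv]
        refine Real.log_le_log (by linarith) ?_
        have : 3 ≤ d⁻¹ := by
          rw [le_inv_comm₀ (by norm_num) hd]; linarith
        linarith
    refine (le_abs_self _).trans ?_
    rw [abs_mul, mul_comm]
    exact mul_le_mul_of_nonneg_right h2 (abs_nonneg _)
  refine (sum_le_sum h1).trans ?_
  rw [← mul_sum, ← mul_sum]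
  have h2 := sum_abs_cfg_le (T := T) A B v
  have h3 : 0 ≤ -Real.log d := by
    have := Real.log_nonpos hd.le (by linarith); linarith
  rw [abs_sub_comm (T.cnt A v : ℝ)] at h2
  have := mul_le_mul_of_nonneg_left h2 (mul_nonneg h3 (T.w_pos v).le)
  linarith

end Fin

end LevelTree

/-- The integer `n` is the real number `m` rounded up or down. -/
def Near (m : ℝ) (n : ℤ) : Prop := ∀ j : ℤ, ((j : ℝ) ≤ m → j ≤ n) ∧ (m ≤ j → n ≤ j)

namespace Near

variable {m ε : ℝ} {n a b : ℤ}

lemma neg (h : Near m n) : Near (-m) (-n) := fun j =>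
  ⟨fun hj => by have := (h (-j)).2 (by push_cast; linarith); omega,
    fun hj => by have := (h (-j)).1 (by push_cast; linarith); omega⟩

lemma pred (ha : Near m a) (hb : Near m b) (h : b < a) : Near m (a - 1) := fun j =>
  ⟨fun hj => by have := (hb j).1 hj; omega, fun hj => by have := (ha j).2 hj; omega⟩

lemma succ (ha : Near m a) (hb : Near m b) (h : a < b) : Near m (a + 1) := fun j =>
  ⟨fun hj => by have := (ha j).1 hj; omega, fun hj => by have := (hb j).2 hj; omega⟩

lemma le_add_one (ha : Near m a) (hb : Near m b) : a ≤ b + 1 := by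
  by_contra! h
  rcases le_total m ((b + 1 : ℤ) : ℝ) with h1 | h1
  · have := (ha _).2 h1; omega
  · have := (hb _).1 h1; omega

end Near

/-- There is no integer within `ε` of `m`, except possibly `m` itself. -/
def Gap (m ε : ℝ) : Prop := ∀ j : ℤ, (m - ε ≤ j → m ≤ j) ∧ ((j : ℝ) ≤ m + ε → (j : ℝ) ≤ m)

lemma Gap.of_le {m ε δ : ℝ} (h : Gap m ε) (hd : δ ≤ ε) : Gap m δ := fun j =>
  ⟨fun hj => (h j).1 (by linarith), fun hj => (h j).2 (by linarith)⟩

lemma exists_gap (m : ℝ) : ∃ ε > 0, Gap m ε := by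
  have h1 := Int.ceil_lt_add_one m
  have h2 := Int.lt_floor_add_one m
  refine ⟨min (m + 1 - ⌈m⌉) (⌊m⌋ + 1 - m) / 2, ?_, fun j => ⟨fun hj => ?_, fun hj => ?_⟩⟩
  · have := lt_min (show (0 : ℝ) < m + 1 - ⌈m⌉ by linarith) (show (0 : ℝ) < ⌊m⌋ + 1 - m by linarith)
    linarith
  · have h3 := min_le_left (m + 1 - (⌈m⌉ : ℝ)) (⌊m⌋ + 1 - m)
    have h4 : (⌈m⌉ : ℝ) - 1 < j := by linarith
    have h5 : ⌈m⌉ ≤ j := by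
      have : ⌈m⌉ - 1 < j := by exact_mod_cast h4
      omega
    exact Int.ceil_le.1 h5
  · have h3 := min_le_right (m + 1 - (⌈m⌉ : ℝ)) (⌊m⌋ + 1 - m)
    have h4 : (j : ℝ) < ⌊m⌋ + 1 := by linarith
    have h5 : j ≤ ⌊m⌋ := by
      have : j < ⌊m⌋ + 1 := by exact_mod_cast h4
      omega
    exact Int.le_floor.1 h5

lemma Near.sub {m ε : ℝ} {n : ℤ} (h : Near m n) (hg : Gap m ε) (hε : 0 < ε) : Near (m - ε) n :=
  fun j => ⟨fun hj => (h j).1 (by linarith), fun hj => (h j).2 ((hg j).1 hj)⟩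

lemma Near.add {m ε : ℝ} {n : ℤ} (h : Near m n) (hg : Gap m ε) (hε : 0 < ε) : Near (m + ε) n :=
  fun j => ⟨fun hj => (h j).1 ((hg j).2 hj), fun hj => (h j).2 (by linarith)⟩

lemma Near.sub_pred {m ε : ℝ} {n : ℤ} (h : Near m n) (hg : Gap m ε) (hε : 0 < ε) (hn : m ≤ n) :
    Near (m - ε) (n - 1) := fun j =>
  ⟨fun hj => by
    have : (j : ℝ) < n := by linarith
    have : j < n := by exact_mod_cast this
    omega,
  fun hj => by have := (h j).2 ((hg j).1 hj); omega⟩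

lemma Near.add_succ {m ε : ℝ} {n : ℤ} (h : Near m n) (hg : Gap m ε) (hε : 0 < ε)
    (hn : (n : ℝ) ≤ m) : Near (m + ε) (n + 1) := fun j =>
  ⟨fun hj => by have := (h j).1 ((hg j).2 hj); omega,
  fun hj => by
    have : (n : ℝ) < j := by linarith
    have : n < j := by exact_mod_cast this
    omega⟩

namespace LevelTree

section Fin

variable {V X : Type*} (T : LevelTree V X) [Fintype V] [DecidableEq V] [Fintype X]

/-- The part of the mass below `v` that is located at `v` itself. -/
def slk {M : Type*} [AddCommGroup M] (N : V → M) (v : V) : M := N v - ∑ c ∈ T.ch v, N c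

lemma slk_add {M : Type*} [AddCommGroup M] (N N' : V → M) (v : V) :
    T.slk (N + N') v = T.slk N v + T.slk N' v := by
  simp only [slk, Pi.add_apply, sum_add_distrib]; abel

lemma slk_neg {M : Type*} [AddCommGroup M] (N : V → M) (v : V) :
    T.slk (-N) v = -T.slk N v := by
  simp only [slk, Pi.neg_apply, sum_neg_distrib]; abel

lemma slk_sub {M : Type*} [AddCommGroup M] (N N' : V → M) (v : V) :
    T.slk (N - N') v = T.slk N v - T.slk N' v := by
  rw [sub_eq_add_neg, slk_add, slk_neg, sub_eq_add_neg]

lemma eq_slk_add {M : Type*} [AddCommGroup M] (N : V → M) (v : V) :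
    N v = T.slk N v + ∑ c ∈ T.ch v, N c := by simp [slk]

/-- A single server at `h`. -/
def anc (h : V) : V → ℤ := fun v => if T.Below v h then 1 else 0

lemma sum_ch_anc (h v : V) :
    ∑ c ∈ T.ch v, T.anc h c = if T.Below v h ∧ v ≠ h then 1 else 0 := by
  split_ifs with hv
  · obtain ⟨c, hc, hb⟩ := T.exists_ch_below hv.1 hv.2.symm
    rw [sum_eq_single_of_mem c hc fun c' hc' hne => ?_]
    · simp [anc, hb]
    · simp only [anc, ite_eq_right_iff]
      exact fun hb' => absurd (T.eq_of_below_ch hc' hc hb' hb) hne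
  · refine sum_eq_zero fun c hc => ?_
    simp only [anc, ite_eq_right_iff]
    intro hb
    refine absurd ⟨(T.below_ch hc).trans T hb, ?_⟩ hv
    rintro rfl
    exact absurd hb (T.not_below_of_ch hc)

lemma slk_anc (h v : V) : T.slk (T.anc h) v = if v = h then 1 else 0 := by
  rw [slk, sum_ch_anc]
  by_cases hv : v = h
  · subst hv; simp [anc, T.below_refl]
  · by_cases hb : T.Below v h <;> simp [anc, hv, hb]

lemma slk_single (u v : V) (ε : ℝ) : T.slk (Pi.single u ε) v
    = (if v = u then ε else 0) - (if u ∈ T.ch v then ε else 0) := by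
  simp only [slk, Pi.single_apply, sum_ite_eq']

variable {T}

lemma exists_slot {T : LevelTree V X} {N N' : V → ℤ} (g : V) : N' g < N g → ∃ h, T.Below g h ∧ T.slk N' h < T.slk N h ∧
    ∀ v, T.Below g v → T.Below v h → N' v < N v := by
  induction g using T.up_induction with
  | h p ih =>
    intro hlt
    by_cases hs : T.slk N' p < T.slk N p
    · refine ⟨p, T.below_refl p, hs, fun v h1 h2 => ?_⟩
      rw [h2.eq_of_lev T (T.below_refl p) (le_antisymm h2.1 h1.1)]
      exact hlt
    · obtain ⟨c, hc, hlt'⟩ : ∃ c ∈ T.ch p, N' c < N c := by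
        by_contra! hcon
        have := sum_le_sum hcon
        rw [T.eq_slk_add N, T.eq_slk_add N'] at hlt
        omega
      obtain ⟨h, hb, h1, h2⟩ := ih c hc hlt'
      refine ⟨h, (T.below_ch hc).trans T hb, h1, fun v hv1 hv2 => ?_⟩
      rcases hv1.1.lt_or_eq with hl | hl
      · exact h2 v (T.below_of_lev_le hb hv2 (by rw [T.lev_ch hc]; exact hl)) hv2
      · rw [← ((T.below_ch hc).trans T hb).eq_of_lev T hv2 hl]
        exact hlt

/-- The configurations in `S` round `Z`, and each server count is above or below the value that it
rounds equally much. -/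
structure Rounds (T : LevelTree V X) (S : Set (V → ℤ)) (Z : V → ℝ) : Prop where
  near : ∀ N ∈ S, ∀ v, Near (Z v) (N v)
  near_slk : ∀ N ∈ S, ∀ v, Near (T.slk Z v) (T.slk N v)
  ge : ∀ v, ∃ N ∈ S, Z v ≤ N v
  le : ∀ v, ∃ N ∈ S, (N v : ℝ) ≤ Z v
  lt_slk : ∀ N ∈ S, ∀ v, T.slk Z v < T.slk N v → ∃ N' ∈ S, ((T.slk N' v : ℤ) : ℝ) < T.slk Z v
  gt_slk : ∀ N ∈ S, ∀ v, ((T.slk N v : ℤ) : ℝ) < T.slk Z v → ∃ N' ∈ S, T.slk Z v < T.slk N' v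

variable {S : Set (V → ℤ)} {Z : V → ℝ}

lemma Rounds.neg (h : T.Rounds S Z) : T.Rounds (-S) (-Z) where
  near N hN v := by simpa using (h.near _ hN v).neg
  near_slk N hN v := by
    have := (h.near_slk _ hN v).neg
    rwa [slk_neg, neg_neg, ← slk_neg] at this
  ge v := by
    obtain ⟨N, hN, h1⟩ := h.le v
    exact ⟨-N, by simpa, by simpa using h1⟩
  le v := by
    obtain ⟨N, hN, h1⟩ := h.ge v
    exact ⟨-N, by simpa, by simpa using h1⟩
  lt_slk N hN v hlt := by
    obtain ⟨N', hN', h1⟩ := h.gt_slk (-N) hN v (by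
      rw [slk_neg] at hlt ⊢; push_cast; linarith)
    exact ⟨-N', by simpa, by rw [slk_neg, slk_neg]; push_cast; linarith⟩
  gt_slk N hN v hlt := by
    obtain ⟨N', hN', h1⟩ := h.lt_slk (-N) hN v (by
      rw [slk_neg] at hlt ⊢; push_cast; linarith)
    exact ⟨-N', by simpa, by rw [slk_neg, slk_neg]; push_cast; linarith⟩

lemma Rounds.exists_top (h : T.Rounds S Z) {u p : V} (hu : u ∈ T.ch p) :
    ∃ C1 ∈ S, ∃ C2 ∈ S, ∃ t, Z u ≤ C1 u ∧ ¬ T.Below u t ∧ T.Below p t ∧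
      (∀ v, T.Below v t → ¬ T.Below v p → C1 v < C2 v) ∧ ((T.slk C2 p : ℤ) : ℝ) ≤ T.slk Z p ∧
      (t = p ∧ C2 = C1 ∨ t ≠ p ∧ T.slk C1 t < T.slk C2 t) := by
  have triv : ∀ C ∈ S, Z u ≤ C u → ((T.slk C p : ℤ) : ℝ) ≤ T.slk Z p → 
    ∃ C1 ∈ S, ∃ C2 ∈ S, ∃ t, Z u ≤ C1 u ∧ ¬ T.Below u t ∧ T.Below p t ∧
      (∀ v, T.Below v t → ¬ T.Below v p → C1 v < C2 v) ∧ ((T.slk C2 p : ℤ) : ℝ) ≤ T.slk Z p ∧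
      (t = p ∧ C2 = C1 ∨ t ≠ p ∧ T.slk C1 t < T.slk C2 t) := fun C hC h1 h2 =>
    ⟨C, hC, C, hC, p, h1, T.not_below_of_ch hu, T.below_refl p, fun v h h' => absurd h h', h2,
      Or.inl ⟨rfl, rfl⟩⟩
  obtain ⟨C1, hC1, h1⟩ := h.ge u
  by_cases hs : ((T.slk C1 p : ℤ) : ℝ) ≤ T.slk Z p
  · exact triv C1 hC1 h1 hs
  push Not at hs
  obtain ⟨C2, hC2, h2⟩ := h.lt_slk C1 hC1 p hs
  by_cases hs2 : Z u ≤ C2 u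
  · exact triv C2 hC2 hs2 h2.le
  push Not at hs2
  obtain ⟨c, hc, hlt⟩ : ∃ c ∈ T.ch p, C1 c < C2 c := by
    by_contra! hcon
    have e1 : T.slk C2 p < T.slk C1 p := by exact_mod_cast h2.trans hs
    have e2 : C2 u < C1 u := by exact_mod_cast hs2.trans_le h1
    have e3 := (h.near C1 hC1 p).le_add_one (h.near C2 hC2 p)
    have e4 := sum_lt_sum hcon ⟨u, hu, e2⟩
    rw [T.eq_slk_add C1, T.eq_slk_add C2] at e3
    omega
  obtain ⟨t, ht, h3, h4⟩ := exists_slot (T := T) c hlt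
  refine ⟨C1, hC1, C2, hC2, t, h1, fun hb => ?_, (T.below_ch hc).trans T ht, fun v hv hv' => ?_,
    h2.le, Or.inr ⟨?_, h3⟩⟩
  · rw [T.eq_of_below_ch hu hc hb ht] at hs2 h1
    have : C2 c < C1 c := by exact_mod_cast hs2.trans_le h1
    omega
  · refine h4 v (T.below_of_lev_le ht hv ?_) hv
    rw [T.lev_ch hc]
    by_contra! hl
    exact hv' (T.below_of_lev_le hv ((T.below_ch hc).trans T ht) (by omega))
  · rintro rfl
    exact T.not_below_of_ch hc ht

lemma Rounds.exists_low (h : T.Rounds S Z) {C1 : V → ℤ} (hC1 : C1 ∈ S) {u : V} (h1 : Z u ≤ C1 u) :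
    ∃ C3 ∈ S, ∃ t, T.Below u t ∧ (∀ v, T.Below v t → ¬ T.Below v u → C3 v < C1 v) ∧
      T.slk Z u ≤ T.slk C3 u ∧ (t = u ∧ C3 = C1 ∨ t ≠ u ∧ T.slk C3 t < T.slk C1 t) := by
  by_cases hs : T.slk Z u ≤ T.slk C1 u
  · exact ⟨C1, hC1, u, T.below_refl u, fun v h h' => absurd h h', hs, Or.inl ⟨rfl, rfl⟩⟩
  push Not at hs
  obtain ⟨C3, hC3, h3⟩ := h.gt_slk C1 hC1 u hs
  obtain ⟨g, hg, hlt⟩ : ∃ g ∈ T.ch u, C3 g < C1 g := by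
    by_contra! hcon
    have e1 : T.slk C1 u < T.slk C3 u := by exact_mod_cast hs.trans h3
    have e2 := (h.near C3 hC3 u (C1 u)).2 h1
    have e3 := sum_le_sum hcon
    rw [T.eq_slk_add C1, T.eq_slk_add C3] at e2
    omega
  obtain ⟨t, ht, h4, h5⟩ := exists_slot (T := T) g hlt
  refine ⟨C3, hC3, t, (T.below_ch hg).trans T ht, fun v hv hv' => ?_, h3.le, Or.inr ⟨?_, h4⟩⟩
  · refine h5 v (T.below_of_lev_le ht hv ?_) hv
    rw [T.lev_ch hg]
    by_contra! hl
    exact hv' (T.below_of_lev_le hv ((T.below_ch hg).trans T ht) (by omega))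
  · rintro rfl
    exact T.not_below_of_ch hg ht

/-- The configuration `N` rounds `Z`. -/
def IsRounding (T : LevelTree V X) (Z : V → ℝ) (N : V → ℤ) : Prop :=
  ∀ v, Near (Z v) (N v) ∧ Near (T.slk Z v) (T.slk N v)

lemma IsRounding.neg {T : LevelTree V X} {N : V → ℤ} (h : T.IsRounding Z N) : T.IsRounding (-Z) (-N) := fun v =>
  ⟨(h v).1.neg, by rw [slk_neg, slk_neg]; exact (h v).2.neg⟩

lemma Rounds.isRounding (h : T.Rounds S Z) {N : V → ℤ} (hN : N ∈ S) : T.IsRounding Z N :=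
  fun v => ⟨h.near N hN v, h.near_slk N hN v⟩

/-- Effect of a change of the target at `u` on the target counts. -/
lemma isRounding_sub_single {u p : V} {ε : ℝ} (hu : u ∈ T.ch p) {N : V → ℤ}
    (h1 : ∀ v, v ≠ u → Near (Z v) (N v)) (h2 : Near (Z u - ε) (N u))
    (h3 : ∀ v, v ≠ u → v ≠ p → Near (T.slk Z v) (T.slk N v))
    (h4 : Near (T.slk Z u - ε) (T.slk N u)) (h5 : Near (T.slk Z p + ε) (T.slk N p)) :
    T.IsRounding (Z - Pi.single u ε) N := by
  have hup : u ≠ p := by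
    rintro rfl; exact T.not_below_of_ch hu (T.below_refl _)
  intro v
  rw [slk_sub, slk_single]
  constructor
  · by_cases hv : v = u
    · subst hv; simpa using h2
    · simpa [Pi.single_apply, hv] using h1 v hv
  · by_cases hv : v = u
    · subst hv
      rw [if_pos rfl, if_neg fun hc => T.not_below_of_ch hc (T.below_refl _), sub_zero]
      exact h4
    · by_cases hv' : v = p
      · subst hv'
        rw [if_neg hv, if_pos hu, zero_sub, sub_neg_eq_add]
        exact h5
      · rw [if_neg hv, if_neg, sub_zero, sub_zero]
        · exact h3 v hv hv'
        · intro hc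
          exact hv' (by rw [← (T.mem_ch.1 hc).2, (T.mem_ch.1 hu).2])

lemma IsRounding.sub_single {u p : V} {ε : ℝ} (hu : u ∈ T.ch p) (hε : 0 < ε)
    (g1 : Gap (Z u) ε) (g2 : Gap (T.slk Z u) ε) (g3 : Gap (T.slk Z p) ε) {N : V → ℤ}
    (h : T.IsRounding Z N) : T.IsRounding (Z - Pi.single u ε) N :=
  isRounding_sub_single hu (fun v _ => (h v).1) ((h u).1.sub g1 hε) (fun v _ _ => (h v).2)
    ((h u).2.sub g2 hε) ((h p).2.add g3 hε)

/-- Moving target mass from `u` to its parent can be followed by moving three servers. -/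
theorem Rounds.exists_moves (h : T.Rounds S Z) {u p : V} {ε : ℝ} (hu : u ∈ T.ch p) (hε : 0 < ε)
    (g1 : Gap (Z u) ε) (g2 : Gap (T.slk Z u) ε) (g3 : Gap (T.slk Z p) ε) :
    ∃ C1 ∈ S, ∃ C2 ∈ S, ∃ C3 ∈ S, ∃ a b, T.Below p a ∧ T.Below p b ∧
      T.IsRounding (Z - Pi.single u ε) (C1 - T.anc a + T.anc b) ∧
      T.IsRounding (Z - Pi.single u ε) (C2 - T.anc b + T.anc p) ∧
      T.IsRounding (Z - Pi.single u ε) (C3 - T.anc u + T.anc a) := by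
  have hup : u ≠ p := by
    rintro rfl; exact T.not_below_of_ch hu (T.below_refl _)
  have hbu := T.below_ch hu
  have hnu := T.not_below_of_ch hu
  obtain ⟨C1, hC1, C2, hC2, b, t1, t2, t3, t4, t5, t6⟩ := h.exists_top hu
  obtain ⟨C3, hC3, a, s1, s2, s3, s4⟩ := h.exists_low hC1 t1
  have r1 := h.isRounding hC1
  have r2 := h.isRounding hC2
  have r3 := h.isRounding hC3
  have hab : ∀ v, T.Below v a → T.Below v b → T.Below v p := fun v h1 h2 => by
    by_contra hv
    have hl : T.lev p < T.lev v := by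
      by_contra! hl
      exact hv (T.below_of_lev_le h1 (hbu.trans T s1) hl)
    have := T.lev_ch hu
    exact t2 ((T.below_of_lev_le s1 h1 (by omega)).trans T h2)
  refine ⟨C1, hC1, C2, hC2, C3, hC3, a, b, hbu.trans T s1, t3, ?_, ?_, ?_⟩
  · refine isRounding_sub_single hu (fun v hv => ?_) ?_ (fun v hv hv' => ?_) ?_ ?_
    · simp only [Pi.add_apply, Pi.sub_apply, anc]
      by_cases hva : T.Below v a <;> by_cases hvb : T.Below v b
      · simpa [hva, hvb] using (r1 v).1
      · have : ¬ T.Below v u := by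
          intro hvu
          refine hvb ?_
          rcases hvu.1.lt_or_eq with hl | hl
          · have := T.lev_ch hu
            exact (T.below_of_lev_le hvu hbu (by omega)).trans T t3
          · exact absurd (hvu.eq_of_lev T (T.below_refl u) hl) hv
        simpa [hva, hvb] using (r1 v).1.pred (r3 v).1 (s2 v hva this)
      · have : ¬ T.Below v p := fun hvp => hva (hvp.trans T (hbu.trans T s1))
        simpa [hva, hvb] using (r1 v).1.succ (r2 v).1 (t4 v hvb this)
      · simpa [hva, hvb] using (r1 v).1
    · simp only [Pi.add_apply, Pi.sub_apply, anc, s1, t2, if_true, if_false, add_zero]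
      exact (r1 u).1.sub_pred g1 hε t1
    · rw [slk_add, slk_sub, slk_anc, slk_anc]
      by_cases hva : v = a
      · have hvb : v ≠ b := by
          rintro rfl; subst hva; exact t2 s1
        rcases s4 with ⟨s4, -⟩ | ⟨-, s4⟩
        · exact absurd (hva.trans s4) hv
        · subst hva
          simpa [hvb] using (r1 v).2.pred (r3 v).2 s4
      · by_cases hvb : v = b
        · rcases t6 with ⟨t6, -⟩ | ⟨-, t6⟩
          · exact absurd (hvb.trans t6) hv'
          · subst hvb
            simpa [hva] using (r1 v).2.succ (r2 v).2 t6
        · simpa [hva, hvb] using (r1 v).2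
    · have hub : u ≠ b := by rintro rfl; exact t2 (T.below_refl _)
      rw [slk_add, slk_sub, slk_anc, slk_anc, if_neg hub, add_zero]
      rcases s4 with ⟨s4, s5⟩ | ⟨s4, -⟩
      · rw [if_pos s4.symm]
        subst s5
        exact (r3 u).2.sub_pred g2 hε s3
      · rw [if_neg s4.symm, sub_zero]
        exact (r1 u).2.sub g2 hε
    · have hpa : p ≠ a := by rintro rfl; exact hnu s1
      rw [slk_add, slk_sub, slk_anc, slk_anc, if_neg hpa, sub_zero]
      rcases t6 with ⟨t6, t7⟩ | ⟨t6, -⟩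
      · rw [if_pos t6.symm]
        subst t7
        exact (r2 p).2.add_succ g3 hε t5
      · rw [if_neg t6.symm, add_zero]
        exact (r1 p).2.add g3 hε
  · have hub : u ≠ b := by rintro rfl; exact t2 (T.below_refl _)
    refine isRounding_sub_single hu (fun v hv => ?_) ?_ (fun v hv hv' => ?_) ?_ ?_
    · simp only [Pi.add_apply, Pi.sub_apply, anc]
      by_cases hvp : T.Below v p
      · simpa [hvp, hvp.trans T t3] using (r2 v).1
      · by_cases hvb : T.Below v b
        · simpa [hvp, hvb] using (r2 v).1.pred (r1 v).1 (t4 v hvb hvp)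
        · simpa [hvp, hvb] using (r2 v).1
    · simp only [Pi.add_apply, Pi.sub_apply, anc, t2, hnu, if_false, add_zero, sub_zero]
      exact (r2 u).1.sub g1 hε
    · rw [slk_add, slk_sub, slk_anc, slk_anc, if_neg hv', add_zero]
      by_cases hvb : v = b
      · rcases t6 with ⟨t6, -⟩ | ⟨-, t6⟩
        · exact absurd (hvb.trans t6) hv'
        · subst hvb
          simpa using (r2 v).2.pred (r1 v).2 t6
      · simpa [hvb] using (r2 v).2
    · rw [slk_add, slk_sub, slk_anc, slk_anc, if_neg hub, if_neg hup, sub_zero, add_zero]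
      exact (r2 u).2.sub g2 hε
    · rw [slk_add, slk_sub, slk_anc, slk_anc, if_pos rfl]
      rcases t6 with ⟨t6, -⟩ | ⟨t6, -⟩
      · rw [if_pos t6.symm, sub_add_cancel]
        exact (r2 p).2.add g3 hε
      · rw [if_neg t6.symm, sub_zero]
        exact (r2 p).2.add_succ g3 hε t5
  · have hpa : p ≠ a := by rintro rfl; exact hnu s1
    refine isRounding_sub_single hu (fun v hv => ?_) ?_ (fun v hv hv' => ?_) ?_ ?_
    · simp only [Pi.add_apply, Pi.sub_apply, anc]
      by_cases hvu : T.Below v u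
      · simpa [hvu, hvu.trans T s1] using (r3 v).1
      · by_cases hva : T.Below v a
        · simpa [hvu, hva] using (r3 v).1.succ (r1 v).1 (s2 v hva hvu)
        · simpa [hvu, hva] using (r3 v).1
    · simp only [Pi.add_apply, Pi.sub_apply, anc, s1, T.below_refl, if_true, sub_add_cancel]
      exact (r3 u).1.sub g1 hε
    · rw [slk_add, slk_sub, slk_anc, slk_anc, if_neg hv, sub_zero]
      by_cases hva : v = a
      · rcases s4 with ⟨s4, -⟩ | ⟨-, s4⟩
        · exact absurd (hva.trans s4) hv
        · subst hva
          simpa using (r3 v).2.succ (r1 v).2 s4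
      · simpa [hva] using (r3 v).2
    · rw [slk_add, slk_sub, slk_anc, slk_anc, if_pos rfl]
      rcases s4 with ⟨s4, -⟩ | ⟨s4, -⟩
      · rw [if_pos s4.symm, sub_add_cancel]
        exact (r3 u).2.sub g2 hε
      · rw [if_neg s4.symm, add_zero]
        exact (r3 u).2.sub_pred g2 hε s3
    · rw [slk_add, slk_sub, slk_anc, slk_anc, if_neg hpa, if_neg hup.symm, sub_zero, add_zero]
      exact (r3 p).2.add g3 hε

end Fin

end LevelTree

section Stochastic

variable {Ω : Type*} [Fintype Ω]

/-- A law on a finite type. -/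
structure IsLaw (π : Ω → ℝ) : Prop where
  nonneg : ∀ a, 0 ≤ π a
  sum : ∑ a, π a = 1

/-- The law after one step of a kernel. -/
def push (π : Ω → ℝ) (κ : Ω → Ω → ℝ) (b : Ω) : ℝ := ∑ a, π a * κ a b

/-- The composition of two kernels. -/
def kcomp (κ κ' : Ω → Ω → ℝ) (a c : Ω) : ℝ := ∑ b, κ a b * κ' b c

/-- The expected cost of one step of a kernel. -/
def kcost (W : Ω → Ω → ℝ) (π : Ω → ℝ) (κ : Ω → Ω → ℝ) : ℝ := ∑ a, ∑ b, π a * κ a b * W a b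

lemma push_kcomp (π : Ω → ℝ) (κ κ' : Ω → Ω → ℝ) : push π (kcomp κ κ') = push (push π κ) κ' := by
  funext c
  simp only [push, kcomp, mul_sum, sum_mul]
  rw [sum_comm]
  exact sum_congr rfl fun _ _ => sum_congr rfl fun _ _ => by ring

lemma IsLaw.kcomp {κ κ' : Ω → Ω → ℝ} (h : ∀ a, IsLaw (κ a)) (h' : ∀ a, IsLaw (κ' a)) (a : Ω) :
    IsLaw (kcomp κ κ' a) where
  nonneg c := sum_nonneg fun b _ => mul_nonneg ((h a).nonneg b) ((h' b).nonneg c)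
  sum := by
    simp only [_root_.kcomp]
    rw [sum_comm]
    simp only [← mul_sum, (h' _).sum, mul_one, (h a).sum]

lemma IsLaw.push {π : Ω → ℝ} {κ : Ω → Ω → ℝ} (h : IsLaw π) (h' : ∀ a, IsLaw (κ a)) :
    IsLaw (push π κ) where
  nonneg c := sum_nonneg fun b _ => mul_nonneg (h.nonneg b) ((h' b).nonneg c)
  sum := by
    simp only [_root_.push]
    rw [sum_comm]
    simp only [← mul_sum, (h' _).sum, mul_one, h.sum]

lemma kcost_kcomp_le {W : Ω → Ω → ℝ} (hW : ∀ a b c, W a c ≤ W a b + W b c) {π : Ω → ℝ}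
    {κ κ' : Ω → Ω → ℝ} (hπ : IsLaw π) (h : ∀ a, IsLaw (κ a)) (h' : ∀ a, IsLaw (κ' a)) :
    kcost W π (kcomp κ κ') ≤ kcost W π κ + kcost W (push π κ) κ' := by
  have e1 : kcost W π (kcomp κ κ') = ∑ a, ∑ b, ∑ c, π a * κ a b * κ' b c * W a c := by
    refine sum_congr rfl fun a _ => ?_
    rw [sum_comm]
    refine sum_congr rfl fun c _ => ?_
    rw [kcomp, mul_sum, sum_mul]
    exact sum_congr rfl fun b _ => by ring
  have e2 : kcost W π κ = ∑ a, ∑ b, ∑ c, π a * κ a b * κ' b c * W a b := by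
    refine sum_congr rfl fun a _ => sum_congr rfl fun b _ => ?_
    rw [← sum_mul, ← mul_sum, (h' b).sum, mul_one]
  have e3 : kcost W (push π κ) κ' = ∑ a, ∑ b, ∑ c, π a * κ a b * κ' b c * W b c := by
    unfold kcost push
    simp only [sum_mul]
    rw [sum_comm' (t' := univ) (s' := fun _ => univ) (by simp)]
    conv_rhs => rw [sum_comm' (t' := univ) (s' := fun _ => univ) (by simp)]
    conv_lhs => rw [sum_comm' (t' := univ) (s' := fun _ => univ) (by simp)]
    refine sum_congr rfl fun b _ => ?_
    rw [sum_comm]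
  rw [e1, e2, e3, ← sum_add_distrib]
  refine sum_le_sum fun a _ => ?_
  rw [← sum_add_distrib]
  refine sum_le_sum fun b _ => ?_
  rw [← sum_add_distrib]
  refine sum_le_sum fun c _ => ?_
  rw [← mul_add]
  exact mul_le_mul_of_nonneg_left (hW a b c)
    (mul_nonneg (mul_nonneg (hπ.nonneg a) ((h a).nonneg b)) ((h' b).nonneg c))

section Nudge

variable [DecidableEq Ω] {ι : Type*} [Fintype ι]

/-- Move mass `ε` from each `C i` to `D i`. -/
noncomputable def nudge (π : Ω → ℝ) (ε : ℝ) (C D : ι → Ω) (a b : Ω) : ℝ :=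
  (if b = a then 1 else 0) +
    ∑ i, (if a = C i then ε / π a else 0) * ((if b = D i then 1 else 0) - (if b = a then 1 else 0))

lemma sum_nudge_mul (π : Ω → ℝ) (ε : ℝ) (C D : ι → Ω) (a : Ω) (g : Ω → ℝ) :
    ∑ b, nudge π ε C D a b * g b
      = g a + ∑ i, (if a = C i then ε / π a else 0) * (g (D i) - g a) := by
  simp only [nudge, add_mul, sum_add_distrib, sum_mul, ite_mul, one_mul, zero_mul, sum_ite_eq',
    mem_univ, if_true]
  congr 1
  rw [sum_comm]
  refine sum_congr rfl fun i _ => ?_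
  split_ifs
  · simp only [mul_assoc, sub_mul, ite_mul, one_mul, zero_mul, ← mul_sum, sum_sub_distrib,
      sum_ite_eq', mem_univ, if_true]
  · simp

lemma isLaw_nudge {π : Ω → ℝ} {ε : ℝ} {C D : ι → Ω} (hε : 0 ≤ ε)
    (hC : ∀ i, 0 < π (C i)) (hs : ∀ i, Fintype.card ι * ε ≤ π (C i)) (a : Ω) :
    IsLaw (nudge π ε C D a) where
  nonneg b := by
    have hnn : ∀ i, 0 ≤ (if a = C i then ε / π a else 0) := by
      intro i
      split_ifs with h
      · subst h; exact div_nonneg hε (hC i).le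
      · exact le_rfl
    unfold nudge
    by_cases hb : b = a
    · subst hb
      have h1 : ∀ i ∈ univ, -(1 / Fintype.card ι : ℝ) ≤ (if b = C i then ε / π b else 0) *
          ((if b = D i then 1 else 0) - (if b = b then 1 else 0)) := by
        intro i _
        have hι : (0 : ℝ) < Fintype.card ι := by exact_mod_cast Fintype.card_pos_iff.2 ⟨i⟩
        have h2 : (if b = C i then ε / π b else 0) ≤ 1 / Fintype.card ι := by
          split_ifs with h
          · subst h
            rw [div_le_div_iff₀ (hC i) hι]
            linarith [hs i]
          · positivity
        have h3 := hnn i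
        rw [if_pos rfl]
        split_ifs <;> simp_all
      have h2 := sum_le_sum h1
      rw [sum_const, nsmul_eq_mul, card_univ] at h2
      rw [if_pos rfl]
      have h3 : -(1 : ℝ) ≤ (Fintype.card ι : ℝ) * -(1 / Fintype.card ι) := by
        rcases eq_or_ne (Fintype.card ι : ℝ) 0 with h | h
        · rw [h]; simp
        · rw [mul_neg, mul_one_div_cancel h]
      rw [if_pos rfl] at h2
      linarith
    · simp only [hb, if_false, sub_zero, zero_add]
      refine sum_nonneg fun i _ => mul_nonneg (hnn i) ?_
      split_ifs <;> norm_num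
  sum := by
    have := sum_nudge_mul π ε C D a fun _ => 1
    simpa using this

lemma sum_push_nudge {π : Ω → ℝ} {ε : ℝ} {C D : ι → Ω} (hC : ∀ i, 0 < π (C i))
    (F : Ω → Ω → ℝ) :
    ∑ a, ∑ b, π a * nudge π ε C D a b * F a b
      = ∑ a, π a * F a a + ε * ∑ i, (F (C i) (D i) - F (C i) (C i)) := by
  have h1 : ∀ a, ∑ b, π a * nudge π ε C D a b * F a b
      = π a * F a a + ∑ i, if a = C i then ε * (F a (D i) - F a a) else 0 := by
    intro a
    simp only [mul_assoc]
    rw [← mul_sum, sum_nudge_mul, mul_add, mul_sum]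
    congr 1
    refine sum_congr rfl fun i _ => ?_
    split_ifs with h
    · subst h
      have := (hC i).ne'
      field_simp
    · simp
  rw [sum_congr rfl fun a _ => h1 a, sum_add_distrib, sum_comm (s := univ) (t := univ), mul_sum]
  congr 1
  refine sum_congr rfl fun i _ => ?_
  simp

lemma nudge_ne_zero {π : Ω → ℝ} {ε : ℝ} {C D : ι → Ω} {a b : Ω} (h : nudge π ε C D a b ≠ 0) :
    b = a ∨ ∃ i, a = C i ∧ b = D i := by
  by_contra! hcon
  refine h ?_
  unfold nudge
  rw [if_neg hcon.1, zero_add]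
  refine sum_eq_zero fun i _ => ?_
  by_cases ha : a = C i
  · simp [hcon.2 i ha]
  · simp [ha]

end Nudge

/-- The integer random variable `f` is the number `m` rounded up or down in an unbiased way. -/
def Bal (π : Ω → ℝ) (f : Ω → ℤ) (m : ℝ) : Prop :=
  ∑ a, π a * f a = m ∧ ∀ j : ℤ, ∑ a, π a * |(f a : ℝ) - j| = |m - j|

lemma bal_iff {π : Ω → ℝ} (h : IsLaw π) {f : Ω → ℤ} {m : ℝ} :
    Bal π f m ↔ ∑ a, π a * f a = m ∧ ∀ a, 0 < π a → Near m (f a) := by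
  have hsub : ∀ j : ℤ, ∑ a, π a * ((f a : ℝ) - j) = ∑ a, π a * f a - j := fun j => by
    simp only [mul_sub, sum_sub_distrib, ← sum_mul, h.sum, one_mul]
  unfold Bal
  refine and_congr_right fun hm => ⟨fun hj a ha j => ⟨fun hjm => ?_, fun hjm => ?_⟩, fun hn j => ?_⟩
  · have h1 : ∑ a, π a * (|(f a : ℝ) - j| - ((f a : ℝ) - j)) = 0 := by
      simp only [mul_sub (π _) |_|, sum_sub_distrib]
      rw [hj, hsub, hm, abs_of_nonneg (by linarith)]; ring
    rw [sum_eq_zero_iff_of_nonneg fun a _ => mul_nonneg (h.nonneg a)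
      (sub_nonneg.2 (le_abs_self _))] at h1
    have h2 := (mul_eq_zero.1 (h1 a (mem_univ a))).resolve_left ha.ne'
    have h3 : (0 : ℝ) ≤ f a - j := by
      have := abs_nonneg ((f a : ℝ) - j); linarith
    exact_mod_cast (sub_nonneg.1 h3)
  · have h1 : ∑ a, π a * (|(f a : ℝ) - j| + ((f a : ℝ) - j)) = 0 := by
      simp only [mul_add, sum_add_distrib]
      rw [hj, hsub, hm, abs_of_nonpos (by linarith)]; ring
    rw [sum_eq_zero_iff_of_nonneg fun a _ => mul_nonneg (h.nonneg a)
      (by linarith [neg_abs_le ((f a : ℝ) - j)])] at h1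
    have h2 := (mul_eq_zero.1 (h1 a (mem_univ a))).resolve_left ha.ne'
    have h3 : (f a : ℝ) - j ≤ 0 := by
      have := abs_nonneg ((f a : ℝ) - j); linarith
    exact_mod_cast (sub_nonpos.1 h3)
  · have key : ∀ a, π a = 0 ∨ Near m (f a) := fun a => by
      rcases (h.nonneg a).lt_or_eq with h1 | h1
      · exact Or.inr (hn a h1)
      · exact Or.inl h1.symm
    rcases le_total (j : ℝ) m with h1 | h1
    · rw [abs_of_nonneg (by linarith), ← hm, ← hsub]
      refine sum_congr rfl fun a _ => ?_
      rcases key a with h2 | h2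
      · simp [h2]
      · have : (j : ℝ) ≤ f a := by exact_mod_cast (h2 j).1 h1
        rw [abs_of_nonneg (by linarith)]
    · rw [abs_of_nonpos (by linarith), ← hm, ← hsub, ← sum_neg_distrib]
      refine sum_congr rfl fun a _ => ?_
      rcases key a with h2 | h2
      · simp [h2]
      · have : (f a : ℝ) ≤ j := by exact_mod_cast (h2 j).2 h1
        rw [abs_of_nonpos (by linarith), mul_neg]

lemma IsLaw.exists_ge {π : Ω → ℝ} (h : IsLaw π) (f : Ω → ℝ) :
    ∃ a, 0 < π a ∧ ∑ b, π b * f b ≤ f a := by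
  by_contra! hcon
  set m := ∑ b, π b * f b with hm
  have h1 : ∑ b, π b * (m - f b) = 0 := by
    simp only [mul_sub, sum_sub_distrib, ← sum_mul, h.sum, one_mul]
    rw [← hm, sub_self]
  have h2 : ∀ b ∈ univ, 0 ≤ π b * (m - f b) := fun b _ => by
    rcases (h.nonneg b).lt_or_eq with h3 | h3
    · exact mul_nonneg h3.le (by linarith [hcon b h3])
    · simp [← h3]
  rw [sum_eq_zero_iff_of_nonneg h2] at h1
  have h4 : ∑ b, π b = 0 := sum_eq_zero fun b hb => by
    by_contra hne
    have h5 := (h.nonneg b).lt_of_ne' hne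
    have := (mul_eq_zero.1 (h1 b hb)).resolve_left hne
    linarith [hcon b h5]
  rw [h.sum] at h4
  exact one_ne_zero h4

lemma IsLaw.exists_le {π : Ω → ℝ} (h : IsLaw π) (f : Ω → ℝ) :
    ∃ a, 0 < π a ∧ f a ≤ ∑ b, π b * f b := by
  obtain ⟨a, ha, h1⟩ := h.exists_ge fun b => -f b
  refine ⟨a, ha, ?_⟩
  simp only [mul_neg, sum_neg_distrib] at h1
  linarith

lemma IsLaw.exists_gt {π : Ω → ℝ} (h : IsLaw π) (f : Ω → ℝ) {a : Ω} (ha : 0 < π a)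
    (hlt : f a < ∑ b, π b * f b) : ∃ a, 0 < π a ∧ ∑ b, π b * f b < f a := by
  by_contra! hcon
  set m := ∑ b, π b * f b with hm
  have h1 : ∑ b, π b * (m - f b) = 0 := by
    simp only [mul_sub, sum_sub_distrib, ← sum_mul, h.sum, one_mul]
    rw [← hm, sub_self]
  have h2 : ∀ b ∈ univ, 0 ≤ π b * (m - f b) := fun b _ => by
    rcases (h.nonneg b).lt_or_eq with h3 | h3
    · exact mul_nonneg h3.le (by linarith [hcon b h3])
    · simp [← h3]
  rw [sum_eq_zero_iff_of_nonneg h2] at h1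
  have := (mul_eq_zero.1 (h1 a (mem_univ a))).resolve_left ha.ne'
  linarith

lemma IsLaw.exists_lt {π : Ω → ℝ} (h : IsLaw π) (f : Ω → ℝ) {a : Ω} (ha : 0 < π a)
    (hlt : ∑ b, π b * f b < f a) : ∃ a, 0 < π a ∧ f a < ∑ b, π b * f b := by
  obtain ⟨a, ha, h1⟩ := h.exists_gt (fun b => -f b) ha (by
    simp only [mul_neg, sum_neg_distrib]; linarith)
  refine ⟨a, ha, ?_⟩
  simp only [mul_neg, sum_neg_distrib] at h1
  linarith

end Stochastic

lemma eventually_gap (m : ℝ) : ∀ᶠ ε in nhdsWithin (0 : ℝ) (Set.Ioi 0), Gap m ε := by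
  obtain ⟨ε, hε, h⟩ := exists_gap m
  have : Set.Iio ε ∈ nhdsWithin (0 : ℝ) (Set.Ioi 0) := mem_nhdsWithin_of_mem_nhds (Iio_mem_nhds hε)
  filter_upwards [this] with δ hδ
  exact h.of_le (le_of_lt hδ)

lemma eventually_mul_le {a : ℝ} (c : ℝ) (ha : 0 < a) :
    ∀ᶠ ε in nhdsWithin (0 : ℝ) (Set.Ioi 0), c * ε ≤ a := by
  have h : Filter.Tendsto (fun ε : ℝ => c * ε) (nhdsWithin (0 : ℝ) (Set.Ioi 0)) (nhds (c * 0)) :=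
    ((continuous_const.mul continuous_id).tendsto 0).mono_left nhdsWithin_le_nhds
  rw [mul_zero] at h
  exact (h.eventually (gt_mem_nhds ha)).mono fun _ h => le_of_lt h

namespace LevelTree

section Fin

variable {V X : Type*} (T : LevelTree V X) [Fintype V] [DecidableEq V] [Fintype X]

/-- The server counts of a configuration. -/
def num {n : ℕ} (C : V → Fin n) : V → ℤ := fun v => ((C v : ℕ) : ℤ)

/-- The transport distance of two server configurations on the tree. -/
noncomputable def cdist (N N' : V → ℤ) : ℝ := T.wdist (fun v => (N v : ℝ)) fun v => (N' v : ℝ)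

lemma cdist_nonneg (N N' : V → ℤ) : 0 ≤ T.cdist N N' := T.wdist_nonneg _ _

lemma cdist_triangle (N N' N'' : V → ℤ) : T.cdist N N'' ≤ T.cdist N N' + T.cdist N' N'' :=
  T.wdist_triangle _ _ _

lemma cdist_comm (N N' : V → ℤ) : T.cdist N N' = T.cdist N' N := by
  unfold cdist wdist
  exact sum_congr rfl fun v _ => by rw [abs_sub_comm]

lemma cdist_self (N : V → ℤ) : T.cdist N N = 0 := by simp [cdist, wdist]

lemma anc_ch_sub {u p : V} (hu : u ∈ T.ch p) (v : V) :
    (T.anc u v : ℝ) - T.anc p v = if v = u then 1 else 0 := by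
  have hv : T.Below v u ↔ v = u ∨ T.Below v p := by
    refine ⟨fun h => ?_, fun h => ?_⟩
    · rcases h.1.lt_or_eq with hl | hl
      · have := T.lev_ch hu
        exact Or.inr (T.below_of_lev_le h (T.below_ch hu) (by omega))
      · exact Or.inl (h.eq_of_lev T (T.below_refl u) hl)
    · rcases h with rfl | h
      · exact T.below_refl _
      · exact h.trans T (T.below_ch hu)
  unfold anc
  by_cases h1 : v = u
  · subst h1; simp [T.below_refl, T.not_below_of_ch hu]
  · simp [hv, h1]

lemma cdist_anc_ch {a c : V} (hc : c ∈ T.ch a) : T.cdist (T.anc c) (T.anc a) = T.w c := by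
  unfold cdist wdist
  rw [sum_eq_single c]
  · simp [anc, T.below_refl, T.not_below_of_ch hc]
  · intro v _ hv
    have : T.Below v c ↔ T.Below v a := by
      refine ⟨fun h => ?_, fun h => h.trans T (T.below_ch hc)⟩
      rcases h.1.lt_or_eq with hl | hl
      · have := T.lev_ch hc
        exact T.below_of_lev_le h (T.below_ch hc) (by omega)
      · exact absurd (h.eq_of_lev T (T.below_refl c) hl) hv
    simp [anc, this]
  · simp

lemma cdist_anc_le (p a : V) : T.Below p a → T.cdist (T.anc a) (T.anc p) ≤ T.w p - T.w a := by
  induction a using T.down_induction with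
  | h0 =>
    intro h
    rw [h.eq_of_lev T (T.below_refl _) (le_antisymm h.1 (by rw [T.lev_root]; omega)), cdist_self]
    simp
  | h a ih c hc =>
    intro h
    rcases h.1.lt_or_eq with hl | hl
    · have hl' := T.lev_ch hc
      have h1 := ih (T.below_of_lev_le h (T.below_ch hc) (by omega))
      have h2 := T.cdist_triangle (T.anc c) (T.anc a) (T.anc p)
      rw [T.cdist_anc_ch hc] at h2
      have := T.w_ch hc
      linarith
    · rw [h.eq_of_lev T (T.below_refl _) hl, cdist_self]
      simp

lemma cdist_anc_anc_le {p a b : V} (ha : T.Below p a) (hb : T.Below p b) :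
    T.cdist (T.anc a) (T.anc b) ≤ 2 * T.w p := by
  have h1 := T.cdist_triangle (T.anc a) (T.anc p) (T.anc b)
  have h2 := T.cdist_anc_le p a ha
  have h3 := T.cdist_anc_le p b hb
  rw [T.cdist_comm (T.anc p)] at h1
  have := T.w_pos a
  have := T.w_pos b
  linarith

lemma cdist_sub_add (N M M' : V → ℤ) : T.cdist N (N - M + M') = T.cdist M M' := by
  unfold cdist wdist
  refine sum_congr rfl fun v _ => ?_
  congr 2
  simp only [Pi.add_apply, Pi.sub_apply]
  push_cast
  ring

variable {T} {n : ℕ}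

/-- An unbiased rounding of the mass distribution `Z`. -/
structure Balanced (T : LevelTree V X) (Z : V → ℝ) (π : (V → Fin n) → ℝ) : Prop where
  law : IsLaw π
  tot : ∀ v, Bal π (fun C => num C v) (Z v)
  slot : ∀ v, Bal π (fun C => T.slk (num C) v) (T.slk Z v)

variable {Z : V → ℝ} {π : (V → Fin n) → ℝ}

lemma sum_mul_slk (h : ∀ v, ∑ C, π C * (num C v : ℝ) = Z v) (v : V) :
    ∑ C, π C * ((T.slk (num C) v : ℤ) : ℝ) = T.slk Z v := by
  simp only [slk]
  push_cast
  simp only [mul_sub, sum_sub_distrib, mul_sum]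
  rw [h, sum_comm]
  simp only [h]

lemma balanced_of (h : IsLaw π) (h1 : ∀ v, ∑ C, π C * (num C v : ℝ) = Z v)
    (h2 : ∀ C, 0 < π C → T.IsRounding Z (num C)) : T.Balanced Z π where
  law := h
  tot v := (bal_iff h).2 ⟨h1 v, fun C hC => (h2 C hC v).1⟩
  slot v := (bal_iff h).2 ⟨sum_mul_slk h1 v, fun C hC => (h2 C hC v).2⟩

lemma Balanced.isRounding (h : T.Balanced Z π) {C : V → Fin n} (hC : 0 < π C) :
    T.IsRounding Z (num C) := fun v =>
  ⟨((bal_iff h.law).1 (h.tot v)).2 C hC, ((bal_iff h.law).1 (h.slot v)).2 C hC⟩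

lemma Balanced.rounds (h : T.Balanced Z π) : T.Rounds (num '' {C | 0 < π C}) Z where
  near := by rintro _ ⟨C, hC, rfl⟩ v; exact (h.isRounding hC v).1
  near_slk := by rintro _ ⟨C, hC, rfl⟩ v; exact (h.isRounding hC v).2
  ge v := by
    obtain ⟨C, hC, h1⟩ := h.law.exists_ge fun C => (num C v : ℝ)
    exact ⟨_, ⟨C, hC, rfl⟩, by rwa [← (h.tot v).1]⟩
  le v := by
    obtain ⟨C, hC, h1⟩ := h.law.exists_le fun C => (num C v : ℝ)
    exact ⟨_, ⟨C, hC, rfl⟩, by rwa [← (h.tot v).1]⟩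
  lt_slk := by
    rintro _ ⟨C, hC, rfl⟩ v hlt
    rw [← (h.slot v).1] at hlt
    obtain ⟨C', hC', h1⟩ := h.law.exists_lt (fun C => ((T.slk (num C) v : ℤ) : ℝ)) hC hlt
    exact ⟨_, ⟨C', hC', rfl⟩, by rwa [← (h.slot v).1]⟩
  gt_slk := by
    rintro _ ⟨C, hC, rfl⟩ v hlt
    rw [← (h.slot v).1] at hlt
    obtain ⟨C', hC', h1⟩ := h.law.exists_gt (fun C => ((T.slk (num C) v : ℤ) : ℝ)) hC hlt
    exact ⟨_, ⟨C', hC', rfl⟩, by rwa [← (h.slot v).1]⟩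

lemma IsRounding.exists_num {K : ℝ} (hZ : T.IsMass K Z) (hK : K + 1 ≤ n) {N : V → ℤ}
    (h : T.IsRounding Z N) : ∃ C : V → Fin n, num C = N := by
  have h0 : ∀ v, 0 ≤ N v := fun v => ((h v).1 0).1 (by simpa using hZ.nonneg v)
  have h1 : ∀ v, N v ≤ n - 1 := fun v => ((h v).1 (n - 1)).2 (by
    push_cast; linarith [hZ.le_root v])
  refine ⟨fun v => ⟨(N v).toNat, ?_⟩, ?_⟩
  · have := h0 v
    have := h1 v
    omega
  · funext v
    simp only [num]
    exact Int.toNat_of_nonneg (h0 v)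

/-- If finitely many configurations of a balanced law move, the law stays balanced. -/
lemma Balanced.exists_kernel_of_moves {K ε : ℝ} {Z' : V → ℝ} (h : T.Balanced Z π)
    (hZ : T.IsMass K Z') (hK : K + 1 ≤ n) (hε : 0 ≤ ε) (hs : ∀ C, 0 < π C → 3 * ε ≤ π C)
    (hr : ∀ C, 0 < π C → T.IsRounding Z' (num C)) {N : Fin 3 → V → ℤ} {a b : Fin 3 → V}
    (hN : ∀ i, N i ∈ num '' {C | 0 < π C}) (hD : ∀ i, T.IsRounding Z' (N i - T.anc (a i) + T.anc (b i)))
    (hsum : ∀ v, Z' v = Z v + ε * ∑ i, ((T.anc (b i) v : ℝ) - T.anc (a i) v)) :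
    ∃ κ : (V → Fin n) → (V → Fin n) → ℝ, (∀ C, IsLaw (κ C)) ∧
      (∀ C D, κ C D ≠ 0 → D T.root = C T.root) ∧ T.Balanced Z' (push π κ) ∧
      kcost (fun C D => T.cdist (num C) (num D)) π κ
        ≤ ε * ∑ i, T.cdist (T.anc (a i)) (T.anc (b i)) := by
  choose C hC hCN using hN
  choose D hDN using fun i => (hD i).exists_num hZ hK
  have hC' : ∀ i, 0 < π (C i) := hC
  have hlaw : ∀ c, IsLaw (nudge π ε C D c) := isLaw_nudge hε hC' (by simpa using fun i => hs _ (hC' i))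
  refine ⟨nudge π ε C D, hlaw, ?_, ?_, ?_⟩
  · intro c d hcd
    rcases nudge_ne_zero hcd with h1 | ⟨i, rfl, rfl⟩
    · rw [h1]
    · have h1 := congrFun (hDN i) T.root
      rw [← hCN i] at h1
      simp only [Pi.add_apply, Pi.sub_apply, anc, T.below_root, if_true, sub_add_cancel] at h1
      simp only [num] at h1
      exact Fin.ext (by exact_mod_cast h1)
  · refine balanced_of (h.law.push hlaw) (fun v => ?_) (fun d hd => ?_)
    · have h1 := sum_push_nudge (ε := ε) (D := D) hC' fun _ d => (num d v : ℝ)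
      have h2 : ∑ d, push π (nudge π ε C D) d * (num d v : ℝ)
          = ∑ c, ∑ d, π c * nudge π ε C D c d * (num d v : ℝ) := by
        rw [sum_comm]
        exact sum_congr rfl fun d _ => by rw [push, sum_mul]
      rw [h2, h1, (h.tot v).1, hsum]
      congr 2
      refine sum_congr rfl fun i _ => ?_
      rw [hDN, ← hCN]
      simp only [Pi.add_apply, Pi.sub_apply]
      push_cast; ring
    · unfold push at hd
      obtain ⟨c, -, hc⟩ := exists_ne_zero_of_sum_ne_zero hd.ne'
      have hc1 : 0 < π c := (h.law.nonneg c).lt_of_ne' fun h0 => hc (by rw [h0, zero_mul])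
      rcases nudge_ne_zero (right_ne_zero_of_mul hc) with h1 | ⟨i, -, rfl⟩
      · rw [h1]; exact hr c hc1
      · rw [hDN]; exact hD i
  · unfold kcost
    rw [sum_push_nudge hC']
    simp only [cdist_self, mul_zero, sum_const_zero, zero_add, sub_zero]
    refine le_of_eq ?_
    congr 1
    refine sum_congr rfl fun i _ => ?_
    rw [hDN, ← hCN, cdist_sub_add]

/-- Mass `ε` moves from `u` to its parent. -/
lemma Balanced.exists_kernel_down {K : ℝ} (h : T.Balanced Z π) (hK : K + 1 ≤ n) {u p : V}
    (hu : u ∈ T.ch p) : ∀ᶠ ε in nhdsWithin (0 : ℝ) (Set.Ioi 0),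
    T.IsMass K (Z - Pi.single u ε) →
    ∃ κ : (V → Fin n) → (V → Fin n) → ℝ, (∀ C, IsLaw (κ C)) ∧
      (∀ C D, κ C D ≠ 0 → D T.root = C T.root) ∧
      T.Balanced (Z - Pi.single u ε) (push π κ) ∧
      kcost (fun C D => T.cdist (num C) (num D)) π κ ≤ 12 * (T.w u * ε) := by
  have h1 : ∀ᶠ ε in nhdsWithin (0 : ℝ) (Set.Ioi 0), ∀ C, 0 < π C → 3 * ε ≤ π C :=
    Filter.eventually_all.2 fun C => by
      by_cases hC : 0 < π C
      · exact (eventually_mul_le 3 hC).mono fun _ h _ => h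
      · exact Filter.Eventually.of_forall fun _ h => absurd h hC
  filter_upwards [h1, eventually_gap (Z u), eventually_gap (T.slk Z u), eventually_gap (T.slk Z p),
    self_mem_nhdsWithin] with ε hs g1 g2 g3 hε hZ'
  have hε : 0 < ε := hε
  obtain ⟨C1, hC1, C2, hC2, C3, hC3, a, b, ha, hb, r1, r2, r3⟩ :=
    h.rounds.exists_moves hu hε g1 g2 g3
  obtain ⟨κ, k1, k2, k3, k4⟩ := h.exists_kernel_of_moves (N := ![C1, C2, C3]) (a := ![a, b, u])
    (b := ![b, p, a]) hZ' hK hε.le hs (fun C hC => (h.isRounding hC).sub_single hu hε g1 g2 g3)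
    (fun i => by fin_cases i <;> assumption) (fun i => by fin_cases i <;> assumption)
    (fun v => by
      have e1 := T.anc_ch_sub hu v
      simp only [Fin.sum_univ_three, Matrix.cons_val_zero, Matrix.cons_val_one, Matrix.cons_val,
        Pi.sub_apply, Pi.single_apply]
      have : (if v = u then ε else 0) = ε * (if v = u then 1 else 0) := by simp
      rw [this, ← e1]
      ring)
  refine ⟨κ, k1, k2, k3, k4.trans ?_⟩
  simp only [Fin.sum_univ_three, Matrix.cons_val_zero, Matrix.cons_val_one, Matrix.cons_val]
  have d1 := T.cdist_anc_anc_le ha hb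
  have d2 := T.cdist_anc_anc_le hb (T.below_refl p)
  have d3 := T.cdist_anc_anc_le (T.below_ch hu) ha
  have := T.w_ch hu
  have : T.cdist (T.anc a) (T.anc b) + T.cdist (T.anc b) (T.anc p) + T.cdist (T.anc u) (T.anc a)
      ≤ 12 * T.w u := by linarith
  nlinarith

/-- Mass `ε` moves from the parent of `u` to `u`. -/
lemma Balanced.exists_kernel_up {K : ℝ} (h : T.Balanced Z π) (hK : K + 1 ≤ n) {u p : V}
    (hu : u ∈ T.ch p) : ∀ᶠ ε in nhdsWithin (0 : ℝ) (Set.Ioi 0),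
    T.IsMass K (Z + Pi.single u ε) →
    ∃ κ : (V → Fin n) → (V → Fin n) → ℝ, (∀ C, IsLaw (κ C)) ∧
      (∀ C D, κ C D ≠ 0 → D T.root = C T.root) ∧
      T.Balanced (Z + Pi.single u ε) (push π κ) ∧
      kcost (fun C D => T.cdist (num C) (num D)) π κ ≤ 12 * (T.w u * ε) := by
  have h1 : ∀ᶠ ε in nhdsWithin (0 : ℝ) (Set.Ioi 0), ∀ C, 0 < π C → 3 * ε ≤ π C :=
    Filter.eventually_all.2 fun C => by
      by_cases hC : 0 < π C
      · exact (eventually_mul_le 3 hC).mono fun _ h _ => h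
      · exact Filter.Eventually.of_forall fun _ h => absurd h hC
  filter_upwards [h1, eventually_gap ((-Z) u), eventually_gap (T.slk (-Z) u),
    eventually_gap (T.slk (-Z) p), self_mem_nhdsWithin] with ε hs g1 g2 g3 hε hZ'
  have hε : 0 < ε := hε
  obtain ⟨C1, hC1, C2, hC2, C3, hC3, a, b, ha, hb, r1, r2, r3⟩ :=
    h.rounds.neg.exists_moves hu hε g1 g2 g3
  have eZ : -(-Z - Pi.single u ε) = Z + Pi.single u ε := by abel
  have flip : ∀ (C : V → ℤ) (a b : V), T.IsRounding (-Z - Pi.single u ε) (C - T.anc a + T.anc b) →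
      T.IsRounding (Z + Pi.single u ε) (-C - T.anc b + T.anc a) := fun C a b hr => by
    have := hr.neg
    rw [eZ] at this
    convert this using 1
    abel
  have r1 := flip _ _ _ r1
  have r2 := flip _ _ _ r2
  have r3 := flip _ _ _ r3
  obtain ⟨κ, k1, k2, k3, k4⟩ := h.exists_kernel_of_moves (N := ![-C1, -C2, -C3]) (a := ![b, p, a])
    (b := ![a, b, u]) hZ' hK hε.le hs (fun C hC => by
      have := ((h.isRounding hC).neg.sub_single hu hε g1 g2 g3).neg
      rwa [eZ, neg_neg] at this)
    (fun i => by fin_cases i <;> assumption) (fun i => by fin_cases i <;> assumption)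
    (fun v => by
      have e1 := T.anc_ch_sub hu v
      simp only [Fin.sum_univ_three, Matrix.cons_val_zero, Matrix.cons_val_one, Matrix.cons_val,
        Pi.add_apply, Pi.single_apply]
      have : (if v = u then ε else 0) = ε * (if v = u then 1 else 0) := by simp
      rw [this, ← e1]
      ring)
  refine ⟨κ, k1, k2, k3, k4.trans ?_⟩
  simp only [Fin.sum_univ_three, Matrix.cons_val_zero, Matrix.cons_val_one, Matrix.cons_val]
  have d1 := T.cdist_anc_anc_le hb ha
  have d2 := T.cdist_anc_anc_le (T.below_refl p) hb
  have d3 := T.cdist_anc_anc_le ha (T.below_ch hu)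
  have := T.w_ch hu
  have : T.cdist (T.anc b) (T.anc a) + T.cdist (T.anc p) (T.anc b) + T.cdist (T.anc a) (T.anc u)
      ≤ 12 * T.w u := by linarith
  nlinarith

end Fin

end LevelTree

namespace LevelTree

section Fin

variable {V X : Type*} {T : LevelTree V X} [Fintype V] [DecidableEq V] [Fintype X]
variable {n : ℕ} {K : ℝ} {Z Z' : V → ℝ} {π : (V → Fin n) → ℝ}

/-- The distributions on the way from `Z` to `Z'` that can be followed by transporting servers. -/
structure Reach (T : LevelTree V X) (K : ℝ) (Z Z' : V → ℝ) (π : (V → Fin n) → ℝ) (Y : V → ℝ)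
    (κ : (V → Fin n) → (V → Fin n) → ℝ) : Prop where
  mass : T.IsMass K Y
  law : ∀ C, IsLaw (κ C)
  root : ∀ C D, κ C D ≠ 0 → D T.root = C T.root
  bal : T.Balanced Y (push π κ)
  cost : kcost (fun C D => T.cdist (num C) (num D)) π κ ≤ 12 * T.wdist Z Y
  hull : Y ∈ Set.Icc (Z ⊓ Z') (Z ⊔ Z')

lemma isClosed_reach (hπ : IsLaw π) : IsClosed {p : (V → ℝ) × ((V → Fin n) → (V → Fin n) → ℝ) |
    T.Reach K Z Z' π p.1 p.2} := by
  have e : {p : (V → ℝ) × ((V → Fin n) → (V → Fin n) → ℝ) | T.Reach K Z Z' π p.1 p.2}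
      = {p | ∀ v, 0 ≤ p.1 v} ∩ {p | ∀ v, T.lev v < T.depth → ∑ c ∈ T.ch v, p.1 c ≤ p.1 v} ∩
        {p | p.1 T.root = K} ∩ {p | ∀ C D, 0 ≤ p.2 C D} ∩ {p | ∀ C, ∑ D, p.2 C D = 1} ∩
        {p | ∀ C D, D T.root ≠ C T.root → p.2 C D = 0} ∩
        {p | ∀ v, ∑ C, push π p.2 C * (num C v : ℝ) = p.1 v} ∩
        {p | ∀ v, ∀ j : ℤ, ∑ C, push π p.2 C * |(num C v : ℝ) - j| = |p.1 v - (j : ℝ)|} ∩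
        {p | ∀ v, ∑ C, push π p.2 C * ((T.slk (num C) v : ℤ) : ℝ) = T.slk p.1 v} ∩
        {p | ∀ v, ∀ j : ℤ, ∑ C, push π p.2 C * |((T.slk (num C) v : ℤ) : ℝ) - j|
          = |T.slk p.1 v - (j : ℝ)|} ∩
        {p | kcost (fun C D => T.cdist (num C) (num D)) π p.2 ≤ 12 * T.wdist Z p.1} ∩
        {p | ∀ v, (Z ⊓ Z') v ≤ p.1 v} ∩
        {p | ∀ v, p.1 v ≤ (Z ⊔ Z') v} := by
    ext ⟨Y, κ⟩
    simp only [Set.mem_inter_iff, Set.mem_ofPred_eq]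
    constructor
    · intro h
      exact ⟨⟨⟨⟨⟨⟨⟨⟨⟨⟨⟨⟨h.mass.nonneg, h.mass.node⟩, h.mass.root⟩, fun C D => (h.law C).nonneg D⟩,
        fun C => (h.law C).sum⟩, fun C D hne => by by_contra h0; exact hne (h.root C D h0)⟩,
        fun v => (h.bal.tot v).1⟩, fun v => (h.bal.tot v).2⟩, fun v => (h.bal.slot v).1⟩,
        fun v => (h.bal.slot v).2⟩, h.cost⟩, h.hull.1⟩, h.hull.2⟩
    · rintro ⟨⟨⟨⟨⟨⟨⟨⟨⟨⟨⟨⟨h1, h2⟩, h3⟩, h4⟩, h5⟩, h6⟩, h7⟩, h8⟩, h9⟩, h10⟩, h11⟩, h12⟩, h13⟩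
      have hl : ∀ C, IsLaw (κ C) := fun C => ⟨h4 C, h5 C⟩
      refine ⟨⟨h1, h2, h3⟩, hl, fun C D h0 => ?_, ⟨hπ.push hl, fun v => ⟨h7 v, h8 v⟩,
        fun v => ⟨h9 v, h10 v⟩⟩, h11, ⟨h12, h13⟩⟩
      by_contra hne
      exact h0 (h6 C D hne)
  rw [e]
  simp only [Set.ofPred_forall]
  unfold kcost push wdist slk
  repeat' apply IsClosed.inter
  all_goals
    repeat' refine isClosed_iInter fun _ => ?_
    first
    | exact isClosed_le (by fun_prop) (by fun_prop)
    | exact isClosed_eq (by fun_prop) (by fun_prop)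

lemma wdist_of_single {Y Y' W : V → ℝ} {u : V} (h : ∀ v, v ≠ u → Y' v = Y v) :
    T.wdist W Y' = T.wdist W Y + T.w u * (|Y' u - W u| - |Y u - W u|) := by
  unfold wdist
  rw [← add_sum_erase _ _ (mem_univ u), ← add_sum_erase univ (fun v => T.w v * |Y v - W v|)
    (mem_univ u)]
  rw [sum_congr rfl fun v hv => by rw [h v (mem_erase.1 hv).1]]
  ring

/-- Following a distribution for one more move. -/
lemma Reach.trans {Y Y' : V → ℝ} {κ κ' : (V → Fin n) → (V → Fin n) → ℝ} {u : V} {ε : ℝ}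
    (hπ : IsLaw π) (h : T.Reach K Z Z' π Y κ) (hY : T.IsMass K Y') (hl : ∀ C, IsLaw (κ' C))
    (hr : ∀ C D, κ' C D ≠ 0 → D T.root = C T.root) (hb : T.Balanced Y' (push (push π κ) κ'))
    (hc : kcost (fun C D => T.cdist (num C) (num D)) (push π κ) κ' ≤ 12 * (T.w u * ε))
    (hne : ∀ v, v ≠ u → Y' v = Y v) (hu : |Y' u - Z u| = |Y u - Z u| + ε)
    (hh : Y' u ∈ Set.Icc (Z u ⊓ Z' u) (Z u ⊔ Z' u)) : ∃ κ, T.Reach K Z Z' π Y' κ := by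
  refine ⟨kcomp κ κ', hY, IsLaw.kcomp h.law hl, fun C D h0 => ?_, ?_, ?_, ?_⟩
  · obtain ⟨E, -, hE⟩ := exists_ne_zero_of_sum_ne_zero h0
    rw [hr E D (right_ne_zero_of_mul hE), h.root C E (left_ne_zero_of_mul hE)]
  · rw [push_kcomp]; exact hb
  · have h1 := kcost_kcomp_le (W := fun C D => T.cdist (num C) (num D))
      (fun a b c => T.cdist_triangle _ _ _) hπ h.law hl
    rw [wdist_of_single hne, hu]
    have := h.cost
    linarith
  · constructor
    · intro v
      by_cases hv : v = u
      · subst hv; exact hh.1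
      · rw [hne v hv]; exact h.hull.1 v
    · intro v
      by_cases hv : v = u
      · subst hv; exact hh.2
      · rw [hne v hv]; exact h.hull.2 v

lemma Reach.exists_closer {Y : V → ℝ} {κ : (V → Fin n) → (V → Fin n) → ℝ} (hπ : IsLaw π)
    (hZ' : T.IsMass K Z') (hK : K + 1 ≤ n) (h : T.Reach K Z Z' π Y κ) (hne : Y ≠ Z') :
    ∃ Y' κ', T.Reach K Z Z' π Y' κ' ∧ T.wdist Z' Y' < T.wdist Z' Y := by
  have hroot : Y T.root = Z' T.root := by rw [h.mass.root, hZ'.root]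
  by_cases hgt : ∃ v, Z' v < Y v
  · obtain ⟨u, hu, hmax⟩ := exists_max_image (univ.filter fun v => Z' v < Y v) T.lev
      (by obtain ⟨v, hv⟩ := hgt; exact ⟨v, by simpa using hv⟩)
    simp only [mem_filter, mem_univ, true_and] at hu hmax
    have hur : u ≠ T.root := by rintro rfl; exact hu.ne' hroot
    have hup : u ∈ T.ch (T.par u) := T.mem_ch.2 ⟨hur, rfl⟩
    have hslk : 0 < Y u - ∑ c ∈ T.ch u, Y c := by
      have h1 : ∑ c ∈ T.ch u, Y c ≤ ∑ c ∈ T.ch u, Z' c := sum_le_sum fun c hc => by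
        by_contra! hlt
        have := hmax c hlt
        have := T.lev_ch hc
        omega
      rcases (T.lev_le u).lt_or_eq with hl | hl
      · have := hZ'.node u hl; linarith
      · rw [T.ch_leaf hl, sum_empty]; linarith [hZ'.nonneg u]
    obtain ⟨ε, hk, e1, e2, hε⟩ := ((h.bal.exists_kernel_down hK hup).and
      ((eventually_mul_le 1 hslk).and ((eventually_mul_le 1 (sub_pos.2 hu)).and
        self_mem_nhdsWithin))).exists
    have hε : 0 < ε := hε
    have hY' : ∀ v, v ≠ u → (Y - Pi.single u ε : V → ℝ) v = Y v := fun v hv => by simp [hv]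
    have hYu : (Y - Pi.single u ε : V → ℝ) u = Y u - ε := by simp
    have hm : T.IsMass K (Y - Pi.single u ε) := by
      refine ⟨fun v => ?_, fun p hp => ?_, by rw [hY' _ hur.symm, h.mass.root]⟩
      · by_cases hv : v = u
        · subst hv; rw [hYu]; linarith [hZ'.nonneg v]
        · rw [hY' v hv]; exact h.mass.nonneg v
      · have h1 : ∑ c ∈ T.ch p, (Y - Pi.single u ε : V → ℝ) c ≤ ∑ c ∈ T.ch p, Y c :=
          sum_le_sum fun c _ => by
            by_cases hv : c = u
            · subst hv; rw [hYu]; linarith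
            · rw [hY' c hv]
        by_cases hv : p = u
        · subst hv
          rw [hYu]
          have h2 : ∑ c ∈ T.ch p, (Y - Pi.single p ε : V → ℝ) c = ∑ c ∈ T.ch p, Y c :=
            sum_congr rfl fun c hc => hY' c fun e => by
              subst e; exact T.not_below_of_ch hc (T.below_refl _)
          linarith
        · rw [hY' p hv]; exact h1.trans (h.mass.node p hp)
    obtain ⟨κ', k1, k2, k3, k4⟩ := hk hm
    have hhull1 := h.hull.1 u
    have hhull2 := h.hull.2 u
    simp only [Pi.inf_apply, Pi.sup_apply] at hhull1 hhull2
    have hZu : Y u ≤ Z u := by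
      by_contra! hlt
      exact absurd hhull2 (not_le.2 (max_lt hlt hu))
    obtain ⟨κ'', hκ⟩ := h.trans hπ hm k1 k2 k3 k4 hY' (by
      rw [hYu, abs_of_nonpos (by linarith), abs_of_nonpos (by linarith)]; ring) (by
      rw [hYu]
      exact ⟨(min_le_right _ _).trans (by linarith), (show Y u - ε ≤ Z u by linarith).trans
        (le_max_left _ _)⟩)
    refine ⟨_, κ'', hκ, ?_⟩
    rw [wdist_of_single hY', hYu, abs_of_nonneg (by linarith), abs_of_nonneg (by linarith)]
    have := mul_pos (T.w_pos u) hε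
    linarith
  · push Not at hgt
    have hlt : ∃ v, Y v < Z' v := by
      by_contra! hcon
      exact hne (funext fun v => le_antisymm (hgt v) (hcon v))
    obtain ⟨u, hu, hmin⟩ := exists_min_image (univ.filter fun v => Y v < Z' v) T.lev
      (by obtain ⟨v, hv⟩ := hlt; exact ⟨v, by simpa using hv⟩)
    simp only [mem_filter, mem_univ, true_and] at hu hmin
    have hur : u ≠ T.root := by rintro rfl; exact hu.ne hroot
    have hup : u ∈ T.ch (T.par u) := T.mem_ch.2 ⟨hur, rfl⟩
    have hpu : T.par u ≠ u := fun e => T.not_below_of_ch hup (by rw [e]; exact T.below_refl u)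
    have hslk : 0 < Y (T.par u) - ∑ c ∈ T.ch (T.par u), Y c := by
      have h1 : ∑ c ∈ T.ch (T.par u), Y c < ∑ c ∈ T.ch (T.par u), Z' c :=
        sum_lt_sum (fun c _ => hgt c) ⟨u, hup, hu⟩
      have h2 : Z' (T.par u) ≤ Y (T.par u) := by
        by_contra! hcon
        have := hmin _ hcon
        have := T.lev_ch hup
        omega
      have := hZ'.node _ (T.lev_lt_of_ch hup)
      linarith
    obtain ⟨ε, hk, e1, e2, hε⟩ := ((h.bal.exists_kernel_up hK hup).and
      ((eventually_mul_le 1 hslk).and ((eventually_mul_le 1 (sub_pos.2 hu)).and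
        self_mem_nhdsWithin))).exists
    have hε : 0 < ε := hε
    have hY' : ∀ v, v ≠ u → (Y + Pi.single u ε : V → ℝ) v = Y v := fun v hv => by simp [hv]
    have hYu : (Y + Pi.single u ε : V → ℝ) u = Y u + ε := by simp
    have hm : T.IsMass K (Y + Pi.single u ε) := by
      refine ⟨fun v => ?_, fun p hp => ?_, by rw [hY' _ hur.symm, h.mass.root]⟩
      · by_cases hv : v = u
        · subst hv; rw [hYu]; linarith [h.mass.nonneg v]
        · rw [hY' v hv]; exact h.mass.nonneg v
      · by_cases hv : p = T.par u
        · subst hv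
          rw [hY' _ hpu, ← add_sum_erase _ _ hup, hYu]
          rw [← add_sum_erase _ _ hup] at hslk e1
          rw [sum_congr rfl fun c hc => hY' c (mem_erase.1 hc).1]
          linarith
        · have h1 : ∑ c ∈ T.ch p, (Y + Pi.single u ε : V → ℝ) c = ∑ c ∈ T.ch p, Y c :=
            sum_congr rfl fun c hc => hY' c fun e => by
              subst e; exact hv (T.mem_ch.1 hc).2.symm
          rw [h1]
          refine (h.mass.node p hp).trans ?_
          by_cases hv' : p = u
          · subst hv'; rw [hYu]; linarith
          · rw [hY' p hv']
    obtain ⟨κ', k1, k2, k3, k4⟩ := hk hm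
    have hhull1 := h.hull.1 u
    have hhull2 := h.hull.2 u
    simp only [Pi.inf_apply, Pi.sup_apply] at hhull1 hhull2
    have hZu : Z u ≤ Y u := by
      by_contra! hlt
      exact absurd hhull1 (not_le.2 (lt_min hlt hu))
    obtain ⟨κ'', hκ⟩ := h.trans hπ hm k1 k2 k3 k4 hY' (by
      rw [hYu, abs_of_nonneg (by linarith), abs_of_nonneg (by linarith)]; ring) (by
      rw [hYu]
      exact ⟨(min_le_left _ _).trans (by linarith), (show Y u + ε ≤ Z' u by linarith).trans
        (le_max_right _ _)⟩)
    refine ⟨_, κ'', hκ, ?_⟩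
    rw [wdist_of_single hY', hYu, abs_of_nonpos (by linarith), abs_of_nonpos (by linarith)]
    have := mul_pos (T.w_pos u) hε
    linarith

/-- Online rounding: a change of the fractional masses can be followed by random integral
configurations at comparable expected cost. -/
theorem Balanced.exists_kernel (h : T.Balanced Z π) (hZ : T.IsMass K Z) (hZ' : T.IsMass K Z')
    (hK : K + 1 ≤ n) : ∃ κ : (V → Fin n) → (V → Fin n) → ℝ, (∀ C, IsLaw (κ C)) ∧
      (∀ C D, κ C D ≠ 0 → D T.root = C T.root) ∧ T.Balanced Z' (push π κ) ∧
      kcost (fun C D => T.cdist (num C) (num D)) π κ ≤ 12 * T.wdist Z Z' := by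
  set S := {p : (V → ℝ) × ((V → Fin n) → (V → Fin n) → ℝ) | T.Reach K Z Z' π p.1 p.2} with hS
  have hcpt : IsCompact S := by
    refine IsCompact.of_isClosed_subset (isCompact_Icc (a := (Z ⊓ Z', 0)) (b := (Z ⊔ Z', 1)))
      (isClosed_reach h.law) fun p hp => ?_
    refine ⟨⟨hp.hull.1, fun C D => (hp.law C).nonneg D⟩, ⟨hp.hull.2, fun C D => ?_⟩⟩
    exact (single_le_sum (fun D _ => (hp.law C).nonneg D) (mem_univ D)).trans (hp.law C).sum.le
  have hid : push π (fun C D => if D = C then 1 else 0) = π := by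
    funext D; simp [push]
  have hne : S.Nonempty := by
    refine ⟨(Z, fun C D => if D = C then 1 else 0), hZ, fun C => ⟨fun D => ?_, by simp⟩,
      fun C D h0 => ?_, ?_, ?_, ⟨inf_le_left, le_sup_left⟩⟩
    · dsimp only; split_ifs <;> norm_num
    · by_contra hcon
      exact h0 (if_neg fun e => hcon (by rw [e]))
    · rw [hid]; exact h
    · simp [kcost, cdist_self, wdist]
  obtain ⟨⟨Y, κ⟩, hp, hmin⟩ := hcpt.exists_isMinOn hne
    (f := fun p => T.wdist Z' p.1) (by unfold wdist; fun_prop)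
  have hY : Y = Z' := by
    by_contra hcon
    obtain ⟨Y', κ', hp', hlt⟩ := hp.exists_closer h.law hZ' hK hcon
    exact absurd (hmin (show (Y', κ') ∈ S from hp')) (not_le.2 hlt)
  subst hY
  exact ⟨κ, hp.law, hp.root, hp.bal, hp.cost⟩

end Fin

end LevelTree

namespace KServer

section Online

variable {X : Type*} [Fintype X] [MetricSpace X] {k : ℕ} {S : Type*}

/-- The expected remaining cost of a strategy whose moves depend on a state, which is updated
deterministically, and on the current configuration. -/
noncomputable def stateCost (next : S → X → S) (ker : S → X → Config X k → PMF (Config X k)) :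
    S → Config X k → List X → ℝ
  | _, _, [] => 0
  | s, A, r :: rs => ∑ B : Config X k, (ker s r A B).toReal *
      (moveCost A B + stateCost next ker (next s r) B rs)

/-- The state and the configuration after a history. -/
def stateAfter (next : S → X → S) (s0 : S) (A0 : Config X k) (h : List (X × Config X k)) :
    S × Config X k := h.foldl (fun p x => (next p.1 x.1, x.2)) (s0, A0)

/-- The online algorithm that keeps track of a state. -/
noncomputable def stateAlg (next : S → X → S) (ker : S → X → Config X k → PMF (Config X k))
    (hker : ∀ s r A, ∀ B ∈ (ker s r A).support, r ∈ B.1) (s0 : S) (A0 : Config X k) :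
    OnlineAlgorithm X k where
  next h r := ker (stateAfter next s0 A0 h).1 r (stateAfter next s0 A0 h).2
  serves _ r B hB := hker _ r _ B hB

lemma stateAlg_costToGo (next : S → X → S) (ker : S → X → Config X k → PMF (Config X k))
    (hker : ∀ s r A, ∀ B ∈ (ker s r A).support, r ∈ B.1) (s0 : S) (A0 : Config X k) (rs : List X) :
    ∀ (h : List (X × Config X k)), (stateAlg next ker hker s0 A0).costToGo h
      (stateAfter next s0 A0 h).2 rs
        = stateCost next ker (stateAfter next s0 A0 h).1 (stateAfter next s0 A0 h).2 rs := by
  induction rs with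
  | nil => intro h; rfl
  | cons r rs ih =>
    intro h
    unfold OnlineAlgorithm.costToGo stateCost
    refine sum_congr rfl fun B _ => ?_
    have e : stateAfter next s0 A0 (h ++ [(r, B)])
        = (next (stateAfter next s0 A0 h).1 r, B) := by
      simp [stateAfter, List.foldl_append]
    have := ih (h ++ [(r, B)])
    rw [e] at this
    rw [this]
    rfl

/-- A kernel with prescribed joint law. -/
lemma exists_ker {Ω : Type*} [Fintype Ω] (P : Ω → Prop) (h0 : ∃ B, P B) {m : ℝ} {q : Ω → ℝ}
    (hq : ∀ B, 0 ≤ q B) (hm : ∑ B, q B = m) (hP : ∀ B, q B ≠ 0 → P B) :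
    ∃ p : PMF Ω, (∀ B ∈ p.support, P B) ∧ ∀ B, m * (p B).toReal = q B := by
  rcases eq_or_ne m 0 with h | h
  · obtain ⟨B0, hB0⟩ := h0
    refine ⟨PMF.pure B0, fun B hB => ?_, fun B => ?_⟩
    · rw [PMF.mem_support_pure_iff] at hB
      rw [hB]; exact hB0
    · rw [h] at hm
      rw [(sum_eq_zero_iff_of_nonneg fun B _ => hq B).1 hm B (mem_univ B), h, zero_mul]
  · have hpos : 0 < m := lt_of_le_of_ne (by rw [← hm]; exact sum_nonneg fun B _ => hq B) h.symm
    refine ⟨PMF.ofFintype (fun B => ENNReal.ofReal (q B / m)) ?_, fun B hB => ?_, fun B => ?_⟩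
    · rw [← ENNReal.ofReal_sum_of_nonneg fun B _ => div_nonneg (hq B) hpos.le, ← sum_div, hm,
        div_self h, ENNReal.ofReal_one]
    · refine hP B fun h0 => ?_
      rw [PMF.mem_support_iff] at hB
      simp [h0] at hB
    · rw [PMF.ofFintype_apply, ENNReal.toReal_ofReal (div_nonneg (hq B) hpos.le)]
      field_simp

/-- A strategy given by joint laws of consecutive configurations is competitive if a potential
pays for it. -/
theorem exists_competitive {μ : S → Config X k → ℝ} {next : S → X → S}
    {q : S → X → Config X k → Config X k → ℝ} {pot : S → Config X k → ℝ} {c b : ℝ} (s0 : S)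
    (A0 : Config X k) (hr : ∀ r : X, ∃ B : Config X k, r ∈ B.1)
    (hq0 : ∀ s r A B, 0 ≤ q s r A B) (hq1 : ∀ s r A, ∑ B, q s r A B = μ s A)
    (hq2 : ∀ s r B, ∑ A, q s r A B = μ (next s r) B)
    (hserve : ∀ s r A B, q s r A B ≠ 0 → r ∈ B.1)
    (hμ : ∀ f : Config X k → ℝ, ∑ A, μ s0 A * f A = f A0)
    (hpot : ∀ s r A' B', r ∈ B'.1 → ∑ A, ∑ B, q s r A B * moveCost A B + pot (next s r) B'
      ≤ pot s A' + c * moveCost A' B')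
    (hb : ∀ s A, |pot s A| ≤ b) :
    ∃ alg : OnlineAlgorithm X k, alg.IsCompetitive A0 c (2 * b) := by
  choose ker hker1 hker2 using fun s r A =>
    exists_ker (fun B : Config X k => r ∈ B.1) (hr r) (hq0 s r A) (hq1 s r A) (hserve s r A)
  have key : ∀ (rs : List X) (s : S) (A' : Config X k) (Bs : List (Config X k)), Serves rs Bs →
      ∑ A, μ s A * stateCost next ker s A rs ≤ pot s A' + c * scheduleCost A' Bs + b := by
    intro rs
    induction rs with
    | nil =>
      rintro s A' _ ⟨⟩
      have := (abs_le.1 (hb s A')).1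
      simp only [stateCost, scheduleCost, mul_zero, sum_const_zero]
      linarith
    | cons r rs ih =>
      intro s A' Bs hBs
      cases hBs with
      | @cons _ B' _ Bs' h1 h2 =>
      have e : ∑ A, μ s A * stateCost next ker s A (r :: rs)
          = ∑ A, ∑ B, q s r A B * moveCost A B
            + ∑ B, μ (next s r) B * stateCost next ker (next s r) B rs := by
        have e1 : ∑ B, μ (next s r) B * stateCost next ker (next s r) B rs
            = ∑ A, ∑ B, q s r A B * stateCost next ker (next s r) B rs := by
          rw [sum_comm]
          exact sum_congr rfl fun B _ => by rw [← hq2, sum_mul]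
        rw [e1, ← sum_add_distrib]
        refine sum_congr rfl fun A _ => ?_
        rw [← sum_add_distrib, stateCost, mul_sum]
        refine sum_congr rfl fun B _ => ?_
        rw [← mul_assoc, hker2, mul_add]
      rw [e]
      have h3 := ih (next s r) B' Bs' h2
      have h4 := hpot s r A' B' h1
      rw [scheduleCost]
      linarith
  refine ⟨stateAlg next ker hker1 s0 A0, fun rs Bs hBs => ?_⟩
  have h1 := key rs s0 A0 Bs hBs
  rw [hμ] at h1
  have h2 := stateAlg_costToGo next ker hker1 s0 A0 rs []
  have h3 := (abs_le.1 (hb s0 A0)).2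
  unfold OnlineAlgorithm.expectedCost
  refine le_trans (le_of_eq h2) ?_
  change stateCost next ker s0 A0 rs ≤ _
  linarith

lemma moveCost_le (A B : Config X k) (e : {x // x ∈ A.1} ≃ {x // x ∈ B.1}) :
    moveCost A B ≤ ∑ a : {x // x ∈ A.1}, dist (a : X) (e a : X) :=
  ciInf_le ⟨0, by rintro _ ⟨e, rfl⟩; exact sum_nonneg fun _ _ => dist_nonneg⟩ e

lemma exists_equiv (A B : Config X k) : Nonempty ({x // x ∈ A.1} ≃ {x // x ∈ B.1}) :=
  ⟨Fintype.equivOfCardEq (by simp [A.2, B.2])⟩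

lemma le_moveCost {A B : Config X k} {c : ℝ}
    (h : ∀ e : {x // x ∈ A.1} ≃ {x // x ∈ B.1}, c ≤ ∑ a : {x // x ∈ A.1}, dist (a : X) (e a : X)) :
    c ≤ moveCost A B := by
  have := exists_equiv A B
  exact le_ciInf h

lemma moveCost_self_le (A : Config X k) : moveCost A A ≤ 0 := by
  refine (moveCost_le A A (Equiv.refl _)).trans (le_of_eq ?_)
  simp

lemma moveCost_swap_le [DecidableEq X] {A B : Config X k} {a r : X} (ha : a ∈ A.1) (hr : r ∉ A.1)
    (hB : B.1 = insert r (A.1.erase a)) : moveCost A B ≤ dist a r := by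
  let f : {x // x ∈ A.1} → {x // x ∈ B.1} := fun x =>
    if h : (x : X) = a then ⟨r, by rw [hB]; exact mem_insert_self _ _⟩
    else ⟨x, by rw [hB]; exact mem_insert_of_mem (mem_erase.2 ⟨h, x.2⟩)⟩
  have hf : Function.Injective f := by
    intro x y hxy
    simp only [f] at hxy
    split_ifs at hxy with h1 h2 h2
    · exact Subtype.ext (h1.trans h2.symm)
    · exact absurd (by have := congrArg Subtype.val hxy; simp only at this; rw [this]; exact y.2) hr
    · exact absurd (by have := congrArg Subtype.val hxy; simp only at this; rw [← this]; exact x.2) hr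
    · exact Subtype.ext (by simpa using hxy)
  have hbij : Function.Bijective f :=
    (Fintype.bijective_iff_injective_and_card f).2 ⟨hf, by simp [A.2, B.2]⟩
  refine (moveCost_le A B (Equiv.ofBijective f hbij)).trans ?_
  rw [sum_eq_single ⟨a, ha⟩]
  · simp [f]
  · intro x _ hx
    have : (x : X) ≠ a := fun h => hx (Subtype.ext h)
    simp [f, this]
  · simp

end Online

end KServer

namespace LevelTree

section Fin

variable {V X : Type*} {T : LevelTree V X} [Fintype V] [DecidableEq V] [Fintype X]

/-- The server counts of a set of points. -/
def icnt (T : LevelTree V X) (A : Finset X) : V → ℤ := fun v => (T.cnt A v : ℤ)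

lemma icnt_eq (A : Finset X) (v : V) : T.icnt A v = ∑ a ∈ A, T.anc (T.leaf a) v := by
  simp only [icnt, cnt, anc, card_filter]
  push_cast
  rfl

lemma slk_icnt (A : Finset X) (v : V) :
    T.slk (T.icnt A) v = ∑ a ∈ A, if v = T.leaf a then 1 else 0 := by
  have : T.slk (T.icnt A) v = ∑ a ∈ A, T.slk (T.anc (T.leaf a)) v := by
    simp only [slk, icnt_eq, sum_sub_distrib]
    rw [sum_comm]
  rw [this]
  exact sum_congr rfl fun a _ => T.slk_anc _ _

lemma icnt_insert_erase [DecidableEq X] {A : Finset X} {a r : X} (ha : a ∈ A) (hr : r ∉ A) :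
    T.icnt (insert r (A.erase a)) = T.icnt A - T.anc (T.leaf a) + T.anc (T.leaf r) := by
  funext v
  rw [Pi.add_apply, Pi.sub_apply, icnt_eq, icnt_eq,
    sum_insert fun h => hr (mem_of_mem_erase h), ← add_sum_erase A _ ha]
  ring

/-- If the virtual servers cover `r`, then some real server can move to `r` in such a way that the
distance to the virtual servers decreases by the length of the move. -/
lemma exists_swap [DecidableEq X] {N : V → ℤ} {A : Finset X} {r : X} (hN : ∀ v, 0 ≤ T.slk N v)
    (hroot : N T.root = A.card) (hr : 1 ≤ N (T.leaf r)) (hrA : r ∉ A) :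
    ∃ a ∈ A, T.cdist N (T.icnt (insert r (A.erase a)))
      + T.cdist (T.anc (T.leaf a)) (T.anc (T.leaf r)) ≤ T.cdist N (T.icnt A) := by
  have hex : ∃ j, j ≤ T.depth ∧ N (T.pth r (T.depth - j)) ≤ T.icnt A (T.pth r (T.depth - j)) :=
    ⟨T.depth, le_rfl, by
      rw [Nat.sub_self, T.pth_zero, hroot, icnt, T.cnt_root]⟩
  obtain ⟨hj, hle⟩ := Nat.find_spec hex
  have hmin := fun m => Nat.find_min hex (m := m)
  set j := Nat.find hex with hjdef
  set p := T.pth r (T.depth - j) with hp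
  have hlp : T.lev p = T.depth - j := T.lev_pth r (Nat.sub_le _ _)
  have hpr : T.Below p (T.leaf r) := T.below_pth r (Nat.sub_le _ _)
  have hup : ∀ v, T.Below v (T.leaf r) → T.lev p < T.lev v → T.icnt A v < N v := by
    intro v hv hlt
    have hlv := T.lev_le v
    have := hmin (T.depth - T.lev v) (by omega)
    simp only [not_and, not_le] at this
    have := this (by omega)
    have e : T.depth - (T.depth - T.lev v) = T.lev v := by omega
    rwa [e, ← T.eq_pth hv] at this
  have hj0 : T.lev p < T.depth := by
    by_contra! hcon
    have e : p = T.leaf r := by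
      rw [T.eq_pth hpr, show T.lev p = T.depth from le_antisymm (T.lev_le p) hcon, T.pth_depth]
    rw [e] at hle
    have : T.icnt A (T.leaf r) = 0 := by simp [icnt, T.cnt_leaf, hrA]
    omega
  have hc := T.pth_ch r hj0
  have hcr : T.Below (T.pth r (T.lev p + 1)) (T.leaf r) := T.below_pth r hj0
  rw [← T.eq_pth hpr] at hc
  have hlc := hup _ hcr (by rw [T.lev_ch hc]; omega)
  obtain ⟨g, hg, hlt⟩ : ∃ g ∈ T.ch p, N g < T.icnt A g := by
    by_contra! hcon
    have h1 := sum_lt_sum hcon ⟨_, hc, hlc⟩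
    have h2 := T.eq_slk_add N p
    have h3 := T.eq_slk_add (T.icnt A) p
    have h4 : T.slk (T.icnt A) p = 0 := by
      rw [slk_icnt]
      refine sum_eq_zero fun a _ => if_neg ?_
      rintro e
      rw [e, T.lev_leaf] at hj0
      omega
    have := hN p
    omega
  obtain ⟨h, hgh, hs, hdown⟩ := exists_slot (T := T) g hlt
  obtain ⟨a, haA, hah⟩ : ∃ a ∈ A, h = T.leaf a := by
    by_contra! hcon
    rw [slk_icnt, sum_eq_zero fun a ha => if_neg (hcon a ha)] at hs
    have := hN h
    omega
  subst hah
  refine ⟨a, haA, ?_⟩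
  rw [icnt_insert_erase haA hrA]
  unfold cdist wdist
  rw [← sum_add_distrib]
  refine sum_le_sum fun v _ => ?_
  rw [← mul_add]
  refine mul_le_mul_of_nonneg_left ?_ (T.w_pos v).le
  have hpa : T.Below p (T.leaf a) := (T.below_ch hg).trans T hgh
  have key : |(T.icnt A - T.anc (T.leaf a) + T.anc (T.leaf r)) v - N v|
      + |T.anc (T.leaf r) v - T.anc (T.leaf a) v| ≤ |T.icnt A v - N v| := by
    simp only [Pi.add_apply, Pi.sub_apply, anc]
    by_cases hva : T.Below v (T.leaf a) <;> by_cases hvr : T.Below v (T.leaf r)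
    · simp [hva, hvr]
    · have hl : T.lev p < T.lev v := by
        by_contra! hl
        exact hvr ((T.below_of_lev_le hva hpa hl).trans T hpr)
      have := hdown v (T.below_of_lev_le hgh hva (by rw [T.lev_ch hg]; omega)) hva
      simp only [hva, hvr, if_true, if_false]
      rw [abs_of_nonneg (by omega), abs_of_nonpos (by omega), abs_of_nonneg (by omega)]
      omega
    · have hl : T.lev p < T.lev v := by
        by_contra! hl
        exact hva ((T.below_of_lev_le hvr hpr hl).trans T hpa)
      have := hup v hvr hl
      simp only [hva, hvr, if_true, if_false]
      rw [abs_of_nonpos (by omega), abs_of_nonneg (by omega), abs_of_nonpos (by omega)]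
      omega
    · simp [hva, hvr]
  beta_reduce
  exact_mod_cast key

end Fin

end LevelTree

namespace LevelTree

section Fin

open KServer

variable {V X : Type*} {T : LevelTree V X} [Fintype V] [DecidableEq V] [Fintype X]
variable [MetricSpace X] {k : ℕ} {α β : ℝ}

lemma IsMass.slk_nonneg {K : ℝ} {z : V → ℝ} (h : T.IsMass K z) (v : V) : 0 ≤ T.slk z v := by
  unfold slk
  rcases (T.lev_le v).lt_or_eq with hl | hl
  · exact sub_nonneg.2 (h.node v hl)
  · rw [T.ch_leaf hl, sum_empty, sub_zero]; exact h.nonneg v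

/-- The slightly inflated server masses. -/
noncomputable def infl (T : LevelTree V X) (k : ℕ) (x : V → ℕ → ℝ) (v : V) : ℝ :=
  (2 * k + 1) / (2 * k) * T.mass x v

lemma Feas.infl_isMass {x : V → ℕ → ℝ} (h : T.Feas k x) (hc : ∀ v i, x v i ≤ 1) (hk1 : 1 ≤ k)
    (hk : k ≤ Fintype.card X) : T.IsMass (k + 1 / 2) (T.infl k x) := by
  have hk0 : (0 : ℝ) < k := by exact_mod_cast hk1
  have hs : (0 : ℝ) ≤ (2 * k + 1) / (2 * k) := by positivity
  have hm := h.isMass hc hk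
  refine ⟨fun v => mul_nonneg hs (hm.nonneg v), fun p hp => ?_, ?_⟩
  · unfold infl
    rw [← mul_sum]
    exact mul_le_mul_of_nonneg_left (hm.node p hp) hs
  · unfold infl
    rw [hm.root]
    field_simp

lemma wdist_infl_le (hk1 : 1 ≤ k) (x x' : V → ℕ → ℝ) :
    T.wdist (T.infl k x) (T.infl k x') ≤ 3 / 2 * T.wdist (T.mass x) (T.mass x') := by
  have hk0 : (1 : ℝ) ≤ k := by exact_mod_cast hk1
  unfold wdist infl
  rw [mul_sum]
  refine sum_le_sum fun v _ => ?_
  rw [← mul_sub, abs_mul, abs_of_nonneg (by positivity)]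
  have h1 : (2 * k + 1 : ℝ) / (2 * k) ≤ 3 / 2 := by
    rw [div_le_div_iff₀ (by positivity) (by norm_num)]; linarith
  have h2 := mul_nonneg (T.w_pos v).le (abs_nonneg (T.mass x' v - T.mass x v))
  nlinarith

/-- The consistent states of the algorithm: a fractional state, a balanced law of virtual
configurations, and a joint law of virtual and real configurations. -/
structure Good (T : LevelTree V X) (k : ℕ) (x : V → ℕ → ℝ) (π : (V → Fin (k + 2)) → ℝ)
    (γ : (V → Fin (k + 2)) → Config X k → ℝ) : Prop where
  feas : T.Feas k x
  cap : ∀ v i, x v i ≤ 1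
  bal : T.Balanced (T.infl k x) π
  nonneg : ∀ C A, 0 ≤ γ C A
  marg : ∀ C, ∑ A, γ C A = if num C T.root = k then 2 * π C else 0

/-- The expected distance of the virtual from the real configuration. -/
noncomputable def gapCost (T : LevelTree V X) (γ : (V → Fin (k + 2)) → Config X k → ℝ) : ℝ :=
  ∑ C, ∑ A, γ C A * T.cdist (num C) (T.icnt A.1)

/-- The offset in the relative entropy. -/
noncomputable def offs (k : ℕ) : ℝ := 1 / (2 * k + 1)

lemma offs_pos (k : ℕ) : 0 < offs k := by unfold offs; positivity

lemma offs_le (hk1 : 1 ≤ k) : offs k ≤ 1 / 3 := by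
  have hk0 : (1 : ℝ) ≤ k := by exact_mod_cast hk1
  unfold offs
  rw [div_le_div_iff₀ (by positivity) (by norm_num)]; linarith

/-- The potential of the fractional algorithm. -/
noncomputable def fracPot (T : LevelTree V X) (k : ℕ) (x : V → ℕ → ℝ) (A : Finset X) : ℝ :=
  8 * lam k * T.ent (offs k) A x + T.treeEnt (T.mass x)

/-- The potential of the randomized algorithm. -/
noncomputable def pot (T : LevelTree V X) (α : ℝ) (x : V → ℕ → ℝ)
    (γ : (V → Fin (k + 2)) → Config X k → ℝ) (A : Config X k) : ℝ :=
  α * (T.gapCost γ + 576 * T.fracPot k x A.1)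

lemma exists_serve_config (hα : 0 ≤ α)
    (hub : ∀ x y : X, dist x y ≤ α * T.cdist (T.anc (T.leaf x)) (T.anc (T.leaf y)))
    (A : Config X k) {N : V → ℤ} {r : X} (hN : ∀ v, 0 ≤ T.slk N v) (hroot : N T.root = k)
    (hr : 1 ≤ N (T.leaf r)) : ∃ B : Config X k, r ∈ B.1 ∧
      moveCost A B ≤ α * (T.cdist N (T.icnt A.1) - T.cdist N (T.icnt B.1)) := by
  classical
  by_cases hrA : r ∈ A.1
  · exact ⟨A, hrA, by rw [sub_self, mul_zero]; exact moveCost_self_le A⟩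
  · obtain ⟨a, ha, h1⟩ := exists_swap (T := T) hN (by rw [hroot, A.2]) hr hrA
    have hcard : (insert r (A.1.erase a)).card = k := by
      rw [card_insert_of_notMem fun h => hrA (mem_of_mem_erase h), card_erase_of_mem ha, A.2]
      have : 0 < A.1.card := card_pos.2 ⟨a, ha⟩
      rw [A.2] at this
      omega
    refine ⟨⟨_, hcard⟩, mem_insert_self _ _, ?_⟩
    refine (moveCost_swap_le ha hrA rfl).trans ((hub a r).trans ?_)
    exact mul_le_mul_of_nonneg_left (by linarith) hα

theorem Good.exists_step (hα : 0 ≤ α)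
    (hub : ∀ x y : X, dist x y ≤ α * T.cdist (T.anc (T.leaf x)) (T.anc (T.leaf y)))
    (hk1 : 1 ≤ k) (hk : k ≤ Fintype.card X) {x : V → ℕ → ℝ} {π : (V → Fin (k + 2)) → ℝ}
    {γ : (V → Fin (k + 2)) → Config X k → ℝ} (h : T.Good k x π γ) (r : X) :
    ∃ x' π' γ', T.Good k x' π' γ' ∧ ∃ q : Config X k → Config X k → ℝ, (∀ A B, 0 ≤ q A B) ∧
      (∀ A, ∑ B, q A B = ∑ C, γ C A) ∧ (∀ B, ∑ A, q A B = ∑ C, γ' C B) ∧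
      (∀ A B, q A B ≠ 0 → r ∈ B.1) ∧
      ∀ A' : Config X k, r ∈ A'.1 →
        ∑ A, ∑ B, q A B * moveCost A B + T.pot α x' γ' A' ≤ T.pot α x γ A' := by
  classical
  have hk0 : (1 : ℝ) ≤ k := by exact_mod_cast hk1
  obtain ⟨x', hf, hc, hxr, hpot⟩ :=
    h.feas.exists_serve (offs_pos k) (offs_le hk1) hk1 hk h.cap r
  have hm := h.feas.infl_isMass h.cap hk1 hk
  have hm' := hf.infl_isMass hc hk1 hk
  obtain ⟨κ, k1, k2, k3, k4⟩ := h.bal.exists_kernel hm hm' (by push_cast; linarith)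
  set π' := push π κ with hπ'
  have hserve : ∀ D : V → Fin (k + 2), ∀ A : Config X k, ∃ B : Config X k, r ∈ B.1 ∧
      (0 < π' D → num D T.root = k →
        moveCost A B ≤ α * (T.cdist (num D) (T.icnt A.1) - T.cdist (num D) (T.icnt B.1))) := by
    intro D A
    by_cases hD : 0 < π' D ∧ num D T.root = k
    · have hr := k3.isRounding hD.1
      obtain ⟨B, hB, h1⟩ := exists_serve_config hα hub A (N := num D) (r := r)
        (fun v => ((hr v).2 0).1 (by simpa using hm'.slk_nonneg v)) hD.2
        (((hr (T.leaf r)).1 1).1 (by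
          unfold infl
          rw [mass_leaf]
          have : 1 - offs k ≤ 1 - x' (T.leaf r) 0 := by linarith
          have h2 : (2 * k + 1 : ℝ) / (2 * k) * (1 - offs k) = 1 := by
            unfold offs; field_simp; ring
          rw [Int.cast_one]
          exact h2.symm.le.trans (mul_le_mul_of_nonneg_left this (by positivity))))
      exact ⟨B, hB, fun _ _ => h1⟩
    · obtain ⟨B, hB, -, hBc⟩ := Finset.exists_subsuperset_card_eq (s := {r}) (t := univ) (n := k)
        (by simp) (by simpa) (by simpa)
      exact ⟨⟨B, hBc⟩, hB (mem_singleton_self r), fun h1 h2 => absurd ⟨h1, h2⟩ hD⟩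
  choose f hf1 hf2 using hserve
  set G : (V → Fin (k + 2)) → Config X k → (V → Fin (k + 2)) → ℝ := fun C A D => γ C A * κ C D with hG
  have hG0 : ∀ C A D, 0 ≤ G C A D := fun C A D => mul_nonneg (h.nonneg C A) ((k1 C).nonneg D)
  have hGA : ∀ C D, ∑ A, G C A D = (if num C T.root = k then 2 * π C else 0) * κ C D := fun C D => by
    simp only [hG, ← sum_mul, h.marg]
  have hGD : ∀ C A, ∑ D, G C A D = γ C A := fun C A => by
    simp only [hG, ← mul_sum, (k1 C).sum, mul_one]
  refine ⟨x', π', fun D B => ∑ C, ∑ A, if f D A = B then G C A D else 0,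
    ⟨hf, hc, k3, fun D B => ?_, fun D => ?_⟩,
    fun A B => ∑ C, ∑ D, if f D A = B then G C A D else 0, fun A B => ?_, fun A => ?_, fun B => ?_,
    fun A B hq => ?_, fun A' hA' => ?_⟩
  · exact sum_nonneg fun C _ => sum_nonneg fun A _ => by split_ifs; exacts [hG0 _ _ _, le_rfl]
  · have e1 : ∑ B, ∑ C, ∑ A, (if f D A = B then G C A D else 0) = ∑ C, ∑ A, G C A D := by
      rw [sum_comm]
      refine sum_congr rfl fun C _ => ?_
      rw [sum_comm]
      exact sum_congr rfl fun A _ => by simp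
    rw [e1, sum_congr rfl fun C _ => hGA C D]
    have e2 : ∀ C, (if num C T.root = k then 2 * π C else 0) * κ C D
        = if num D T.root = k then 2 * (π C * κ C D) else 0 := by
      intro C
      by_cases h0 : κ C D = 0
      · simp [h0]
      · have : num D T.root = num C T.root := by simp only [num, k2 C D h0]
        rw [this]
        split_ifs <;> ring
    rw [sum_congr rfl fun C _ => e2 C]
    split_ifs
    · rw [← mul_sum]; rfl
    · simp
  · exact sum_nonneg fun C _ => sum_nonneg fun A _ => by split_ifs; exacts [hG0 _ _ _, le_rfl]
  · rw [sum_comm]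
    refine sum_congr rfl fun C _ => ?_
    rw [sum_comm, ← hGD]
    exact sum_congr rfl fun D _ => by simp
  · rw [sum_comm' (t' := univ) (s' := fun _ => univ) (by simp)]
    conv_rhs => rw [sum_comm' (t' := univ) (s' := fun _ => univ) (by simp)]
    refine sum_congr rfl fun C _ => ?_
    rw [sum_comm]
  · obtain ⟨C, -, hC⟩ := exists_ne_zero_of_sum_ne_zero hq
    obtain ⟨D, -, hD⟩ := exists_ne_zero_of_sum_ne_zero hC
    have : f D A = B := by by_contra hne; exact hD (if_neg hne)
    rw [← this]
    exact hf1 D A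
  · have e1 : ∑ A, ∑ B, (∑ C, ∑ D, if f D A = B then G C A D else 0) * moveCost A B
        = ∑ C, ∑ A, ∑ D, G C A D * moveCost A (f D A) := by
      rw [sum_comm (s := univ (α := V → Fin (k + 2)))]
      refine sum_congr rfl fun A _ => ?_
      simp only [sum_mul]
      rw [sum_comm]
      refine sum_congr rfl fun C _ => ?_
      rw [sum_comm]
      exact sum_congr rfl fun D _ => by simp [ite_mul]
    have e2 : T.gapCost (fun D B => ∑ C, ∑ A, if f D A = B then G C A D else 0)
        = ∑ C, ∑ A, ∑ D, G C A D * T.cdist (num D) (T.icnt (f D A).1) := by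
      unfold gapCost
      have : ∑ C, ∑ A, ∑ D, G C A D * T.cdist (num D) (T.icnt (f D A).1)
          = ∑ D, ∑ C, ∑ A, G C A D * T.cdist (num D) (T.icnt (f D A).1) := by
        rw [sum_comm' (s := univ) (t := fun _ => univ) (t' := univ) (s' := fun _ => univ) (by simp)]
        conv_rhs => rw [sum_comm]
        conv_rhs => enter [2, C]; rw [sum_comm]
        rw [sum_comm]
      rw [this]
      refine sum_congr rfl fun D _ => ?_
      simp only [sum_mul]
      rw [sum_comm]
      refine sum_congr rfl fun C _ => ?_
      rw [sum_comm]
      exact sum_congr rfl fun A _ => by simp [ite_mul]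
    have e3 : T.gapCost γ = ∑ C, ∑ A, ∑ D, G C A D * T.cdist (num C) (T.icnt A.1) := by
      unfold gapCost
      exact sum_congr rfl fun C _ => sum_congr rfl fun A _ => by rw [← sum_mul, hGD]
    have e4 : ∑ C, ∑ A, ∑ D, G C A D * T.cdist (num C) (num D)
        ≤ 2 * kcost (fun C D => T.cdist (num C) (num D)) π κ := by
      unfold kcost
      rw [mul_sum]
      refine sum_le_sum fun C _ => ?_
      rw [sum_comm, mul_sum]
      refine sum_le_sum fun D _ => ?_
      rw [← sum_mul, hGA]
      have h1 := mul_nonneg (mul_nonneg (h.bal.law.nonneg C) ((k1 C).nonneg D))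
        (T.cdist_nonneg (num C) (num D))
      split_ifs
      · linarith
      · linarith
    have e5 : ∀ C A D, G C A D * moveCost A (f D A) ≤ α * (G C A D * T.cdist (num C) (num D)
        + G C A D * T.cdist (num C) (T.icnt A.1)
        - G C A D * T.cdist (num D) (T.icnt (f D A).1)) := by
      intro C A D
      rcases (hG0 C A D).lt_or_eq with hpos | h0
      · have hκ : κ C D ≠ 0 := right_ne_zero_of_mul hpos.ne'
        have hγ : γ C A ≠ 0 := left_ne_zero_of_mul hpos.ne'
        have hγ' : 0 < ∑ A, γ C A := lt_of_lt_of_le ((h.nonneg C A).lt_of_ne' hγ)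
          (single_le_sum (fun A _ => h.nonneg C A) (mem_univ A))
        rw [h.marg] at hγ'
        have hroot : num C T.root = k := by
          by_contra hne
          rw [if_neg hne] at hγ'
          exact lt_irrefl _ hγ'
        rw [if_pos hroot] at hγ'
        have hD : 0 < π' D := lt_of_lt_of_le
          (mul_pos (by linarith) (((k1 C).nonneg D).lt_of_ne' hκ))
          (single_le_sum (f := fun C => π C * κ C D)
            (fun C _ => mul_nonneg (h.bal.law.nonneg C) ((k1 C).nonneg D)) (mem_univ C))
        have hrD : num D T.root = k := by
          rw [← hroot]; simp only [num, k2 C D hκ]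
        have h1 := hf2 D A hD hrD
        have h2 := T.cdist_triangle (num D) (num C) (T.icnt A.1)
        rw [T.cdist_comm (num D) (num C)] at h2
        have h3 : moveCost A (f D A) ≤ α * (T.cdist (num C) (num D)
            + T.cdist (num C) (T.icnt A.1) - T.cdist (num D) (T.icnt (f D A).1)) :=
          h1.trans (mul_le_mul_of_nonneg_left (by linarith) hα)
        have := mul_le_mul_of_nonneg_left h3 hpos.le
        linarith
      · simp [← h0]
    have e6 := sum_le_sum fun C (_ : C ∈ univ) => sum_le_sum fun A (_ : A ∈ univ) =>
      sum_le_sum fun D (_ : D ∈ univ) => e5 C A D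
    simp only [← mul_sum, sum_add_distrib, sum_sub_distrib] at e6
    rw [← e3, ← e2, ← e1] at e6
    have e7 := hpot A'.1 A'.2 hA'
    have e8 := T.wdist_infl_le hk1 x x'
    unfold pot fracPot
    have e9 : ∑ C, ∑ A, ∑ D, G C A D * T.cdist (num C) (num D) ≤ 576 *
        (8 * lam k * T.ent (offs k) A'.1 x + T.treeEnt (T.mass x)
        - (8 * lam k * T.ent (offs k) A'.1 x' + T.treeEnt (T.mass x'))) := by linarith
    have := mul_le_mul_of_nonneg_left e9 hα
    linarith

end Fin

end LevelTree

namespace LevelTree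

section Fin

open KServer

variable {V X : Type*} {T : LevelTree V X} [Fintype V] [DecidableEq V] [Fintype X]
variable [MetricSpace X] {k : ℕ} {α β : ℝ}

lemma sum_config {M : Type*} [AddCommMonoid M] (A B : Config X k)
    (e : {x // x ∈ A.1} ≃ {x // x ∈ B.1}) (f : X → M) :
    ∑ b ∈ B.1, f b = ∑ a : {x // x ∈ A.1}, f (e a) := by
  rw [← sum_coe_sort, ← e.sum_comp]

lemma mul_wdist_le_moveCost
    (hlb : ∀ x y : X, β * T.cdist (T.anc (T.leaf x)) (T.anc (T.leaf y)) ≤ dist x y)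
    (hβ : 0 ≤ β) (A B : Config X k) :
    β * T.wdist (fun v => T.cnt A.1 v) (fun v => T.cnt B.1 v) ≤ moveCost A B := by
  refine le_moveCost fun e => ?_
  refine le_trans ?_ (sum_le_sum fun a _ => hlb a (e a))
  rw [← mul_sum]
  refine mul_le_mul_of_nonneg_left ?_ hβ
  unfold cdist wdist
  rw [sum_comm]
  refine sum_le_sum fun v _ => ?_
  rw [← mul_sum]
  refine mul_le_mul_of_nonneg_left ?_ (T.w_pos v).le
  have h1 : ∀ A : Finset X, (T.cnt A v : ℝ) = ∑ a ∈ A, (T.anc (T.leaf a) v : ℝ) := fun A => by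
    have := T.icnt_eq A v
    unfold icnt at this
    exact_mod_cast this
  beta_reduce
  rw [h1, h1, sum_config A B e, ← sum_coe_sort A.1, ← sum_sub_distrib]
  exact abs_sum_le_sum_abs _ _

lemma pot_le (hα : 0 ≤ α) (hβ : 0 < β) (hk1 : 1 ≤ k)
    (hlb : ∀ x y : X, β * T.cdist (T.anc (T.leaf x)) (T.anc (T.leaf y)) ≤ dist x y)
    {x : V → ℕ → ℝ} (hx : x ∈ Set.Icc (0 : V → ℕ → ℝ) 1)
    (γ : (V → Fin (k + 2)) → Config X k → ℝ) (A B : Config X k) :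
    T.pot α x γ B ≤ T.pot α x γ A
      + α / β * (4608 * lam k * -Real.log (offs k)) * moveCost A B := by
  have h1 := ent_sub_le (T := T) (offs_pos k) (offs_le hk1) hx A.1 B.1
  have h2 := mul_wdist_le_moveCost hlb hβ.le A B
  have h3 := lam_nonneg k
  have h4 : 0 ≤ -Real.log (offs k) := by
    have := Real.log_nonpos (offs_pos k).le (by linarith [offs_le hk1]); linarith
  set W := T.wdist (fun v => (T.cnt A.1 v : ℝ)) (fun v => (T.cnt B.1 v : ℝ))
  have h5 : T.pot α x γ B - T.pot α x γ A
      = α * 4608 * lam k * (T.ent (offs k) B.1 x - T.ent (offs k) A.1 x) := by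
    unfold pot fracPot; ring
  have h6 := mul_le_mul_of_nonneg_left h1 (show 0 ≤ α * 4608 * lam k by positivity)
  have h7 : W ≤ moveCost A B / β := by rwa [le_div_iff₀ hβ, mul_comm]
  have h8 := mul_le_mul_of_nonneg_left h7
    (show 0 ≤ α * 4608 * lam k * -Real.log (offs k) by positivity)
  have h9 : α / β * (4608 * lam k * -Real.log (offs k)) * moveCost A B
      = α * 4608 * lam k * -Real.log (offs k) * (moveCost A B / β) := by ring
  rw [h9]
  linarith

lemma exists_pot_bound (T : LevelTree V X) (α : ℝ) (hα : 0 ≤ α) (hk : k ≤ Fintype.card X) :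
    ∃ b, ∀ x π γ, T.Good k x π γ → ∀ A : Config X k, |T.pot α x γ A| ≤ b := by
  obtain ⟨B1, hB1⟩ := T.exists_ent_bound (offs_pos k)
  obtain ⟨B2, hB2⟩ := T.exists_treeEnt_bound k
  set M : ℝ := ∑ C : V → Fin (k + 2), ∑ A : Config X k, T.cdist (num C) (T.icnt A.1) with hM
  have hM0 : ∀ (C : V → Fin (k + 2)) (A : Config X k), T.cdist (num C) (T.icnt A.1) ≤ M :=
    fun C A => (single_le_sum (f := fun A : Config X k => T.cdist (num C) (T.icnt A.1))
      (fun A _ => T.cdist_nonneg _ _) (mem_univ A)).trans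
      (single_le_sum (f := fun C : V → Fin (k + 2) => ∑ A : Config X k,
        T.cdist (num C) (T.icnt A.1))
      (fun C _ => sum_nonneg fun A _ => T.cdist_nonneg _ _) (mem_univ C))
  refine ⟨α * (2 * M + 576 * (8 * lam k * B1 + B2)), fun x π γ h A => ?_⟩
  unfold pot
  rw [abs_mul, abs_of_nonneg hα]
  refine mul_le_mul_of_nonneg_left ((abs_add_le _ _).trans (add_le_add ?_ ?_)) hα
  · have hM' : 0 ≤ M := sum_nonneg fun C _ => sum_nonneg fun A _ => T.cdist_nonneg _ _
    unfold gapCost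
    rw [abs_of_nonneg (sum_nonneg fun C _ => sum_nonneg fun A _ =>
      mul_nonneg (h.nonneg C A) (T.cdist_nonneg _ _))]
    calc ∑ C, ∑ A, γ C A * T.cdist (num C) (T.icnt A.1)
        ≤ ∑ C, ∑ A, γ C A * M := sum_le_sum fun C _ => sum_le_sum fun A _ =>
          mul_le_mul_of_nonneg_left (hM0 C A) (h.nonneg C A)
      _ = (∑ C, if num C T.root = k then 2 * π C else 0) * M := by
          rw [sum_mul]
          exact sum_congr rfl fun C _ => by rw [← sum_mul, h.marg]
      _ ≤ (∑ C, 2 * π C) * M := by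
          refine mul_le_mul_of_nonneg_right (sum_le_sum fun C _ => ?_) hM'
          have := h.bal.law.nonneg C
          split_ifs <;> linarith
      _ = 2 * M := by rw [← mul_sum, h.bal.law.sum, mul_one]
  · rw [abs_mul, abs_of_nonneg (by norm_num : (0 : ℝ) ≤ 576)]
    refine mul_le_mul_of_nonneg_left ((abs_add_le _ _).trans (add_le_add ?_ ?_)) (by norm_num)
    · have := lam_nonneg k
      rw [abs_mul, abs_of_nonneg (by positivity : 0 ≤ 8 * lam k)]
      exact mul_le_mul_of_nonneg_left (hB1 A.1 x (h.feas.mem_Icc h.cap)) (by positivity)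
    · exact hB2 _ (h.feas.isMass h.cap hk)

/-- The relaxed state with all servers at the root. -/
def rootState (T : LevelTree V X) (k : ℕ) : V → ℕ → ℝ :=
  fun v i => if v = T.root ∧ i < k then 0 else 1

lemma rootState_le (v : V) (i : ℕ) : T.rootState k v i ≤ 1 := by
  unfold rootState; split_ifs <;> norm_num

lemma psum_rootState {v : V} (hv : v ≠ T.root) (m : ℕ) : psum (T.rootState k) v m = m := by
  simp [psum, rootState, hv]

lemma rootState_feas (hk : k ≤ Fintype.card X) : T.Feas k (T.rootState k) where
  root i := by simp [rootState]
  top v i hi := by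
    refine if_neg ?_
    rintro ⟨rfl, h⟩
    rw [nn, T.cnt_root, card_univ] at hi
    omega
  mono v i _ := by
    unfold rootState
    by_cases h2 : v = T.root ∧ i + 1 < k
    · rw [if_pos h2, if_pos ⟨h2.1, by omega⟩]
    · rw [if_neg h2]; split_ifs <;> norm_num
  cons p hp m _ := by
    rw [sum_congr rfl fun c hc => psum_rootState (T.ne_root_of_ch hc) (m c), ← Nat.cast_sum]
    unfold psum
    refine (sum_le_sum fun i _ => rootState_le (T := T) (k := k) p i).trans (le_of_eq ?_)
    simp

/-- `a` servers at the root. -/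
def rootConfig (T : LevelTree V X) (k : ℕ) (a : Fin (k + 2)) : V → Fin (k + 2) :=
  fun v => if v = T.root then a else 0

lemma slk_of_root {M : Type*} [AddCommGroup M] {N : V → M} (h : ∀ v, v ≠ T.root → N v = 0) (v : V) :
    T.slk N v = N v := by
  rw [slk, sum_eq_zero fun c hc => h c (T.ne_root_of_ch hc), sub_zero]

lemma near_half (k : ℕ) {j : ℤ} (hj : j = k ∨ j = k + 1) : Near ((k : ℝ) + 1 / 2) j := by
  intro i
  constructor
  · intro hi
    have : (i : ℝ) < (k + 1 : ℤ) := by push_cast; linarith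
    have : i < (k + 1 : ℤ) := by exact_mod_cast this
    omega
  · intro hi
    have : ((k : ℤ) : ℝ) < i := by push_cast; linarith
    have : (k : ℤ) < i := by exact_mod_cast this
    omega

theorem exists_good [DecidableEq X] (T : LevelTree V X) (hk1 : 1 ≤ k) (hk : k ≤ Fintype.card X)
    (A0 : Config X k) :
    ∃ x π γ, T.Good k x π γ ∧ ∀ f : Config X k → ℝ, ∑ A, (∑ C, γ C A) * f A = f A0 := by
  have hk0 : (0 : ℝ) < k := by exact_mod_cast hk1
  set a : Fin (k + 2) := ⟨k, by omega⟩ with ha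
  set b : Fin (k + 2) := ⟨k + 1, by omega⟩ with hb
  have hab : a ≠ b := by simp [ha, hb]
  have hne : T.rootConfig k a ≠ T.rootConfig k b := fun h => hab (by
    simpa [rootConfig] using congrFun h T.root)
  have hinfl : ∀ v, T.infl k (T.rootState k) v = if v = T.root then (k : ℝ) + 1 / 2 else 0 := by
    intro v
    split_ifs with hv
    · subst hv
      exact ((rootState_feas hk).infl_isMass rootState_le hk1 hk).root
    · unfold infl mass
      rw [psum_rootState hv, sub_self, mul_zero]
  have hlaw : IsLaw fun C => (if C = T.rootConfig k a then (1 / 2 : ℝ) else 0)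
      + if C = T.rootConfig k b then 1 / 2 else 0 :=
    ⟨fun C => by split_ifs <;> norm_num, by
      rw [sum_add_distrib]; simp; norm_num⟩
  have hslk : ∀ v, T.slk (T.infl k (T.rootState k)) v = T.infl k (T.rootState k) v :=
    slk_of_root fun v hv => by rw [hinfl, if_neg hv]
  have hround : ∀ c : Fin (k + 2), ((c : ℕ) : ℤ) = k ∨ ((c : ℕ) : ℤ) = k + 1 →
      T.IsRounding (T.infl k (T.rootState k)) (num (T.rootConfig k c)) := by
    intro c hc v
    have h1 : Near (T.infl k (T.rootState k) v) (num (T.rootConfig k c) v) := by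
      rw [hinfl]
      unfold num rootConfig
      split_ifs
      · exact near_half k hc
      · intro j; simp
    refine ⟨h1, ?_⟩
    rw [hslk, slk_of_root]
    · exact h1
    · intro v hv
      simp [num, rootConfig, hv]
  refine ⟨T.rootState k, _, fun C A => if C = T.rootConfig k a ∧ A = A0 then 1 else 0,
    ⟨rootState_feas hk, rootState_le, balanced_of hlaw (fun v => ?_) (fun C hC => ?_),
      fun C A => by split_ifs <;> norm_num, fun C => ?_⟩, fun f => ?_⟩
  · rw [hinfl]
    simp only [add_mul, sum_add_distrib, ite_mul, zero_mul, sum_ite_eq', mem_univ, if_true]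
    by_cases hv : v = T.root
    · simp [num, rootConfig, hv, ha, hb]; ring
    · simp [num, rootConfig, hv]
  · by_cases h1 : C = T.rootConfig k a
    · rw [h1]; exact hround a (Or.inl (by simp [ha]))
    · by_cases h2 : C = T.rootConfig k b
      · rw [h2]; exact hround b (Or.inr (by simp [hb]))
      · simp [h1, h2] at hC
  · by_cases h1 : C = T.rootConfig k a
    · subst h1
      rw [if_pos (by simp [num, rootConfig, ha]), if_pos rfl, if_neg hne]
      simp
    · by_cases h2 : C = T.rootConfig k b
      · subst h2
        rw [if_neg (by simp [num, rootConfig, hb])]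
        simp [h1]
      · simp [h1, h2]
  · have : ∀ A, ∑ C, (if C = T.rootConfig k a ∧ A = A0 then (1 : ℝ) else 0)
        = if A = A0 then 1 else 0 := by
      intro A
      by_cases hA : A = A0 <;> simp [hA]
    simp [this]

/-- The `k`-server algorithm on metric spaces that are approximated by a levelled tree. -/
theorem exists_alg (T : LevelTree V X) (hα : 0 ≤ α) (hβ : 0 < β)
    (hub : ∀ x y : X, dist x y ≤ α * T.cdist (T.anc (T.leaf x)) (T.anc (T.leaf y)))
    (hlb : ∀ x y : X, β * T.cdist (T.anc (T.leaf x)) (T.anc (T.leaf y)) ≤ dist x y)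
    (hk1 : 1 ≤ k) (hk : k ≤ Fintype.card X) :
    ∃ b : ℝ, ∀ A : Config X k, ∃ alg : OnlineAlgorithm X k,
      alg.IsCompetitive A (α / β * (4608 * lam k * -Real.log (offs k))) b := by
  classical
  obtain ⟨b, hb⟩ := exists_pot_bound (k := k) T α hα hk
  refine ⟨2 * b, fun A0 => ?_⟩
  let S := {s : (V → ℕ → ℝ) × ((V → Fin (k + 2)) → ℝ) × ((V → Fin (k + 2)) → Config X k → ℝ) //
    T.Good k s.1 s.2.1 s.2.2}
  have hstep : ∀ (s : S) (r : X), ∃ s' : S, ∃ q : Config X k → Config X k → ℝ, (∀ A B, 0 ≤ q A B) ∧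
      (∀ A, ∑ B, q A B = ∑ C, s.1.2.2 C A) ∧ (∀ B, ∑ A, q A B = ∑ C, s'.1.2.2 C B) ∧
      (∀ A B, q A B ≠ 0 → r ∈ B.1) ∧
      ∀ A' : Config X k, r ∈ A'.1 → ∑ A, ∑ B, q A B * moveCost A B + T.pot α s'.1.1 s'.1.2.2 A'
        ≤ T.pot α s.1.1 s.1.2.2 A' := fun s r => by
    obtain ⟨x', π', γ', hg, q, h⟩ := s.2.exists_step hα hub hk1 hk r
    exact ⟨⟨(x', π', γ'), hg⟩, q, h⟩
  choose next q hq0 hq1 hq2 hq3 hq4 using hstep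
  obtain ⟨x, π, γ, hg, hμ⟩ := T.exists_good hk1 hk A0
  refine exists_competitive (μ := fun (s : S) A => ∑ C, s.1.2.2 C A) (next := next) (q := q)
    (pot := fun s A => T.pot α s.1.1 s.1.2.2 A) ⟨(x, π, γ), hg⟩ A0 (fun r => ?_) hq0 hq1 hq2 hq3 hμ
    (fun s r A' B' hr => ?_) (fun s A => hb _ _ _ s.2 A)
  · obtain ⟨B, hB, -, hBc⟩ := Finset.exists_subsuperset_card_eq (s := {r}) (t := univ) (n := k)
      (by simp) (by simpa) (by simpa)
    exact ⟨⟨B, hBc⟩, hB (mem_singleton_self r)⟩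
  · exact (hq4 s r B' hr).trans
      (pot_le hα hβ hk1 hlb (s.2.feas.mem_Icc s.2.cap) _ A' B')

end Fin

end LevelTree

lemma dyadic_sum {t : ℝ} (ht : t ≤ 1) (D : ℕ) :
    (t ≤ (1 / 2) ^ D →
      ∑ j ∈ range (D + 1), (if t ≤ (1 / 2) ^ j then 0 else (1 / 2 : ℝ) ^ j) = 0) ∧
    ((1 / 2) ^ D < t →
      ∑ j ∈ range (D + 1), (if t ≤ (1 / 2) ^ j then 0 else (1 / 2 : ℝ) ^ j) + (1 / 2) ^ D ≤ 2 * t ∧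
      t ≤ 2 * ∑ j ∈ range (D + 1), (if t ≤ (1 / 2) ^ j then 0 else (1 / 2 : ℝ) ^ j)) := by
  induction D with
  | zero =>
    refine ⟨fun _ => by simp [ht], fun h => ?_⟩
    simp at h; linarith
  | succ D ih =>
    have e : (1 / 2 : ℝ) ^ (D + 1) = (1 / 2) ^ D / 2 := by rw [pow_succ]; ring
    have hp : (0 : ℝ) < (1 / 2) ^ D := by positivity
    refine ⟨fun h => ?_, fun h => ?_⟩
    · rw [sum_range_succ, ih.1 (by linarith), if_pos h, add_zero]
    · rw [sum_range_succ, if_neg (not_le.2 h)]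
      rcases le_or_gt t ((1 / 2) ^ D) with h1 | h1
      · rw [ih.1 h1]
        constructor <;> linarith
      · obtain ⟨h2, h3⟩ := ih.2 h1
        constructor <;> linarith

namespace LevelTree

section Leaves

variable {V X : Type*} {T : LevelTree V X} [Fintype V] [DecidableEq V] [Fintype X]

lemma cdist_leaf (x y : X) : T.cdist (T.anc (T.leaf x)) (T.anc (T.leaf y))
    = ∑ j ∈ range (T.depth + 1), (if T.Below (T.pth x j) (T.leaf y) then 0 else (1 / 2 : ℝ) ^ j)
      + ∑ j ∈ range (T.depth + 1),
        (if T.Below (T.pth y j) (T.leaf x) then 0 else (1 / 2 : ℝ) ^ j) := by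
  have key : ∀ x y : X,
      ∑ j ∈ range (T.depth + 1), (if T.Below (T.pth x j) (T.leaf y) then 0 else (1 / 2 : ℝ) ^ j)
        = ∑ v, if T.Below v (T.leaf x) then (if T.Below v (T.leaf y) then 0 else T.w v) else 0 := by
    intro x y
    rw [← sum_filter, T.sum_path x]
    refine sum_congr rfl fun j hj => ?_
    rw [w, T.lev_pth x (by simp at hj; omega)]
  rw [key, key, ← sum_add_distrib]
  unfold cdist wdist
  refine sum_congr rfl fun v _ => ?_
  simp only [anc]
  by_cases h1 : T.Below v (T.leaf x) <;> by_cases h2 : T.Below v (T.leaf y) <;> simp [h1, h2]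

end Leaves

end LevelTree

section Ultra

/-- Two points are equivalent at level `j` if their distance is at most `R / 2 ^ j`. -/
def levelSetoid {X : Type*} {u : X → X → ℝ} (h0 : ∀ x, u x x = 0) (hs : ∀ x y, u x y = u y x)
    (hu : ∀ x y z, u x z ≤ max (u x y) (u y z)) {R : ℝ} (hR : 0 < R) (D : ℕ) :
    Setoid (Fin (D + 1) × X) where
  r p q := p.1 = q.1 ∧ u p.2 q.2 ≤ R * (1 / 2) ^ (p.1 : ℕ)
  iseqv :=
    { refl := fun p => ⟨rfl, by rw [h0]; positivity⟩
      symm := fun {p q} h => ⟨h.1.symm, by rw [hs, ← h.1]; exact h.2⟩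
      trans := fun {p q r} h h' => ⟨h.1.trans h'.1, (hu _ q.2 _).trans (max_le h.2 (by
        rw [h.1]; exact h'.2))⟩ }

/-- A finite ultrametric space is approximated by the leaves of a levelled tree. -/
theorem exists_levelTree.{u₁} {X : Type u₁} [Fintype X] [Nonempty X] {u : X → X → ℝ}
    (h0 : ∀ x, u x x = 0)
    (hs : ∀ x y, u x y = u y x) (hu : ∀ x y z, u x z ≤ max (u x y) (u y z))
    (hpos : ∀ x y, x ≠ y → 0 < u x y) :
    ∃ (V : Type u₁) (_ : Fintype V) (_ : DecidableEq V) (T : LevelTree V X) (R : ℝ), 0 < R ∧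
      ∀ x y, R / 4 * T.cdist (T.anc (T.leaf x)) (T.anc (T.leaf y)) ≤ u x y ∧
        u x y ≤ R * T.cdist (T.anc (T.leaf x)) (T.anc (T.leaf y)) := by
  classical
  have hnn : ∀ x y, 0 ≤ u x y := fun x y => by
    rcases eq_or_ne x y with rfl | h
    · rw [h0]
    · exact (hpos x y h).le
  obtain ⟨R, hR, hmax⟩ : ∃ R : ℝ, 0 < R ∧ ∀ x y, u x y ≤ R := by
    obtain ⟨M, hM⟩ := (Set.finite_range fun p : X × X => u p.1 p.2).bddAbove
    exact ⟨max M 1, by positivity, fun x y => (hM ⟨(x, y), rfl⟩).trans (le_max_left _ _)⟩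
  obtain ⟨D, hD0, hD⟩ : ∃ D : ℕ, 0 < D ∧ ∀ x y, x ≠ y → R * (1 / 2) ^ D < u x y := by
    have h1 : Filter.Tendsto (fun D : ℕ => R * (1 / 2 : ℝ) ^ D) Filter.atTop (nhds (R * 0)) :=
      (tendsto_pow_atTop_nhds_zero_of_lt_one (by norm_num) (by norm_num)).const_mul R
    rw [mul_zero] at h1
    have h2 : ∀ᶠ D : ℕ in Filter.atTop, ∀ p : X × X, p.1 ≠ p.2 → R * (1 / 2) ^ D < u p.1 p.2 := by
      refine Filter.eventually_all.2 fun p => ?_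
      by_cases hp : p.1 = p.2
      · exact Filter.Eventually.of_forall fun _ h => absurd hp h
      · exact (h1.eventually (gt_mem_nhds (hpos _ _ hp))).mono fun _ h _ => h
    obtain ⟨D, hD, hD0⟩ := (h2.and (Filter.eventually_gt_atTop 0)).exists
    exact ⟨D, hD0, fun x y h => hD (x, y) h⟩
  let s := levelSetoid h0 hs hu hR D
  let V := Quotient s
  have heq : ∀ p q : Fin (D + 1) × X, (Quotient.mk s p = Quotient.mk s q) ↔
      p.1 = q.1 ∧ u p.2 q.2 ≤ R * (1 / 2) ^ (p.1 : ℕ) := fun p q => Quotient.eq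
  let par : V → V := Quotient.map
    (fun p : Fin (D + 1) × X => ((⟨p.1.1 - 1, by omega⟩ : Fin (D + 1)), p.2)) (by
      rintro ⟨i, x⟩ ⟨j, y⟩ ⟨h1, h2⟩
      simp only at h1 h2
      subst h1
      refine ⟨rfl, h2.trans (mul_le_mul_of_nonneg_left ?_ hR.le)⟩
      exact pow_le_pow_of_le_one (by norm_num) (by norm_num) (Nat.sub_le _ _))
  let lev : V → ℕ := Quotient.lift (fun p : Fin (D + 1) × X => (p.1 : ℕ)) (by
      rintro p q ⟨h1, -⟩; simp only [h1])
  obtain ⟨x0⟩ := ‹Nonempty X›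
  let T : LevelTree V X :=
    { root := Quotient.mk s (0, x0)
      par := par
      lev := lev
      depth := D
      leaf := fun x => Quotient.mk s (Fin.last D, x)
      depth_pos := hD0
      lev_root := rfl
      lev_par := by
        intro v
        induction v using Quotient.inductionOn with
        | h p =>
        intro hv
        change (p.1 : ℕ) = (p.1 : ℕ) - 1 + 1
        have : (p.1 : ℕ) ≠ 0 := by
          intro hp
          refine hv ((heq _ _).2 ⟨Fin.ext hp, ?_⟩)
          rw [hp, pow_zero, mul_one]
          exact hmax _ _
        omega
      lev_le := by
        intro v
        induction v using Quotient.inductionOn with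
        | h p => exact Nat.lt_succ_iff.1 p.1.2
      lev_leaf := fun x => rfl
      leaf_inj := by
        intro x y hxy
        by_contra hne
        have := ((heq _ _).1 hxy).2
        exact absurd this (not_le.2 (hD x y hne))
      leaf_surj := by
        intro v
        induction v using Quotient.inductionOn with
        | h p =>
        intro hp
        have : p.1 = Fin.last D := Fin.ext hp
        exact ⟨p.2, by rw [← this]⟩ }
  have hfin : Finite V := inferInstanceAs (Finite (Quotient s))
  let _ : Fintype V := Fintype.ofFinite V
  have hiter : ∀ (x : X) (i : ℕ), par^[i] (Quotient.mk s (Fin.last D, x))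
      = Quotient.mk s (⟨D - i, by omega⟩, x) := by
    intro x i
    induction i with
    | zero => rfl
    | succ i ih => rw [Function.iterate_succ_apply', ih]; rfl
  have hpth : ∀ (x : X) (j : ℕ) (hj : j ≤ D), T.pth x j = Quotient.mk s (⟨j, by omega⟩, x) := by
    intro x j hj
    refine (hiter x (D - j)).trans ?_
    have : D - (D - j) = j := by omega
    simp only [this]
  have hbelow : ∀ (x y : X) (j : ℕ), j ≤ D →
      (T.Below (T.pth x j) (T.leaf y) ↔ u x y / R ≤ (1 / 2) ^ j) := by
    intro x y j hj
    rw [div_le_iff₀ hR, mul_comm]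
    have h1 : T.Below (T.pth x j) (T.leaf y) ↔ T.pth x j = T.pth y j := by
      constructor
      · intro h
        have := T.eq_pth h
        rwa [T.lev_pth x hj] at this
      · intro h
        rw [h]
        exact T.below_pth y hj
    rw [h1, hpth x j hj, hpth y j hj, heq]
    exact ⟨fun h => h.2, fun h => ⟨rfl, h⟩⟩
  refine ⟨V, inferInstance, inferInstance, T, R, hR, fun x y => ?_⟩
  have hc : T.cdist (T.anc (T.leaf x)) (T.anc (T.leaf y))
      = 2 * ∑ j ∈ range (D + 1), (if u x y / R ≤ (1 / 2) ^ j then 0 else (1 / 2 : ℝ) ^ j) := by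
    rw [LevelTree.cdist_leaf, two_mul]
    congr 1
    · refine sum_congr rfl fun j hj => ?_
      simp only [hbelow x y j (Nat.lt_succ_iff.1 (mem_range.1 hj))]
    · refine sum_congr rfl fun j hj => ?_
      simp only [hbelow y x j (Nat.lt_succ_iff.1 (mem_range.1 hj)), hs y x]
  obtain ⟨d1, d2⟩ := dyadic_sum ((div_le_one hR).2 (hmax x y)) D
  rw [hc]
  rcases eq_or_ne x y with rfl | hne
  · rw [h0, zero_div] at *
    rw [d1 (by positivity)]
    simp
  · obtain ⟨d3, d4⟩ := d2 (by rw [lt_div_iff₀ hR, mul_comm]; exact hD x y hne)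
    have hp : (0 : ℝ) < (1 / 2) ^ D := by positivity
    have e : u x y = R * (u x y / R) := by field_simp
    constructor
    · rw [e]
      have := mul_le_mul_of_nonneg_left (show ∑ j ∈ range (D + 1),
        (if u x y / R ≤ (1 / 2) ^ j then 0 else (1 / 2 : ℝ) ^ j) ≤ 2 * (u x y / R) by linarith) hR.le
      rw [← e]
      linarith
    · have := mul_le_mul_of_nonneg_left d4 hR.le
      linarith

end Ultra

namespace KServer.RootedTree

variable {V : Type*} (T : RootedTree V)

lemma InSubtree.trans {a b v : V} (h : T.InSubtree a b) (h' : T.InSubtree b v) :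
    T.InSubtree a v := by
  obtain ⟨i, rfl⟩ := h
  obtain ⟨j, rfl⟩ := h'
  exact ⟨i + j, Function.iterate_add_apply _ _ _ _⟩

/-- The edges above `x` that are not above `y` have geometrically decreasing lengths. -/
lemma sum_side_le [Fintype V] {τ : ℝ} (hτ : τ ≤ 1 / 10) (hT : T.IsHST τ) (x y : V) {M : ℝ}
    (hM0 : 0 ≤ M) (hM : ∀ a, T.InSubtree a x → ¬ T.InSubtree a y → T.len a ≤ M) :
    open Classical in
    ∑ a ∈ univ.filter (fun a => T.InSubtree a x ∧ ¬ T.InSubtree a y), T.len a ≤ 10 / 9 * M := by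
  classical
  have hroot : ∀ v, T.InSubtree T.root v := T.reaches_root
  have hex : ∃ i, T.InSubtree (T.parent^[i] x) y := by
    obtain ⟨i, hi⟩ := T.reaches_root x
    exact ⟨i, by rw [hi]; exact hroot y⟩
  set m := Nat.find hex with hm
  have hlt : ∀ i, i < m → ¬ T.InSubtree (T.parent^[i] x) y := fun i hi => Nat.find_min hex hi
  have hne : ∀ i, i < m → T.parent^[i] x ≠ T.root := fun i hi e => hlt i hi (by
    rw [e]; exact hroot y)
  have hsub : univ.filter (fun a => T.InSubtree a x ∧ ¬ T.InSubtree a y)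
      ⊆ (range m).image fun i => T.parent^[i] x := by
    intro a ha
    simp only [mem_filter, mem_univ, true_and] at ha
    obtain ⟨⟨i, rfl⟩, h⟩ := ha
    refine mem_image.2 ⟨i, mem_range.2 ?_, rfl⟩
    by_contra! hi
    refine h (InSubtree.trans T ⟨i - m, ?_⟩ (Nat.find_spec hex))
    rw [← Function.iterate_add_apply, Nat.sub_add_cancel hi]
  have hpos : ∀ i ∈ range m, 0 ≤ T.len (T.parent^[i] x) := fun i hi =>
    (T.len_pos _ (hne i (mem_range.1 hi))).le
  have h1 : ∑ a ∈ univ.filter (fun a => T.InSubtree a x ∧ ¬ T.InSubtree a y), T.len a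
      ≤ ∑ i ∈ range m, T.len (T.parent^[i] x) := by
    refine (sum_le_sum_of_subset_of_nonneg hsub fun a ha _ => ?_).trans
      (sum_image_le_of_nonneg fun a ha => ?_)
    all_goals
      obtain ⟨i, hi, rfl⟩ := mem_image.1 ha
      exact hpos i hi
  refine h1.trans ?_
  have key : ∀ n, n < m → ∑ i ∈ range (n + 1), T.len (T.parent^[i] x)
      ≤ 10 / 9 * T.len (T.parent^[n] x) := by
    intro n
    induction n with
    | zero =>
      intro h
      have := T.len_pos _ (hne 0 h)
      simp only [zero_add, sum_range_one]
      linarith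
    | succ n ih =>
      intro h
      have h2 := ih (by omega)
      have h3 := hT _ (hne n (by omega)) (by
        rw [← Function.iterate_succ_apply' T.parent]; exact hne _ h)
      rw [← Function.iterate_succ_apply' T.parent] at h3
      have h4 := T.len_pos _ (hne _ h)
      rw [sum_range_succ]
      nlinarith
  rcases Nat.eq_zero_or_pos m with h0 | h0
  · rw [h0, range_zero, sum_empty]; positivity
  · have h2 := key (m - 1) (by omega)
    rw [Nat.sub_add_cancel h0] at h2
    have h3 := hM (T.parent^[m - 1] x) ⟨m - 1, rfl⟩ (hlt _ (by omega))
    linarith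

open Classical in
/-- The length of the longest edge between `x` and `y`. -/
noncomputable def maxLen [Fintype V] (x y : V) : NNReal :=
  (univ.filter fun a => Xor (T.InSubtree a x) (T.InSubtree a y)).sup fun a => (T.len a).toNNReal

variable [Fintype V]

lemma maxLen_self (x : V) : T.maxLen x x = 0 := by simp [maxLen]

lemma maxLen_comm (x y : V) : T.maxLen x y = T.maxLen y x := by
  unfold maxLen
  congr 1
  ext a
  simp only [mem_filter, mem_univ, true_and]
  unfold Xor
  tauto

lemma le_maxLen {a x y : V} (h : Xor (T.InSubtree a x) (T.InSubtree a y)) :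
    (T.len a).toNNReal ≤ T.maxLen x y := by
  classical
  exact le_sup (f := fun a => (T.len a).toNNReal) (by simpa using h)

lemma maxLen_ultra (x y z : V) : T.maxLen x z ≤ max (T.maxLen x y) (T.maxLen y z) := by
  classical
  refine Finset.sup_le fun a ha => ?_
  simp only [mem_filter, mem_univ, true_and] at ha
  by_cases h : Xor (T.InSubtree a x) (T.InSubtree a y)
  · exact le_max_of_le_left (T.le_maxLen h)
  · refine le_max_of_le_right (T.le_maxLen ?_)
    unfold Xor at *
    tauto

lemma ne_root_of_xor {a x y : V} (h : Xor (T.InSubtree a x) (T.InSubtree a y)) : a ≠ T.root := by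
  rintro rfl
  rcases h with h | h
  · exact h.2 (T.reaches_root y)
  · exact h.2 (T.reaches_root x)

lemma maxLen_le_pathDist (x y : V) : (T.maxLen x y : ℝ) ≤ T.pathDist x y := by
  classical
  have hnn : ∀ a ∈ univ, 0 ≤ if Xor (T.InSubtree a x) (T.InSubtree a y) then T.len a else 0 := by
    intro a _
    split_ifs with h
    · exact (T.len_pos a (T.ne_root_of_xor h)).le
    · exact le_rfl
  have e : T.pathDist x y
      = ∑ a, if Xor (T.InSubtree a x) (T.InSubtree a y) then T.len a else 0 := by
    unfold pathDist
    exact sum_congr rfl fun a _ => by congr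
  have h0 : 0 ≤ T.pathDist x y := by rw [e]; exact sum_nonneg hnn
  rw [← Real.coe_toNNReal _ h0, NNReal.coe_le_coe]
  refine Finset.sup_le fun a ha => Real.toNNReal_le_toNNReal ?_
  simp only [mem_filter, mem_univ, true_and] at ha
  have := single_le_sum hnn (mem_univ a)
  rwa [if_pos ha, ← e] at this

lemma pathDist_le {τ : ℝ} (hτ : τ ≤ 1 / 10) (hT : T.IsHST τ) (x y : V) :
    T.pathDist x y ≤ 20 / 9 * T.maxLen x y := by
  classical
  have hM : ∀ a, Xor (T.InSubtree a x) (T.InSubtree a y) → T.len a ≤ T.maxLen x y := fun a h => by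
    have := T.le_maxLen h
    rw [← NNReal.coe_le_coe] at this
    exact (Real.le_coe_toNNReal _).trans this
  have h1 := T.sum_side_le hτ hT x y (NNReal.coe_nonneg (T.maxLen x y)) fun a h h' => hM a (Or.inl ⟨h, h'⟩)
  have h2 := T.sum_side_le hτ hT y x (NNReal.coe_nonneg (T.maxLen x y)) fun a h h' => hM a (Or.inr ⟨h, h'⟩)
  have e : T.pathDist x y
      = ∑ a ∈ univ.filter (fun a => T.InSubtree a x ∧ ¬ T.InSubtree a y), T.len a
        + ∑ a ∈ univ.filter (fun a => T.InSubtree a y ∧ ¬ T.InSubtree a x), T.len a := by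
    unfold pathDist
    rw [sum_filter, sum_filter, ← sum_add_distrib]
    refine sum_congr rfl fun a _ => ?_
    by_cases h1 : T.InSubtree a x <;> by_cases h2 : T.InSubtree a y <;> simp [h1, h2]
  rw [e]
  linarith

end KServer.RootedTree

namespace KServer

variable {X : Type*} [Fintype X] [MetricSpace X] {k : ℕ}

lemma moveCost_nonneg (A B : Config X k) : 0 ≤ moveCost A B :=
  Real.iInf_nonneg fun _ => sum_nonneg fun _ _ => dist_nonneg

lemma scheduleCost_nonneg (A : Config X k) (Bs : List (Config X k)) : 0 ≤ scheduleCost A Bs := by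
  induction Bs generalizing A with
  | nil => exact le_rfl
  | cons B Bs ih => exact add_nonneg (moveCost_nonneg A B) (ih B)

lemma OnlineAlgorithm.IsCompetitive.mono {alg : OnlineAlgorithm X k} {A : Config X k}
    {c c' b : ℝ} (h : alg.IsCompetitive A c b) (hc : c ≤ c') : alg.IsCompetitive A c' b :=
  fun rs Bs hs => (h rs Bs hs).trans
    (add_le_add_left (mul_le_mul_of_nonneg_right hc (scheduleCost_nonneg A Bs)) b)

end KServer

namespace LevelTree

lemma lam_le {k : ℕ} (hk : 1 ≤ k) : lam k ≤ 5 * (1 + Real.log k) := by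
  have hk0 : (1 : ℝ) ≤ k := by exact_mod_cast hk
  have h1 : Real.log (k + eta) ≤ Real.log 2 + Real.log k := by
    rw [← Real.log_mul (by norm_num) (by positivity)]
    exact Real.log_le_log (by have := eta_pos; positivity) (by unfold eta; linarith)
  have h2 : Real.log eta = -(6 * Real.log 2) := by
    unfold eta
    rw [one_div, Real.log_inv, show (64 : ℝ) = 2 ^ 6 by norm_num, Real.log_pow]
    norm_num
  have h3 := Real.log_two_lt_d9
  have h4 := Real.log_nonneg hk0
  unfold lam
  rw [h2]
  linarith

lemma neg_log_offs_le {k : ℕ} (hk : 1 ≤ k) : -Real.log (offs k) ≤ 2 * (1 + Real.log k) := by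
  have hk0 : (1 : ℝ) ≤ k := by exact_mod_cast hk
  have h1 : Real.log (2 * k + 1) ≤ Real.log (2 ^ 2) + Real.log k := by
    rw [← Real.log_mul (by norm_num) (by positivity)]
    exact Real.log_le_log (by positivity) (by linarith)
  rw [Real.log_pow] at h1
  have h3 := Real.log_two_lt_d9
  have h4 := Real.log_nonneg hk0
  unfold offs
  rw [one_div, Real.log_inv, neg_neg]
  push_cast at h1
  linarith

end LevelTree

theorem mainTheorem2 :
    ∃ C : ℝ, 0 < C ∧
      ∀ (V : Type*) [Fintype V] (T : KServer.RootedTree V) (τ : ℝ),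
        0 < τ → τ ≤ 1 / 10 → T.IsHST τ →
      ∀ (X : Type*) [Fintype X] [MetricSpace X], T.Induces X →
      ∀ k : ℕ, 1 ≤ k → k ≤ Fintype.card X →
        ∃ b : ℝ, ∀ A : KServer.Config X k, ∃ alg : KServer.OnlineAlgorithm X k,
          alg.IsCompetitive A (C * (1 + Real.log k) ^ 2) b := by
  refine ⟨409600, by norm_num, ?_⟩
  intro V _ T τ _ hτ hT X _ _ hX k hk1 hk
  obtain ⟨φ, hφ⟩ := hX
  have hne : Nonempty X := Fintype.card_pos_iff.1 (by omega)
  have hle : ∀ x y : X, (T.maxLen (φ x) (φ y) : ℝ) ≤ dist x y := fun x y => by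
    rw [hφ]; exact T.maxLen_le_pathDist _ _
  have hge : ∀ x y : X, dist x y ≤ 20 / 9 * (T.maxLen (φ x) (φ y) : ℝ) := fun x y => by
    rw [hφ]; exact T.pathDist_le hτ hT _ _
  obtain ⟨W, _, _, L, R, hR, hL⟩ := exists_levelTree
    (u := fun x y : X => (T.maxLen (φ x) (φ y) : ℝ)) (fun x => by rw [T.maxLen_self]; rfl)
    (fun x y => by rw [T.maxLen_comm])
    (fun x y z => by exact_mod_cast T.maxLen_ultra (φ x) (φ y) (φ z))
    (fun x y h => by
      have := dist_pos.2 h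
      have := hge x y
      linarith)
  obtain ⟨b, hb⟩ := L.exists_alg (k := k) (α := 20 / 9 * R) (β := R / 4) (by positivity)
    (by positivity) (fun x y => (hge x y).trans (by linarith [(hL x y).2]))
    (fun x y => (hL x y).1.trans (hle x y)) hk1 hk
  refine ⟨b, fun A => ?_⟩
  obtain ⟨alg, halg⟩ := hb A
  refine ⟨alg, halg.mono ?_⟩
  have h1 := LevelTree.lam_le hk1
  have h2 := LevelTree.neg_log_offs_le hk1
  have h3 := LevelTree.lam_nonneg k
  have h4 : 0 ≤ 1 + Real.log k := by
    have := Real.log_nonneg (show (1 : ℝ) ≤ k by exact_mod_cast hk1); linarith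
  have h5 : 20 / 9 * R / (R / 4) = 80 / 9 := by field_simp; norm_num
  rw [h5]
  have h6 := mul_le_mul_of_nonneg_left h2 h3
  have h7 := mul_le_mul_of_nonneg_right h1 (show 0 ≤ 2 * (1 + Real.log k) by positivity)
  nlinarith
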